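/- **Notation.** Let $p$ be a prime, $m\ge 0$, $d\ge 1$, and let $\Lambda=\mathbb Z[q]_{(p,q-1)}$. For $0\le k'\le k$ put $k''=k-k'$ and let $r,r',r''$ be the integer parts of $k/p^m,k'/p^m,k''/p^m$. Define $$\left\langle {k\atop k'}\right\rangle=\left\langle {k\atop k'}\right\rangle_{(m),q}=\frac{(k)_q!}{(k')_q!\,(k'')_q!}\left(\frac{(r)_{q^{p^m}}!}{(r')_{q^{p^m}}!\,(r'')_{q^{p^m}}!}\right)^{-1}\in\Lambda ,$$ where $(n)_q=1+q+\dots+q^{n-1}$ and $(n)_q!=(1)_q\cdots(n)_q$. For multi-indices $\underline k'\le\underline k$ in $\mathbb N^d$ let $\left\langle{\underline k\atop \underline k'}\right\rangle=\prod_i\left\langle{k_i\atop k'_i}\right\rangle$ and $|\underline k|=\sum_i k_i$. Let $A$ be a commutative $\Lambda$-algebra that is $(p,q-1)$-adically complete (and separated). (In the application $(R,I_R)\to(A,I_A)$ is a morphism of $q^{p^m}$-PD-pairs, $A$ has étale coordinates $\underline x=(x_1,\dots,x_d)$ of rank one over $R$, and the objects below are the left $A$-modules underlying the linearized $q$-jet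 complex of $A/R$.) * $\widehat{A\langle\underline\xi\rangle}$ is the $(p,q-1)$-adic completion of the free left $A$-module with basis $\underline\xi^{\{\underline k\}}$, $\underline k\in\mathbb N^d$. * $\Omega(\bullet)$ is the differential graded $\Lambda$-algebra obtained from the tensor algebra over $\Lambda$ (product written $\otimes'$) on the degree-one generators $(\underline{d\xi})^{(\underline k)_q}$, $\underline k\in\mathbb N^d\setminus\{0\}$, with the differential that satisfies the graded Leibniz rule $d(\omega\otimes'\eta)=d\omega\otimes'\eta+(-1)^{\deg\omega}\omega\otimes' d\eta$ and $$d\bigl((\underline{d\xi})^{(\underline k)_q}\bigr)=-\sum_{0<\underline k'<\underline k}\left\langle{\underline k\atop \underline k'}\right\rangle(\underline{d\xi})^{(\underline k')_q}\otimes'(\underline{d\xi})^{(\underline k-\underline k')_q},$$ by dividing out the DG-ideal generated by the $(\underline{d\xi})^{(\underline k)_q}$ with $|\underline k|>p^m$. * $L\Omega(r)=L\Omega^{(m)}_{A/R,q}(r)=\widehat{A\langle\underline\xi\rangle}\otimes_\Lambda\Omega(r)$ for $r\ge0$, and $L\Omega(-1)=0$. The $A$-linear differential of $L\Omega(\bullet)$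 is $d(y\otimes z)=d^0(y)\,z+y\otimes dz$, where $$d^0(\underline\xi^{\{\underline k\}})=\sum_{0<\underline k'\le\underline k}\left\langle{\underline k\atop \underline k'}\right\rangle\underline\xi^{\{\underline k-\underline k'\}}(\underline{d\xi})^{(\underline k')_q}.$$ * A coefficient to the right of a form of degree one is moved to the left by the rule $\omega\otimes' y=y\omega+(d^0y)\omega$. Explicitly, for $\underline a\in\mathbb N^{d-1}\setminus\{0\}$, $$(\underline{d\hat\xi})^{(\underline a)_q}\otimes'\xi_d^{\{t\}}=\sum_{j=0}^{t}\left\langle{t\atop j}\right\rangle\xi_d^{\{t-j\}}(\underline{d\hat\xi})^{(\underline a)_q}(d\xi_d)^{(j)_q}.$$ Here, for $\underline a\in\mathbb N^{d-1}$ and $t\in\mathbb N$, $\underline{\hat\xi}^{\{\underline a\}}\xi_d^{\{t\}}$ and $(\underline{d\hat\xi})^{(\underline a)_q}(d\xi_d)^{(t)_q}$ denote $\underline\xi^{\{(\underline a,t)\}}$ and $(\underline{d\xi})^{((\underline a,t))_q}$. **Theorem.** If $p^m\mid k$ and $0<l\le p^m$, then $\left\langle{k+l\atop k}\right\rangle$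 is invertible in $\Lambda$. There is one and only one family of $A$-linear maps $h:L\Omega(r)\to L\Omega(r-1)$, $r\ge0$, such that the following holds for all $1\le s\le r$, all $\underline k\in\mathbb N^{d-1}$ and $k\ge 0$, all $\underline k_{(1)},\dots,\underline k_{(s-1)}\in\mathbb N^{d-1}\setminus\{0\}$ of weight at most $p^m$, all $\underline k_{(s)}\in\mathbb N^{d-1}$ and $l\geq 0$ with $0<|\underline k_{(s)}|+l\le p^m$, and all $\underline k_{(s+1)},\dots,\underline k_{(r)}\in\mathbb N^d\setminus\{0\}$ of weight at most $p^m$. The value $$h\Bigl[\underline{\hat\xi}^{\{\underline k\}}\xi_d^{\{k\}}(\underline{d\hat\xi})^{(\underline k_{(1)})_q}\otimes'\cdots\otimes'(\underline{d\hat\xi})^{(\underline k_{(s-1)})_q}\otimes'(\underline{d\hat\xi})^{(\underline k_{(s)})_q}(d\xi_d)^{(l)_q}\otimes'(\underline{d\xi})^{(\underline k_{(s+1)})_q}\otimes'\cdots\otimes'(\underline{d\xi})^{(\underline k_{(r)})_q}\Bigr]$$ is equal to * $0$, if (1) $s=r$ and $l=0$, or (2) $l\ne0$ and $\underline k_{(s)}\ne0$,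 or (3) $p^m\nmid k$; * $$(-1)^{s-1}\left\langle{k+l\atop k}\right\rangle^{-1}\underline{\hat\xi}^{\{\underline k\}}(\underline{d\hat\xi})^{(\underline k_{(1)})_q}\otimes'\cdots\otimes'(\underline{d\hat\xi})^{(\underline k_{(s-1)})_q}\otimes'\xi_d^{\{k+l\}}(\underline{d\xi})^{(\underline k_{(s+1)})_q}\otimes'\cdots\otimes'(\underline{d\xi})^{(\underline k_{(r)})_q},$$ if $\underline k_{(s)}=0$, $p^m\mid k$, and either (1) $0<l<p^m$, or (2) $l=p^m$ and $s=r$. Moreover $$hd+dh=\mathrm{Id}-\pi ,$$ where $\pi$ is the $A$-linear projector of $L\Omega(\bullet)$ that sends a generator $\underline\xi^{\{\underline k\}}(\underline{d\xi})^{(\underline k_{(1)})_q}\otimes'\cdots\otimes'(\underline{d\xi})^{(\underline k_{(r)})_q}$ to itself if the $d$-th entries of $\underline k,\underline k_{(1)},\dots,\underline k_{(r)}$ all vanish, and to $0$ otherwise. -/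

import Mathlib

open scoped TensorProduct
open Polynomial

noncomputable section

namespace QJet

/-! ## The base ring `ℤ[q]_{(p, q-1)}` -/

/-- The ideal `(p, q - 1)` of `ℤ[q]`. -/
def qIdeal (p : ℕ) : Ideal ℤ[X] := Ideal.span {(p : ℤ[X]), X - 1}

lemma mem_qIdeal_iff (p : ℕ) (f : ℤ[X]) : f ∈ qIdeal p ↔ (p : ℤ) ∣ f.eval 1 := by
  constructor
  · intro h
    obtain ⟨a, b, rfl⟩ := Ideal.mem_span_pair.1 h
    simp
  · rintro ⟨c, hc⟩
    obtain ⟨g, hg⟩ : (X - C (1 : ℤ)) ∣ f - C (f.eval 1) := by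
      rw [dvd_iff_isRoot]; simp
    refine Ideal.mem_span_pair.2 ⟨C c, g, ?_⟩
    have : f = C (f.eval 1) + (X - C 1) * g := by rw [← hg]; ring
    rw [this, hc]
    simp
    ring

instance qIdeal_isPrime (p : ℕ) [hp : Fact p.Prime] : (qIdeal p).IsPrime := by
  have hpp : Prime (p : ℤ) := Nat.prime_iff_prime_int.1 hp.out
  refine ⟨fun h => ?_, fun {x y} h => ?_⟩
  · have h1 : (1 : ℤ[X]) ∈ qIdeal p := by rw [h]; trivial
    rw [mem_qIdeal_iff] at h1
    simp only [eval_one] at h1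
    exact hpp.not_isUnit (isUnit_of_dvd_one h1)
  · rw [mem_qIdeal_iff, eval_mul] at h
    simpa only [mem_qIdeal_iff] using hpp.dvd_or_dvd h

/-- The local ring `Λ = ℤ[q]_{(p, q-1)}`. -/
def Lam (p : ℕ) [Fact p.Prime] : Type := Localization.AtPrime (qIdeal p)

instance (p : ℕ) [Fact p.Prime] : CommRing (Lam p) :=
  inferInstanceAs (CommRing (Localization.AtPrime (qIdeal p)))

instance (p : ℕ) [Fact p.Prime] : Algebra ℤ[X] (Lam p) :=
  inferInstanceAs (Algebra ℤ[X] (Localization.AtPrime (qIdeal p)))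

instance (p : ℕ) [Fact p.Prime] : IsLocalization.AtPrime (Lam p) (qIdeal p) :=
  inferInstanceAs (IsLocalization.AtPrime (Localization.AtPrime (qIdeal p)) (qIdeal p))

/-- The element `q` of `Λ`. -/
def qel (p : ℕ) [Fact p.Prime] : Lam p := algebraMap ℤ[X] (Lam p) X

/-! ## `q`-integers and `q`-factorials -/

/-- The `q`-integer `(n)_q = 1 + q + ⋯ + q^(n-1)`. -/
def qInt {R : Type*} [CommRing R] (q : R) (n : ℕ) : R := ∑ i ∈ Finset.range n, q ^ i

/-- The `q`-factorial `(n)_q! = (1)_q (2)_q ⋯ (n)_q`. -/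
def qFact {R : Type*} [CommRing R] (q : R) (n : ℕ) : R := ∏ j ∈ Finset.range n, qInt q (j + 1)

section integrality

lemma qInt_mul {R : Type*} [CommRing R] (q : R) (a b : ℕ) :
    qInt q (a * b) = qInt q a * qInt (q ^ a) b := by
  induction b with
  | zero => simp [qInt]
  | succ b ih =>
    have h1 : qInt q (a * (b + 1)) = qInt q (a * b) + q ^ (a * b) * qInt q a := by
      simp only [qInt]
      rw [Nat.mul_succ, Finset.sum_range_add, Finset.mul_sum]
      simp only [pow_add]
    have h2 : qInt (q ^ a) (b + 1) = qInt (q ^ a) b + q ^ (a * b) := by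
      simp only [qInt]
      rw [Finset.sum_range_succ, pow_mul]
    rw [h1, h2, ih]; ring

lemma qInt_add {R : Type*} [CommRing R] (q : R) (a b : ℕ) :
    qInt q (a + b) = qInt q a + q ^ a * qInt q b := by
  simp only [qInt]
  rw [Finset.sum_range_add, Finset.mul_sum]
  simp only [pow_add]

lemma qFact_succ {R : Type*} [CommRing R] (q : R) (n : ℕ) :
    qFact q (n + 1) = qFact q n * qInt q (n + 1) := by
  simp [qFact, Finset.prod_range_succ]

lemma qFact_dvd {R : Type*} [CommRing R] (q : R) (a b : ℕ) :
    qFact q a * qFact q b ∣ qFact q (a + b) := by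
  induction a generalizing b with
  | zero => simp [qFact]
  | succ a iha =>
    induction b with
    | zero => simp [qFact]
    | succ b ihb =>
      have e : qFact q (a + 1 + (b + 1)) =
          qFact q (a + (b + 1)) * qInt q (a + 1)
            + qFact q (a + 1 + b) * qInt q (b + 1) * q ^ (a + 1) := by
        rw [show a + 1 + (b + 1) = (a + 1 + b) + 1 by ring, qFact_succ,
          show a + 1 + b + 1 = (a + 1) + (b + 1) by ring, qInt_add,
          show a + (b + 1) = a + 1 + b by ring]
        ring
      rw [e]
      refine dvd_add ?_ (Dvd.dvd.mul_right ?_ _)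
      · have := mul_dvd_mul_right (iha (b + 1)) (qInt q (a + 1))
        rw [qFact_succ q a]
        convert this using 1
        ring
      · have := mul_dvd_mul_right ihb (qInt q (b + 1))
        rw [qFact_succ q b]
        convert this using 1
        ring

variable (p : ℕ) [hp : Fact p.Prime]

lemma isUnit_qInt (j n : ℕ) (hn : ¬ p ∣ n) : IsUnit (qInt (qel p ^ j) n) := by
  have e : qInt (qel p ^ j) n = algebraMap ℤ[X] (Lam p) (qInt (X ^ j) n) := by
    simp [qInt, qel, map_sum]
  rw [e, IsLocalization.AtPrime.isUnit_to_map_iff (Lam p) (qIdeal p)]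
  intro h
  have h' : qInt (X ^ j : ℤ[X]) n ∈ qIdeal p := h
  rw [mem_qIdeal_iff] at h'
  have : (qInt (X ^ j : ℤ[X]) n).eval 1 = n := by
    simp [qInt, eval_finsetSum]
  rw [this] at h'
  exact hn (by exact_mod_cast h')

variable (m : ℕ)

lemma associated_qInt (r s : ℕ) (hs : ¬ p ^ m ∣ s) :
    Associated (qInt (qel p) (p ^ m * r + s)) (qInt (qel p) s) := by
  have hs0 : s ≠ 0 := fun h => hs (h ▸ dvd_zero _)
  obtain ⟨n, l, hl, rfl⟩ := Nat.exists_eq_pow_mul_and_not_dvd hs0 p hp.out.ne_one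
  have hnm : n < m := by
    by_contra hcon
    exact hs (Dvd.dvd.mul_right (pow_dvd_pow p (not_lt.1 hcon)) l)
  obtain ⟨c, rfl⟩ := Nat.exists_eq_add_of_lt hnm
  have e : p ^ (n + c + 1) * r + p ^ n * l = p ^ n * (p * (p ^ c * r) + l) := by ring
  rw [e, qInt_mul, qInt_mul]
  have h1 : IsUnit (qInt (qel p ^ p ^ n) (p * (p ^ c * r) + l)) :=
    isUnit_qInt p _ _ (fun h => hl ((Nat.dvd_add_right (Dvd.intro _ rfl)).1 h))
  have h2 : IsUnit (qInt (qel p ^ p ^ n) l) := isUnit_qInt p _ _ hl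
  exact (Associated.refl _).mul_mul
    ((associated_one_iff_isUnit.2 h1).trans (associated_one_iff_isUnit.2 h2).symm)

/-- The quotient `(k)_q! / (⌊k / p^m⌋)_{q^{p^m}}!`, written as a product. -/
def redFact (k : ℕ) : Lam p :=
  ∏ j ∈ Finset.range k,
    if p ^ m ∣ j + 1 then qInt (qel p) (p ^ m) else qInt (qel p) (j + 1)

lemma qFact_eq_redFact (k : ℕ) :
    qFact (qel p) k = redFact p m k * qFact (qel p ^ p ^ m) (k / p ^ m) := by
  induction k with
  | zero => simp [qFact, redFact]
  | succ k ih =>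
    rw [qFact_succ, ih, redFact.eq_1 p m (k + 1), Finset.prod_range_succ, ← redFact.eq_1 p m k,
      Nat.succ_div]
    split_ifs with h
    · obtain ⟨t, ht⟩ := h
      have hN : 0 < p ^ m := pow_pos hp.out.pos m
      have h1 : k / p ^ m + 1 = t := by
        have h2 := Nat.succ_div_of_dvd (Dvd.intro t ht.symm : p ^ m ∣ k + 1)
        rw [ht, Nat.mul_div_cancel_left _ hN] at h2
        exact h2.symm
      rw [qFact_succ, h1, ht, qInt_mul]
      ring
    · simp only [add_zero]
      ring

lemma redFact_add (r s : ℕ) :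
    Associated (redFact p m (p ^ m * r + s)) (redFact p m (p ^ m * r) * redFact p m s) := by
  induction s with
  | zero => simp [redFact]
  | succ s ih =>
    rw [← add_assoc, redFact.eq_1 p m (p ^ m * r + s + 1), Finset.prod_range_succ,
      ← redFact.eq_1 p m (p ^ m * r + s)]
    conv_rhs => rw [redFact.eq_1 p m (s + 1), Finset.prod_range_succ, ← redFact.eq_1 p m s,
      ← mul_assoc]
    refine ih.mul_mul ?_
    have hd : p ^ m ∣ p ^ m * r + s + 1 ↔ p ^ m ∣ s + 1 := by
      rw [add_assoc]; exact Nat.dvd_add_right (Dvd.intro _ rfl)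
    by_cases h : p ^ m ∣ s + 1
    · rw [if_pos h, if_pos (hd.2 h)]
      exact Associated.refl _
    · rw [if_neg h, if_neg (fun h' => h (hd.1 h')), add_assoc]
      exact associated_qInt p m r _ h

lemma redFact_pow (r : ℕ) :
    Associated (redFact p m (p ^ m * r)) (redFact p m (p ^ m) ^ r) := by
  induction r with
  | zero => simp [redFact]
  | succ r ih =>
    rw [Nat.mul_succ, pow_succ]
    exact (redFact_add p m r _).trans (ih.mul_mul (Associated.refl _))

lemma redFact_small (s : ℕ) (hs : s < 2 * p ^ m) : redFact p m s = qFact (qel p) s := by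
  have h : s / p ^ m ≤ 1 := by
    have := Nat.div_lt_of_lt_mul (by rwa [mul_comm] at hs : s < p ^ m * 2)
    omega
  rw [qFact_eq_redFact p m s]
  interval_cases s / p ^ m <;> simp [qFact, qInt]

lemma redFact_dvd (a b : ℕ) : redFact p m a * redFact p m b ∣ redFact p m (a + b) := by
  have hN : 0 < p ^ m := pow_pos hp.out.pos m
  have key : ∀ c r s, c = p ^ m * r + s →
      Associated (redFact p m c) (redFact p m (p ^ m) ^ r * redFact p m s) := by
    rintro c r s rfl
    exact (redFact_add p m r s).trans ((redFact_pow p m r).mul_mul (Associated.refl _))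
  have ha := key a _ _ (Nat.div_add_mod a (p ^ m)).symm
  have hb := key b _ _ (Nat.div_add_mod b (p ^ m)).symm
  have hab := key (a + b) (a / p ^ m + b / p ^ m) (a % p ^ m + b % p ^ m) (by
    conv_lhs => rw [← Nat.div_add_mod a (p ^ m), ← Nat.div_add_mod b (p ^ m)]
    ring)
  rw [(ha.mul_mul hb).dvd_iff_dvd_left, hab.dvd_iff_dvd_right, pow_add]
  have la := Nat.mod_lt a hN
  have lb := Nat.mod_lt b hN
  rw [redFact_small p m (a % p ^ m) (by omega), redFact_small p m (b % p ^ m) (by omega),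
    redFact_small p m (a % p ^ m + b % p ^ m) (by omega)]
  have := mul_dvd_mul_left (redFact p m (p ^ m) ^ (a / p ^ m) * redFact p m (p ^ m) ^ (b / p ^ m))
    (qFact_dvd (qel p) (a % p ^ m) (b % p ^ m))
  convert this using 1
  ring

/-- The quotient that defines `⟨k, k'⟩_{(m),q}` lies in `Λ`. -/
lemma exists_angle (k k' : ℕ) (h : k' ≤ k) :
    ∃ u : Lam p,
      u * (qFact (qel p ^ p ^ m) (k / p ^ m) * qFact (qel p) k' * qFact (qel p) (k - k'))
        = qFact (qel p) k * qFact (qel p ^ p ^ m) (k' / p ^ m)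
            * qFact (qel p ^ p ^ m) ((k - k') / p ^ m) := by
  obtain ⟨c, hc⟩ := redFact_dvd p m k' (k - k')
  rw [Nat.add_sub_cancel' h] at hc
  refine ⟨c, ?_⟩
  rw [qFact_eq_redFact p m k, qFact_eq_redFact p m k', qFact_eq_redFact p m (k - k'), hc]
  ring

end integrality

/-- The `q`-binomial coefficient of level `m`,
`⟨k, k'⟩_{(m),q} = ((k)_q! / ((k')_q! (k'')_q!)) * ((r)! / ((r')! (r'')!))⁻¹ ∈ Λ`,
where `k = k' + k''`, the numbers `r, r', r''` are the integer parts of `k / p^m`, `k' / p^m`,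
`k'' / p^m`, and the last three factorials are `q^{p^m}`-factorials.  Since `Λ` is a domain, the
element is determined by the equation with cleared denominators. -/
def angle₁ (p : ℕ) [Fact p.Prime] (m k k' : ℕ) : Lam p :=
  if h : k' ≤ k then (exists_angle p m k k' h).choose else 0

/-! ## Multi-indices -/

/-- Multi-indices in `ℕ^d`. -/
abbrev MIdx (d : ℕ) : Type := Fin d → ℕ

/-- The weight `|k| = k_1 + ⋯ + k_d`. -/
def weight {d : ℕ} (k : MIdx d) : ℕ := ∑ i, k i

/-- `⟨k, k'⟩_{(m),q}` for multi-indices. -/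
def angle (p : ℕ) [Fact p.Prime] (m : ℕ) {d : ℕ} (k k' : MIdx d) : Lam p :=
  ∏ i, angle₁ p m (k i) (k' i)

/-- Nonzero multi-indices; the letter `k` stands for the generator `ξ^{k}_{(m),q}`. -/
abbrev Letter (d : ℕ) : Type := {k : MIdx d // k ≠ 0}

/-! ## The `q`-jet complex

All structure constants of the differential graded algebra `NP^{(m)}_{A/R,q}(•)` with respect to the
basis of words `ξ^{k_1} ⊗' ⋯ ⊗' ξ^{k_r}` lie in `Λ`.  The free `Λ`-module on the words is a
differential graded `Λ`-algebra, and the `q`-jet complex is built from it. -/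

section jet

variable (p : ℕ) [Fact p.Prime] (m d : ℕ)

/-- The tensor algebra over `Λ` on the letters: the free module on all words.  The word
`[k_1, …, k_r]` is `ξ^{k_1} ⊗' ⋯ ⊗' ξ^{k_r}`, of degree `r`; the product is concatenation. -/
abbrev NP : Type := List (Letter d) →₀ Lam p

variable {d} in
/-- Left multiplication by the word `u`. -/
def lmul (u : List (Letter d)) : NP p d →ₗ[Lam p] NP p d :=
  Finsupp.lmapDomain (Lam p) (Lam p) (fun w => u ++ w)

variable {d} in
/-- Right multiplication by the word `v`. -/
def rmul (v : List (Letter d)) : NP p d →ₗ[Lam p] NP p d :=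
  Finsupp.lmapDomain (Lam p) (Lam p) (fun w => w ++ v)

variable {d}

lemma ne_zero_of_mem_Ioo {k a : MIdx d} (h : a ∈ Finset.Ioo 0 k) : a ≠ 0 :=
  (Finset.mem_Ioo.1 h).1.ne'

lemma sub_ne_zero_of_mem_Ioo {k a : MIdx d} (h : a ∈ Finset.Ioo 0 k) : k - a ≠ 0 := by
  intro h0
  exact (Finset.mem_Ioo.1 h).2.not_ge (tsub_eq_zero_iff_le.1 h0)

/-- `d(ξ^{k}) = - ∑_{0 < k' < k} ⟨k, k'⟩ ξ^{k'} ⊗' ξ^{k - k'}`. -/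
def dLetter (k : Letter d) : NP p d :=
  -∑ a ∈ (Finset.Ioo (0 : MIdx d) k.1).attach,
    Finsupp.single
      [⟨a.1, ne_zero_of_mem_Ioo a.2⟩, ⟨k.1 - a.1, sub_ne_zero_of_mem_Ioo a.2⟩]
      (angle p m k.1 a.1)

/-- The differential of a word, by the graded Leibniz rule
`d(ξ^{k} ⊗' w) = d(ξ^{k}) ⊗' w - ξ^{k} ⊗' d(w)`. -/
def dWord : List (Letter d) → NP p d
  | [] => 0
  | k :: w => rmul p w (dLetter p m k) - lmul p [k] (dWord w)

/-- The differential of the tensor algebra. -/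
def dNP : NP p d →ₗ[Lam p] NP p d := Finsupp.linearCombination (Lam p) (dWord p m)

/-- Two-sided ideals that are stable under the differential. -/
structure IsDGIdeal (J : Submodule (Lam p) (NP p d)) : Prop where
  lmul_mem : ∀ (u : List (Letter d)), ∀ x ∈ J, lmul p u x ∈ J
  rmul_mem : ∀ (v : List (Letter d)), ∀ x ∈ J, rmul p v x ∈ J
  d_mem : ∀ x ∈ J, dNP p m x ∈ J

variable (d)

/-- The DG-ideal generated by the `ξ^{k}` with `|k| > p^m`. -/
def K : Submodule (Lam p) (NP p d) :=
  sInf {J | IsDGIdeal p m J ∧ ∀ k : Letter d, p ^ m < weight k.1 → Finsupp.single [k] 1 ∈ J}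

lemma K_isDGIdeal : IsDGIdeal p m (K p m d) where
  lmul_mem u x hx := by
    refine (Submodule.mem_sInf).2 fun J hJ => hJ.1.lmul_mem u x ?_
    exact (Submodule.mem_sInf).1 hx J hJ
  rmul_mem u x hx := by
    refine (Submodule.mem_sInf).2 fun J hJ => hJ.1.rmul_mem u x ?_
    exact (Submodule.mem_sInf).1 hx J hJ
  d_mem x hx := by
    refine (Submodule.mem_sInf).2 fun J hJ => hJ.1.d_mem x ?_
    exact (Submodule.mem_sInf).1 hx J hJ

/-- The `q`-jet complex over `Λ`: the quotient of the tensor algebra by the DG-ideal `K`.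
One has `Ω^{(m)}_{A/R,q}(•) = A ⊗_Λ Ω` as left `A`-modules. -/
abbrev Om : Type := NP p d ⧸ K p m d

variable {d}

/-- The class `(dξ)^{(k_1)_q} ⊗' ⋯ ⊗' (dξ)^{(k_r)_q}` of a word. -/
def cls (w : List (Letter d)) : Om p m d := (K p m d).mkQ (Finsupp.single w 1)

variable (d) in
/-- The differential of the `q`-jet complex. -/
def dOm : Om p m d →ₗ[Lam p] Om p m d :=
  (K p m d).mapQ (K p m d) (dNP p m) (fun x hx => (K_isDGIdeal p m d).d_mem x hx)

/-- Left multiplication by `(dξ)^{(k)_q}` on the `q`-jet complex. -/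
def lmulOm (k : Letter d) : Om p m d →ₗ[Lam p] Om p m d :=
  (K p m d).mapQ (K p m d) (lmul p [k]) (fun x hx => (K_isDGIdeal p m d).lmul_mem [k] x hx)

end jet

/-! ## The projector -/

section projector

variable (p : ℕ) [Fact p.Prime] (m n : ℕ)

/-- The projector of the tensor algebra that sends `ξ^{k}` to itself if the last entry of `k` is
zero, and to `0` otherwise. -/
def piNP : NP p (n + 1) →ₗ[Lam p] NP p (n + 1) :=
  Finsupp.linearCombination (Lam p)
    (fun w => if ∀ k ∈ w, k.1 (Fin.last n) = 0 then Finsupp.single w 1 else 0)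

variable {n}

lemma piNP_single (w : List (Letter (n + 1))) (c : Lam p) :
    piNP p n (Finsupp.single w c) =
      if ∀ k ∈ w, k.1 (Fin.last n) = 0 then Finsupp.single w c else 0 := by
  simp only [piNP, Finsupp.linearCombination_single]
  split_ifs <;> simp

lemma piNP_lmul (u : List (Letter (n + 1))) (x : NP p (n + 1)) :
    piNP p n (lmul p u x) =
      if ∀ k ∈ u, k.1 (Fin.last n) = 0 then lmul p u (piNP p n x) else 0 := by
  induction x using Finsupp.induction_linear with
  | zero => simp
  | add x y hx hy => rw [map_add, map_add, hx, hy]; split_ifs <;> simp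
  | single w c =>
    simp only [lmul, Finsupp.lmapDomain_apply, Finsupp.mapDomain_single, piNP_single,
      List.forall_mem_append]
    by_cases h1 : ∀ k ∈ u, k.1 (Fin.last n) = 0
    · by_cases h2 : ∀ k ∈ w, k.1 (Fin.last n) = 0
      · rw [if_pos ⟨h1, h2⟩, if_pos h1, if_pos h2, Finsupp.mapDomain_single]
      · rw [if_neg (fun h => h2 h.2), if_pos h1, if_neg h2, Finsupp.mapDomain_zero]
    · rw [if_neg (fun h => h1 h.1), if_neg h1]

lemma piNP_rmul (u : List (Letter (n + 1))) (x : NP p (n + 1)) :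
    piNP p n (rmul p u x) =
      if ∀ k ∈ u, k.1 (Fin.last n) = 0 then rmul p u (piNP p n x) else 0 := by
  induction x using Finsupp.induction_linear with
  | zero => simp
  | add x y hx hy => rw [map_add, map_add, hx, hy]; split_ifs <;> simp
  | single w c =>
    simp only [rmul, Finsupp.lmapDomain_apply, Finsupp.mapDomain_single, piNP_single,
      List.forall_mem_append]
    by_cases h1 : ∀ k ∈ u, k.1 (Fin.last n) = 0
    · by_cases h2 : ∀ k ∈ w, k.1 (Fin.last n) = 0
      · rw [if_pos ⟨h2, h1⟩, if_pos h1, if_pos h2, Finsupp.mapDomain_single]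
      · rw [if_neg (fun h => h2 h.1), if_pos h1, if_neg h2, Finsupp.mapDomain_zero]
    · rw [if_neg (fun h => h1 h.2), if_neg h1]

lemma piNP_dLetter (k : Letter (n + 1)) :
    piNP p n (dLetter p m k) = if k.1 (Fin.last n) = 0 then dLetter p m k else 0 := by
  have key : ∀ a ∈ Finset.Ioo (0 : MIdx (n + 1)) k.1,
      (a (Fin.last n) = 0 ∧ k.1 (Fin.last n) - a (Fin.last n) = 0) ↔ k.1 (Fin.last n) = 0 := by
    intro a ha
    have h : a (Fin.last n) ≤ k.1 (Fin.last n) := (Finset.mem_Ioo.1 ha).2.le (Fin.last n)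
    omega
  rw [dLetter, map_neg, map_sum]
  split_ifs with h
  · congr 1
    refine Finset.sum_congr rfl fun a _ => ?_
    rw [piNP_single, if_pos]
    have := (key a.1 a.2).2 h
    simpa using this
  · rw [neg_eq_zero]
    refine Finset.sum_eq_zero fun a _ => ?_
    rw [piNP_single, if_neg]
    intro h'
    refine h ((key a.1 a.2).1 ?_)
    simpa using h'

lemma piNP_dWord (w : List (Letter (n + 1))) :
    piNP p n (dWord p m w) =
      if ∀ k ∈ w, k.1 (Fin.last n) = 0 then dWord p m w else 0 := by
  induction w with
  | nil => simp [dWord]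
  | cons k w ih =>
    rw [dWord, map_sub, piNP_rmul, piNP_lmul, ih, piNP_dLetter]
    simp only [List.forall_mem_singleton]
    simp only [List.forall_mem_cons]
    by_cases h1 : k.1 (Fin.last n) = 0
    · by_cases h2 : ∀ k ∈ w, k.1 (Fin.last n) = 0
      · rw [if_pos h2, if_pos h1, if_pos h1, if_pos h2, if_pos ⟨h1, h2⟩]
      · rw [if_neg h2, if_pos h1, if_neg h2, if_neg (fun h => h2 h.2), map_zero, sub_zero]
    · rw [if_neg h1, if_neg h1, if_neg (fun h => h1 h.1 : ¬ (_ ∧ _)), map_zero, ite_self,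
        sub_zero]

lemma piNP_dNP (x : NP p (n + 1)) : piNP p n (dNP p m x) = dNP p m (piNP p n x) := by
  induction x using Finsupp.induction_linear with
  | zero => simp
  | add x y hx hy => simp only [map_add, hx, hy]
  | single w c =>
    rw [piNP_single, dNP, Finsupp.linearCombination_single, map_smul, piNP_dWord]
    split_ifs <;> simp

lemma K_le_comap_piNP : K p m (n + 1) ≤ (K p m (n + 1)).comap (piNP p n) := by
  refine sInf_le ⟨⟨fun u x hx => ?_, fun u x hx => ?_, fun x hx => ?_⟩, fun k hk => ?_⟩
  · rw [Submodule.mem_comap, piNP_lmul]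
    split_ifs
    · exact (K_isDGIdeal p m _).lmul_mem _ _ hx
    · exact zero_mem _
  · rw [Submodule.mem_comap, piNP_rmul]
    split_ifs
    · exact (K_isDGIdeal p m _).rmul_mem _ _ hx
    · exact zero_mem _
  · rw [Submodule.mem_comap, piNP_dNP]
    exact (K_isDGIdeal p m _).d_mem _ hx
  · rw [Submodule.mem_comap, piNP_single]
    split_ifs
    · exact (Submodule.mem_sInf).2 fun J hJ => hJ.2 k hk
    · exact zero_mem _

/-- The projector on the `q`-jet complex. -/
def piOm : Om p m (n + 1) →ₗ[Lam p] Om p m (n + 1) :=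
  (K p m (n + 1)).mapQ (K p m (n + 1)) (piNP p n) (K_le_comap_piNP p m)

end projector

/-! ## The linearized `q`-jet complex -/

section linearized

variable (p : ℕ) [Fact p.Prime] (m d : ℕ) (A : Type*) [CommRing A] [Algebra (Lam p) A]

/-- The ideal `(p, q - 1)` of `A`. -/
def adicIdeal : Ideal A := Ideal.span {(p : A), algebraMap (Lam p) A (qel p) - 1}

/-- The left `A`-module `A⟨ξ⟩_{(m),q,x}`: it is free with basis `ξ^{k}_{(m),q}`, `k ∈ ℕ^d`. -/
abbrev PDPoly : Type _ := MIdx d →₀ A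

/-- The left `A`-module `A⟨ξ⟩^_{(m),q,x}`, the `(p, q - 1)`-adic completion of `A⟨ξ⟩_{(m),q,x}`. -/
abbrev PDHat : Type _ := AdicCompletion (adicIdeal p A) (PDPoly d A)

/-- An `A`-linear endomorphism of `A⟨ξ⟩_{(m),q,x}`, extended to the completion. -/
def hatMap {d : ℕ} (f : PDPoly d A →ₗ[A] PDPoly d A) : PDHat p d A →ₗ[A] PDHat p d A :=
  (AdicCompletion.map (adicIdeal p A) f).restrictScalars A

/-- The linearized `q`-jet complex `LΩ = A⟨ξ⟩^ ⊗'_A Ω^{(m)}_{A/R,q} = A⟨ξ⟩^ ⊗_Λ Ω`, all degrees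
together, as a left `A`-module. -/
abbrev LOm : Type _ := PDHat p d A ⊗[Lam p] Om p m d

/-- The homogeneous part `LΩ(r)`. -/
def LOmDeg (r : ℕ) : Submodule A (LOm p m d A) :=
  Submodule.span A {z | ∃ (a : PDHat p d A) (w : List (Letter d)),
    w.length = r ∧ z = a ⊗ₜ[Lam p] cls p m w}

variable {d}

/-- The element `ξ^{k} (dξ)^{(k_1)_q} ⊗' ⋯ ⊗' (dξ)^{(k_r)_q}` of `LΩ(r)`. -/
def gen (k : MIdx d) (w : List (Letter d)) : LOm p m d A :=
  AdicCompletion.of (adicIdeal p A) (PDPoly d A) (Finsupp.single k 1) ⊗ₜ[Lam p] cls p m w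

/-- The `A`-linear map `ξ^{k} ↦ ⟨k, b⟩ ξ^{k - b}` (zero unless `b ≤ k`). -/
def shift (b : MIdx d) : PDPoly d A →ₗ[A] PDPoly d A :=
  Finsupp.linearCombination A (fun k =>
    if ∀ i, b i ≤ k i then Finsupp.single (k - b) (algebraMap (Lam p) A (angle p m k b)) else 0)

variable (d) in
/-- The multi-indices `b` with `0 < |b| ≤ p^m`. -/
def smallLetters : Finset (Letter d) :=
  ((Finset.Iic (fun _ : Fin d => p ^ m)).subtype (fun k => k ≠ 0)).filter
    (fun b => weight b.1 ≤ p ^ m)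

variable (d) in
/-- The differential of `LΩ`: `d(a ⊗' z) = d⁰(a) ⊗' z + a ⊗' d(z)`, where
`d⁰(ξ^{k}) = ∑_{0 < k' ≤ k} ⟨k, k'⟩ ξ^{k - k'} (dξ)^{(k')_q}`; recall that `(dξ)^{(k')_q} = 0`
when `|k'| > p^m`. -/
def dLOm : LOm p m d A →ₗ[A] LOm p m d A :=
  (∑ b ∈ smallLetters p m d,
    TensorProduct.AlgebraTensorModule.map (hatMap p A (shift p m A b.1)) (lmulOm p m b))
  + TensorProduct.AlgebraTensorModule.map LinearMap.id (dOm p m d)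

variable {n : ℕ}

/-- The projector of `A⟨ξ⟩_{(m),q,x}` that keeps the `ξ^{k}` with `k_d = 0` and kills the others. -/
def piPoly : PDPoly (n + 1) A →ₗ[A] PDPoly (n + 1) A :=
  Finsupp.linearCombination A (fun k => if k (Fin.last n) = 0 then Finsupp.single k 1 else 0)

variable (n) in
/-- The projector `π` of `LΩ` that sends `ξ_i^{k_i}` and `(dξ_i)^{(l_i)_q}` to itself if `i < d`
and to `0` if `i = d`, `k_d > 0`, `l_d > 0`. -/
def piLOm : LOm p m (n + 1) A →ₗ[A] LOm p m (n + 1) A :=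
  TensorProduct.AlgebraTensorModule.map (hatMap p A (piPoly A)) (piOm p m)

/-! ## The integration map -/

/-- The multi-index `(a, t) ∈ ℕ^d` for a nonzero `a ∈ ℕ^{d-1}` and `t ∈ ℕ`, as a letter. -/
def snocLetter (a : Letter n) (t : ℕ) : Letter (n + 1) :=
  ⟨Fin.snoc (α := fun _ => ℕ) a.1 t, fun h => a.2 (by
    funext i
    have := congrFun h i.castSucc
    simpa using this)⟩

/-- For `u = [k_{s-1}, …, k_1]` (in reversed order, with `k_j ∈ ℕ^{d-1}`), the element
`ξ̂^{k̂} (dξ̂)^{(k_1)_q} ⊗' ⋯ ⊗' (dξ̂)^{(k_{s-1})_q} ⊗' ξ_d^{t} v` of `LΩ`.  The coefficient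
`ξ_d^{t}` is moved to the left past one factor at a time by the rule
`ω ⊗' y = y ω + (d⁰ y) ω`, which for `ω = (dξ̂)^{(a)_q}` and `y = ξ_d^{t}` reads
`(dξ̂)^{(a)_q} ⊗' ξ_d^{t} = ∑_{0 ≤ j ≤ t} ⟨t, j⟩ ξ_d^{t-j} (dξ̂)^{(a)_q} (dξ_d)^{(j)_q}`. -/
def moved (kh : MIdx n) : List (Letter n) → ℕ → List (Letter (n + 1)) → LOm p m (n + 1) A
  | [], t, v => gen p m A (Fin.snoc (α := fun _ => ℕ) kh t) v
  | a :: u, t, v =>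
      ∑ j ∈ Finset.range (t + 1), angle₁ p m t j • moved kh u (t - j) (snocLetter a j :: v)

/-- The conditions on the integration map `h` of differential forms.  It lowers the degree by one
(`LΩ(-1) = 0`).  The generator in the last two conditions is
`ξ̂^{k̂} ξ_d^{k} (dξ̂)^{(k_1)_q} ⊗' ⋯ ⊗' (dξ̂)^{(k_{s-1})_q} ⊗' (dξ̂)^{(k_s)_q} (dξ_d)^{(l)_q} ⊗' v`
with `u = [k_1, …, k_{s-1}]`, `b = (k_s, l)` and `v = (dξ)^{(k_{s+1})_q} ⊗' ⋯ ⊗' (dξ)^{(k_r)_q}`. -/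
structure IsIntegration (h : LOm p m (n + 1) A →ₗ[A] LOm p m (n + 1) A) : Prop where
  map_deg : ∀ r : ℕ, ∀ z ∈ LOmDeg p m (n + 1) A (r + 1), h z ∈ LOmDeg p m (n + 1) A r
  map_deg_zero : ∀ z ∈ LOmDeg p m (n + 1) A 0, h z = 0
  eq_zero : ∀ (kh : MIdx n) (k : ℕ) (u : List (Letter n)) (b : Letter (n + 1))
    (v : List (Letter (n + 1))),
    (∀ a ∈ u, weight a.1 ≤ p ^ m) → weight b.1 ≤ p ^ m → (∀ c ∈ v, weight c.1 ≤ p ^ m) →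
    ((v = [] ∧ b.1 (Fin.last n) = 0) ∨
      (b.1 (Fin.last n) ≠ 0 ∧ Fin.init (α := fun _ => ℕ) b.1 ≠ 0) ∨ ¬ p ^ m ∣ k) →
    h (gen p m A (Fin.snoc (α := fun _ => ℕ) kh k)
      (u.map (fun a => snocLetter a 0) ++ b :: v)) = 0
  eq_moved : ∀ (kh : MIdx n) (k : ℕ) (u : List (Letter n)) (b : Letter (n + 1))
    (v : List (Letter (n + 1))),
    (∀ a ∈ u, weight a.1 ≤ p ^ m) → weight b.1 ≤ p ^ m → (∀ c ∈ v, weight c.1 ≤ p ^ m) →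
    Fin.init (α := fun _ => ℕ) b.1 = 0 → p ^ m ∣ k →
    ((0 < b.1 (Fin.last n) ∧ b.1 (Fin.last n) < p ^ m) ∨
      (b.1 (Fin.last n) = p ^ m ∧ v = [])) →
    h (gen p m A (Fin.snoc (α := fun _ => ℕ) kh k)
      (u.map (fun a => snocLetter a 0) ++ b :: v)) =
      ((-1) ^ u.length * Ring.inverse (angle₁ p m (k + b.1 (Fin.last n)) k)) •
        moved p m A kh u.reverse (k + b.1 (Fin.last n)) v

end linearized

end QJet

end

open scoped TensorProduct
open Polynomial

noncomputable section

namespace QJet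

open Finset.HasAntidiagonal (antidiagonal mem_antidiagonal)

/-! ## Coefficients -/

section coefficients

variable (p : ℕ) [hp : Fact p.Prime]

/-! Coefficients. In the domain `Lam p`, `angle₁ p m (a + b) a` is the quotient of `redFact` of `a +
b` by the product of those of `a` and `b`. Up to a unit, `redFact p m k` is the product over i < m
of `cycloFactor p i` to the power k / p^(i+1), as in Legendre's formula. So the coefficient is a
unit if adding a and b carries nothing out of the m lowest p-adic digits, in particular if p^m
divides one of them.

Existence. The form algebra Ω is generated by the letters of weight at most p^m, with one quadratic
relation ∑ ⟨K, k'⟩ (dξ)^{k'} ⊗' (dξ)^{K-k'} = 0 for each K of weight > p^m. A linear map on Ω may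
therefore be prescribed by its value at 1 and a recursion for left multiplication by letters,
provided the recursion respects these relations (`exists_extension`). The integration map, curried
with values in maps from the coefficients to LΩ, is built in this way: a form in the first variables
is passed at the cost of a sign (`bimul`), (dξ_d)^{l} with 0 < l < p^m is integrated by `raise`, and
a mixed form gives 0. The value at (dξ_d)^{p^m} followed by a letter (a, e) is forced by the
relation in multidegree (a, p^m + e), where the coefficient ⟨p^m + e, p^m⟩ is a unit. This is again
a recursion, `topInt`; `sum_corr` and `sum_firstInt` verify the relations for the two recursions.

Homotopy. The differential is `lastDiff` plus the sum of `hatLower a ∘ bimul a` over a ≠ 0. Since h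
commutes with `hatLower a` and anticommutes with `bimul a`, this sum drops out of hd + dh. For
`lastDiff`, the `defect` of the identity vanishes on ξ^{k} w by direct computation if p^m does not
divide the last exponent, or if w = 1. It commutes with `bimul b` and `lastDiff` on monomials.
Applied to ξ_d^{k+t} w with p^m ∣ k, these operators produce ξ_d^{k} (dξ)^{(b,t)} w with a unit
coefficient, and all other terms have vanishing defect for one of the reasons above; so induction on
w applies.

Completion and uniqueness. An A-linear map on LΩ is determined by its values on generators, because
LΩ is separated: Ω is a retract of a free Λ-module (`exists_section`). This is a diamond lemma. The
leading term of a relation is the word whose first letter is the head of K, its coefficient is a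
unit, and overlaps are resolved by `IsHead.trans`. On generators, the stated conditions together
with the relations that involve (dξ_d)^{p^m} leave no choice for h. -/

lemma primeCompl_qIdeal_le : (qIdeal p).primeCompl ≤ nonZeroDivisors ℤ[X] := by
  refine le_nonZeroDivisors_of_noZeroDivisors fun h => h (zero_mem _)

instance : IsDomain (Lam p) :=
  IsLocalization.isDomain_of_le_nonZeroDivisors (Lam p)
    (primeCompl_qIdeal_le p)

lemma qInt_qel_pow_ne_zero (j : ℕ) {k : ℕ} (hk : k ≠ 0) : qInt (qel p ^ j) k ≠ 0 := by
  have e : qInt (qel p ^ j) k = algebraMap ℤ[X] (Lam p) (qInt (X ^ j) k) := by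
    simp [qInt, qel, map_sum]
  rw [e]
  intro h
  have h0 := (IsLocalization.to_map_eq_zero_iff (Lam p) (primeCompl_qIdeal_le p)).1 h
  have h1 : (qInt (X ^ j : ℤ[X]) k).eval 1 = k := by simp [qInt, eval_finsetSum]
  rw [h0, eval_zero] at h1
  exact hk (by exact_mod_cast h1.symm)

lemma qInt_qel_ne_zero {k : ℕ} (hk : k ≠ 0) : qInt (qel p) k ≠ 0 := by
  simpa using qInt_qel_pow_ne_zero p 1 hk

lemma qFact_qel_pow_ne_zero (j k : ℕ) : qFact (qel p ^ j) k ≠ 0 :=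
  Finset.prod_ne_zero_iff.2 fun _ _ => qInt_qel_pow_ne_zero p j (Nat.succ_ne_zero _)

variable (m : ℕ)

lemma redFact_ne_zero (k : ℕ) : redFact p m k ≠ 0 := by
  refine Finset.prod_ne_zero_iff.2 fun j _ => ?_
  split_ifs
  · exact qInt_qel_ne_zero p (pow_pos hp.out.pos m).ne'
  · exact qInt_qel_ne_zero p (Nat.succ_ne_zero _)

/-- The `q^{p^m}`-factorials cancel from the defining equation. All identities between coefficients
below follow from this form by cancelling the nonzero `redFact`s. -/
lemma angle₁_mul_redFact {k a b : ℕ} (h : a + b = k) :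
    angle₁ p m k a * (redFact p m a * redFact p m b) = redFact p m k := by
  subst h
  have hle : a ≤ a + b := Nat.le_add_right a b
  have key := (exists_angle p m (a + b) a hle).choose_spec
  rw [angle₁, dif_pos hle]
  set u := (exists_angle p m (a + b) a hle).choose
  rw [Nat.add_sub_cancel_left, qFact_eq_redFact p m (a + b), qFact_eq_redFact p m a,
    qFact_eq_redFact p m b] at key
  have h0 : qFact (qel p ^ p ^ m) ((a + b) / p ^ m) * qFact (qel p ^ p ^ m) (a / p ^ m)
      * qFact (qel p ^ p ^ m) (b / p ^ m) ≠ 0 :=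
    mul_ne_zero (mul_ne_zero (qFact_qel_pow_ne_zero p _ _) (qFact_qel_pow_ne_zero p _ _))
      (qFact_qel_pow_ne_zero p _ _)
  refine mul_right_cancel₀ h0 ?_
  linear_combination key

lemma angle₁_eq_zero {k a : ℕ} (h : k < a) : angle₁ p m k a = 0 := by
  rw [angle₁, dif_neg (not_le.2 h)]

lemma angle₁_ne_zero {k a : ℕ} (h : a ≤ k) : angle₁ p m k a ≠ 0 := by
  have := angle₁_mul_redFact p m (Nat.add_sub_of_le h)
  intro h0
  rw [h0, zero_mul] at this
  exact redFact_ne_zero p m k this.symm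

@[simp] lemma redFact_zero : redFact p m 0 = 1 := by simp [redFact]

@[simp] lemma angle₁_zero_right (k : ℕ) : angle₁ p m k 0 = 1 := by
  have := angle₁_mul_redFact p m (Nat.zero_add k)
  rw [redFact_zero, one_mul] at this
  exact mul_right_cancel₀ (redFact_ne_zero p m k) (by rw [this, one_mul])

lemma angle₁_symm {k a b : ℕ} (h : a + b = k) : angle₁ p m k a = angle₁ p m k b := by
  have h1 := angle₁_mul_redFact p m h
  have h2 := angle₁_mul_redFact p m ((add_comm b a).trans h)
  refine mul_right_cancel₀ (mul_ne_zero (redFact_ne_zero p m a) (redFact_ne_zero p m b)) ?_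
  rw [h1, mul_comm (redFact p m a), h2]

@[simp] lemma angle₁_self (k : ℕ) : angle₁ p m k k = 1 := by
  rw [angle₁_symm p m (Nat.add_zero k), angle₁_zero_right]

/-- Both sides are the trinomial coefficient of (a, b, c). This coassociativity is the source of d²
= 0. -/
lemma angle₁_assoc {k a b c ab bc : ℕ} (h1 : a + b = ab) (h2 : b + c = bc) (h : ab + c = k) :
    angle₁ p m k ab * angle₁ p m ab a = angle₁ p m k a * angle₁ p m bc b := by
  have e1 := angle₁_mul_redFact p m h1
  have e2 := angle₁_mul_redFact p m h2
  have e3 := angle₁_mul_redFact p m h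
  have e4 : angle₁ p m k a * (redFact p m a * redFact p m bc) = redFact p m k :=
    angle₁_mul_redFact p m (by omega)
  refine mul_right_cancel₀ (mul_ne_zero (mul_ne_zero (redFact_ne_zero p m a)
    (redFact_ne_zero p m b)) (redFact_ne_zero p m c)) ?_
  linear_combination angle₁ p m k ab * redFact p m c * e1 + e3 - e4
    - angle₁ p m k a * redFact p m a * e2

lemma angle₁_mul_angle₁_sub (k a b : ℕ) :
    angle₁ p m k b * angle₁ p m (k - b) a = angle₁ p m (a + b) a * angle₁ p m k (a + b) := by
  by_cases h : a + b ≤ k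
  · have h1 := angle₁_assoc p m (add_comm b a) (show a + (k - b - a) = k - b by omega)
      (show (a + b) + (k - b - a) = k by omega)
    rw [← h1, angle₁_symm p m (rfl : a + b = a + b), mul_comm]
  · rw [angle₁_eq_zero p m (not_le.1 h), mul_zero]
    by_cases h1 : k < b
    · rw [angle₁_eq_zero p m h1, zero_mul]
    · rw [angle₁_eq_zero p m (show k - b < a by omega), mul_zero]

/-- The factor of `redFact` at `p ^ (i + 1)`. -/
def cycloFactor (i : ℕ) : Lam p := qInt (qel p ^ p ^ i) p

lemma qInt_pow_eq_prod (v : ℕ) :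
    qInt (qel p) (p ^ v) = ∏ i ∈ Finset.range v, cycloFactor p i := by
  induction v with
  | zero => simp [qInt]
  | succ v ih => rw [pow_succ, qInt_mul, ih, Finset.prod_range_succ, cycloFactor]

/-- Writing j = p^v l with p ∤ l, the q-integer of j is that of p^v times a unit, and the q-integer
of p^v is the product of the `cycloFactor p i` with i < v. -/
lemma redFact_factor_associated {j : ℕ} (hj : j ≠ 0) :
    Associated (if p ^ m ∣ j then qInt (qel p) (p ^ m) else qInt (qel p) j)
      (∏ i ∈ Finset.range m, if p ^ (i + 1) ∣ j then cycloFactor p i else 1) := by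
  split_ifs with h
  · rw [qInt_pow_eq_prod]
    refine Associated.of_eq (Finset.prod_congr rfl fun i hi => ?_)
    rw [if_pos ((pow_dvd_pow p (Finset.mem_range.1 hi)).trans h)]
  · obtain ⟨v, l, hl, rfl⟩ := Nat.exists_eq_pow_mul_and_not_dvd hj p hp.out.ne_one
    have hvm : v < m := by
      by_contra hcon
      exact h (Dvd.dvd.mul_right (pow_dvd_pow p (not_lt.1 hcon)) l)
    have hdvd : ∀ i, p ^ (i + 1) ∣ p ^ v * l ↔ i < v := by
      intro i
      refine ⟨fun hi => ?_, fun hi => Dvd.dvd.mul_right (pow_dvd_pow p hi) l⟩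
      by_contra hcon
      have h1 : p ^ (v + 1) ∣ p ^ v * l := (pow_dvd_pow p (by omega)).trans hi
      rw [pow_succ] at h1
      exact hl (Nat.dvd_of_mul_dvd_mul_left (pow_pos hp.out.pos v) h1)
    simp only [hdvd]
    rw [Finset.prod_ite, Finset.prod_const_one, mul_one, qInt_mul, qInt_pow_eq_prod]
    have hr : (Finset.range m).filter (· < v) = Finset.range v := by
      ext i; simp only [Finset.mem_filter, Finset.mem_range]; omega
    rw [hr]
    exact associated_mul_unit_left _ _ (isUnit_qInt p _ _ hl)

/-- Legendre's formula: k / p^(i+1) counts the multiples of p^(i+1) up to k. -/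
lemma redFact_associated_prod (k : ℕ) :
    Associated (redFact p m k)
      (∏ i ∈ Finset.range m, cycloFactor p i ^ (k / p ^ (i + 1))) := by
  induction k with
  | zero => simp
  | succ k ih =>
    rw [redFact, Finset.prod_range_succ, ← redFact]
    refine (ih.mul_mul (redFact_factor_associated p m (Nat.succ_ne_zero k))).trans
      (Associated.of_eq ?_)
    rw [← Finset.prod_mul_distrib]
    refine Finset.prod_congr rfl fun i _ => ?_
    rw [Nat.succ_div]
    split_ifs <;> simp [pow_succ]

lemma isUnit_angle₁ {a b : ℕ}
    (h : ∀ i < m, (a + b) / p ^ (i + 1) = a / p ^ (i + 1) + b / p ^ (i + 1)) :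
    IsUnit (angle₁ p m (a + b) a) := by
  have h1 : Associated (redFact p m (a + b)) (redFact p m a * redFact p m b) := by
    refine (redFact_associated_prod p m _).trans (Associated.trans ?_
      ((redFact_associated_prod p m a).mul_mul (redFact_associated_prod p m b)).symm)
    rw [← Finset.prod_mul_distrib]
    refine Associated.of_eq (Finset.prod_congr rfl fun i hi => ?_)
    rw [h i (Finset.mem_range.1 hi), pow_add]
  rw [← angle₁_mul_redFact p m (rfl : a + b = a + b)] at h1
  obtain ⟨u, hu⟩ := h1
  have h0 := mul_ne_zero (redFact_ne_zero p m a) (redFact_ne_zero p m b)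
  refine IsUnit.of_mul_eq_one (u : Lam p) (mul_right_cancel₀ h0 ?_)
  linear_combination hu

lemma isUnit_angle₁_of_dvd {k : ℕ} (hk : p ^ m ∣ k) (l : ℕ) :
    IsUnit (angle₁ p m (k + l) k) := by
  refine isUnit_angle₁ p m fun i hi => ?_
  exact Nat.add_div_of_dvd_right ((pow_dvd_pow p hi).trans hk)

end coefficients

/-! ## Sums over decompositions of multi-indices -/

section antidiagonal

/-- Sums over 0 < k' < K are replaced by sums over all pairs with sum K; the operators attached to
the index 0 vanish, so the two extreme terms are harmless. -/
instance instHasAntidiagonalMIdx (d : ℕ) : Finset.HasAntidiagonal (MIdx d) where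
  antidiagonal K := (Finset.Iic K).image fun a => (a, K - a)
  mem_antidiagonal := by
    rintro K ⟨a, b⟩
    simp only [Finset.mem_image, Finset.mem_Iic, Prod.mk.injEq]
    constructor
    · rintro ⟨c, hc, rfl, rfl⟩
      exact add_tsub_cancel_of_le hc
    · rintro rfl
      exact ⟨a, le_self_add, rfl, add_tsub_cancel_left a b⟩

lemma sum_antidiagonal_assoc {S M : Type*} [AddCommMonoid S] [Finset.HasAntidiagonal S]
    [AddCommMonoid M] (K : S) (f : S → S → S → S → M) :
    ∑ x ∈ antidiagonal K, ∑ y ∈ antidiagonal x.1, f y.1 y.2 x.2 x.1 =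
      ∑ x ∈ antidiagonal K, ∑ y ∈ antidiagonal x.2,
        f x.1 y.1 y.2 (x.1 + y.1) := by
  rw [Finset.sum_sigma', Finset.sum_sigma']
  refine Finset.sum_bij' (fun z _ => ⟨(z.2.1, z.2.2 + z.1.2), (z.2.2, z.1.2)⟩)
    (fun z _ => ⟨(z.1.1 + z.2.1, z.2.2), (z.1.1, z.2.1)⟩) ?_ ?_ ?_ ?_ ?_
  all_goals
    rintro ⟨⟨a, b⟩, ⟨c, d⟩⟩ h
    simp only [Finset.mem_sigma, mem_antidiagonal] at h ⊢
    obtain ⟨h1, h2⟩ := h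
    subst h2
    subst h1
    simp [add_assoc]

variable {n : ℕ}

/-- The multi-index `(a, t)`. -/
abbrev snocIdx (a : MIdx n) (t : ℕ) : MIdx (n + 1) := Fin.snoc (α := fun _ => ℕ) a t

lemma snocIdx_add (a b : MIdx n) (s t : ℕ) :
    snocIdx a s + snocIdx b t = snocIdx (a + b) (s + t) := by
  funext i
  refine Fin.lastCases ?_ (fun i => ?_) i <;> simp [snocIdx]

lemma snocIdx_sub (a b : MIdx n) (s t : ℕ) :
    snocIdx a s - snocIdx b t = snocIdx (a - b) (s - t) := by
  funext i
  refine Fin.lastCases ?_ (fun i => ?_) i <;> simp [snocIdx]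

lemma snocIdx_injective2 {a b : MIdx n} {s t : ℕ} :
    snocIdx a s = snocIdx b t ↔ a = b ∧ s = t := by
  refine ⟨fun h => ?_, fun h => by rw [h.1, h.2]⟩
  exact (Fin.snoc_inj (α := fun _ => ℕ)).1 h

lemma snocIdx_eta (K : MIdx (n + 1)) :
    snocIdx (Fin.init (α := fun _ => ℕ) K) (K (Fin.last n)) = K :=
  Fin.snoc_init_self (α := fun _ => ℕ) K

lemma exists_snocIdx (K : MIdx (n + 1)) : ∃ a t, K = snocIdx a t :=
  ⟨_, _, (snocIdx_eta K).symm⟩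

@[simp] lemma snocIdx_zero : snocIdx (0 : MIdx n) 0 = 0 := by
  funext i
  refine Fin.lastCases ?_ (fun i => ?_) i <;> simp [snocIdx]

lemma snocIdx_eq_zero {a : MIdx n} {t : ℕ} : snocIdx a t = 0 ↔ a = 0 ∧ t = 0 := by
  rw [← snocIdx_zero, snocIdx_injective2]

lemma sum_antidiagonal_snocIdx {M : Type*} [AddCommMonoid M] (a : MIdx n) (t : ℕ)
    (f : MIdx (n + 1) → MIdx (n + 1) → M) :
    ∑ x ∈ antidiagonal (snocIdx a t), f x.1 x.2 =
      ∑ x ∈ antidiagonal a, ∑ y ∈ antidiagonal t,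
        f (snocIdx x.1 y.1) (snocIdx x.2 y.2) := by
  rw [← Finset.sum_product']
  symm
  refine Finset.sum_nbij (fun z => (snocIdx z.1.1 z.2.1, snocIdx z.1.2 z.2.2)) ?_ ?_ ?_ ?_
  · rintro ⟨⟨a1, a2⟩, ⟨t1, t2⟩⟩ h
    simp only [Finset.mem_product, mem_antidiagonal] at h ⊢
    rw [snocIdx_add, h.1, h.2]
  · rintro ⟨⟨a1, a2⟩, ⟨t1, t2⟩⟩ _ ⟨⟨b1, b2⟩, ⟨s1, s2⟩⟩ _ h
    simp only [Prod.mk.injEq, snocIdx_injective2] at h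
    simp [h.1.1, h.1.2, h.2.1, h.2.2]
  · rintro ⟨x, y⟩ h
    obtain ⟨a1, t1, rfl⟩ := exists_snocIdx x
    obtain ⟨a2, t2, rfl⟩ := exists_snocIdx y
    simp only [Finset.mem_coe, mem_antidiagonal, snocIdx_add, snocIdx_injective2] at h
    exact ⟨((a1, a2), (t1, t2)), by simpa using h, rfl⟩
  · rintro _ _
    rfl

lemma sum_range_range_eq_sum_antidiagonal {M : Type*} [AddCommMonoid M] (N : ℕ)
    (f : ℕ → ℕ → M) (h1 : ∀ i j, N < i → f i j = 0) (h2 : ∀ i j, N < j → f i j = 0) :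
    ∑ i ∈ Finset.range (N + 1), ∑ j ∈ Finset.range (N + 1), f i j =
      ∑ t ∈ Finset.range (N + N + 1), ∑ x ∈ antidiagonal t, f x.1 x.2 := by
  rw [← Finset.sum_product', Finset.sum_sigma']
  refine Finset.sum_bij_ne_zero (fun z _ _ => ⟨z.1 + z.2, z⟩) ?_ ?_ ?_ ?_
  · rintro ⟨i, j⟩ h _
    simp only [Finset.mem_product, Finset.mem_range] at h
    simp only [Finset.mem_sigma, Finset.mem_range, mem_antidiagonal, and_true]
    omega
  · rintro ⟨i, j⟩ _ _ ⟨i', j'⟩ _ _ h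
    simp only [Sigma.mk.injEq, heq_eq_eq] at h
    exact h.2
  · rintro ⟨t, i, j⟩ h hne
    simp only [Finset.mem_sigma, Finset.mem_range, mem_antidiagonal] at h
    refine ⟨(i, j), ?_, hne, by simp [h.2]⟩
    simp only [Finset.mem_product, Finset.mem_range]
    constructor
    · by_contra hc
      exact hne (h1 i j (by omega))
    · by_contra hc
      exact hne (h2 i j (by omega))
  · rintro _ _ _
    rfl

lemma weight_add {d : ℕ} (a b : MIdx d) : weight (a + b) = weight a + weight b := by
  simp [weight, Finset.sum_add_distrib]

lemma weight_snocIdx (a : MIdx n) (t : ℕ) : weight (snocIdx a t) = weight a + t := by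
  simp [weight, Fin.sum_univ_castSucc, snocIdx]

lemma weight_eq_zero {d : ℕ} {a : MIdx d} : weight a = 0 ↔ a = 0 := by
  simp [weight, funext_iff]

@[simp] lemma weight_zero {d : ℕ} : weight (0 : MIdx d) = 0 := weight_eq_zero.2 rfl

end antidiagonal

/-! ### Coefficients of multi-indices -/

section angle

variable (p : ℕ) [Fact p.Prime] (m : ℕ) {d n : ℕ}

lemma angle_snocIdx (a b : MIdx n) (s t : ℕ) :
    angle p m (snocIdx a s) (snocIdx b t) = angle p m a b * angle₁ p m s t := by
  simp [angle, Fin.prod_univ_castSucc, snocIdx]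

@[simp] lemma angle_zero_right (a : MIdx d) : angle p m a 0 = 1 := by simp [angle]

@[simp] lemma angle_self (a : MIdx d) : angle p m a a = 1 := by simp [angle]

lemma angle_ne_zero {a b : MIdx d} (h : b ≤ a) : angle p m a b ≠ 0 :=
  Finset.prod_ne_zero_iff.2 fun i _ => angle₁_ne_zero p m (h i)

lemma angle_symm {k a b : MIdx d} (h : a + b = k) : angle p m k a = angle p m k b :=
  Finset.prod_congr rfl fun i _ => angle₁_symm p m (congrFun h i)

lemma angle_assoc {k a b c ab bc : MIdx d} (h1 : a + b = ab) (h2 : b + c = bc)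
    (h : ab + c = k) :
    angle p m k ab * angle p m ab a = angle p m k a * angle p m bc b := by
  simp only [angle, ← Finset.prod_mul_distrib]
  exact Finset.prod_congr rfl fun i _ =>
    angle₁_assoc p m (congrFun h1 i) (congrFun h2 i) (congrFun h i)

lemma angle_mul_angle_sub (k a b : MIdx d) :
    angle p m k b * angle p m (k - b) a = angle p m (a + b) a * angle p m k (a + b) := by
  simp only [angle, ← Finset.prod_mul_distrib]
  exact Finset.prod_congr rfl fun i _ => angle₁_mul_angle₁_sub p m (k i) (a i) (b i)

end angle

/-! ## The tensor algebra -/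

section tensorAlgebra

variable (p : ℕ) [Fact p.Prime] (m : ℕ) {d : ℕ}

lemma angle_sum_assoc {M : Type*} [AddCommGroup M] [Module (Lam p) M] (K : MIdx d)
    (f : MIdx d → MIdx d → MIdx d → M) :
    ∑ x ∈ antidiagonal K, ∑ y ∈ antidiagonal x.1,
        (angle p m K x.1 * angle p m x.1 y.1) • f y.1 y.2 x.2 =
      ∑ x ∈ antidiagonal K, ∑ y ∈ antidiagonal x.2,
        (angle p m K x.1 * angle p m x.2 y.1) • f x.1 y.1 y.2 := by
  rw [sum_antidiagonal_assoc K
    (fun a b c ab => (angle p m K ab * angle p m ab a) • f a b c)]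
  refine Finset.sum_congr rfl fun x hx => Finset.sum_congr rfl fun y hy => ?_
  rw [mem_antidiagonal] at hx hy
  rw [angle_assoc p m rfl hy (by rw [add_assoc, hy, hx])]

/-- Left multiplication by the letter `K`, and `0` if `K = 0`. -/
def letterMul (K : MIdx d) : NP p d →ₗ[Lam p] NP p d :=
  if h : K ≠ 0 then lmul p [⟨K, h⟩] else 0

@[simp] lemma letterMul_zero : letterMul p (0 : MIdx d) = 0 := by simp [letterMul]

lemma letterMul_single (k : Letter d) (w : List (Letter d)) (c : Lam p) :
    letterMul p k.1 (Finsupp.single w c) = Finsupp.single (k :: w) c := by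
  simp [letterMul, k.2, lmul]

lemma letterMul_letter (k : Letter d) : letterMul p k.1 = lmul p [k] := by
  simp [letterMul, k.2]

lemma sum_antidiagonal_eq_sum_Ioo {M : Type*} [AddCommMonoid M] (K : MIdx d)
    (f : MIdx d → MIdx d → M) (h1 : ∀ b, f 0 b = 0) (h2 : ∀ a, f a 0 = 0) :
    ∑ x ∈ antidiagonal K, f x.1 x.2 = ∑ a ∈ Finset.Ioo 0 K, f a (K - a) := by
  have e : antidiagonal K = (Finset.Iic K).image fun a => (a, K - a) := rfl
  rw [e, Finset.sum_image fun _ _ _ _ h => congrArg Prod.fst h]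
  symm
  refine Finset.sum_subset (fun a ha => Finset.mem_Iic.2 (Finset.mem_Ioo.1 ha).2.le) ?_
  intro a ha hna
  rw [Finset.mem_Iic] at ha
  by_cases h0 : a = 0
  · rw [h0, h1]
  · have : a = K := by
      by_contra hK
      exact hna (Finset.mem_Ioo.2 ⟨lt_of_le_of_ne (zero_le (a := a)) (Ne.symm h0),
        lt_of_le_of_ne ha hK⟩)
    rw [this, tsub_self, h2]

lemma dNP_single (w : List (Letter d)) (c : Lam p) :
    dNP p m (Finsupp.single w c) = c • dWord p m w := by
  simp [dNP]

/-- The graded Leibniz rule as an identity of operators, without reference to words. With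
`letterMul` zero at 0 it holds for every K. -/
lemma dNP_letterMul (K : MIdx d) (x : NP p d) :
    dNP p m (letterMul p K x) = -letterMul p K (dNP p m x)
      - ∑ y ∈ antidiagonal K, angle p m K y.1 • letterMul p y.1 (letterMul p y.2 x) := by
  by_cases hK : K = 0
  · subst hK
    simp only [letterMul_zero, LinearMap.zero_apply, map_zero, neg_zero, zero_sub]
    rw [eq_comm, neg_eq_zero]
    refine Finset.sum_eq_zero fun y hy => ?_
    have : y.1 = 0 := by
      have := mem_antidiagonal.1 hy
      exact (add_eq_zero.1 this).1
    simp [this]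
  induction x using Finsupp.induction_linear with
  | zero => simp
  | add x y hx hy =>
    simp only [map_add, hx, hy, smul_add, Finset.sum_add_distrib]
    abel
  | single w c =>
    have e1 := letterMul_single p ⟨K, hK⟩ w c
    simp only at e1
    rw [e1, dNP_single, dNP_single, dWord, map_smul, letterMul_letter p ⟨K, hK⟩, smul_sub,
      sum_antidiagonal_eq_sum_Ioo K
        (fun a b => angle p m K a • letterMul p a (letterMul p b (Finsupp.single w c)))
        (by simp) (by simp)]
    rw [sub_eq_neg_add, sub_eq_add_neg]
    congr 1
    rw [dLetter, map_neg, smul_neg, map_sum, Finset.smul_sum,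
      ← Finset.sum_attach (Finset.Ioo 0 K)]
    congr 1
    refine Finset.sum_congr rfl fun a _ => ?_
    have e2 := letterMul_single p ⟨K - a.1, sub_ne_zero_of_mem_Ioo a.2⟩ w c
    have e3 := letterMul_single p ⟨a.1, ne_zero_of_mem_Ioo a.2⟩
      (⟨K - a.1, sub_ne_zero_of_mem_Ioo a.2⟩ :: w) c
    simp only at e2 e3
    rw [e2, e3]
    simp [rmul, mul_comm]

/-- Both Leibniz expansions of d² on a letter are sums over triples with sum k, with opposite signs;
`angle_sum_assoc` matches them. -/
lemma dNP_dNP (x : NP p d) : dNP p m (dNP p m x) = 0 := by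
  induction x using Finsupp.induction_linear with
  | zero => simp
  | add x y hx hy => simp only [map_add, hx, hy, add_zero]
  | single w c =>
    induction w with
    | nil => simp [dNP_single, dWord]
    | cons k w ih =>
      rw [← letterMul_single]
      generalize Finsupp.single w c = x at ih
      have key := angle_sum_assoc p m k.1
        (fun a b c => letterMul p a (letterMul p b (letterMul p c x)))
      simp only [dNP_letterMul, map_sub, map_neg, map_sum, map_smul, ih, smul_sub, smul_neg,
        Finset.smul_sum, smul_smul, Finset.sum_sub_distrib, Finset.sum_neg_distrib, map_zero]
      rw [key]
      abel

end tensorAlgebra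

/-! ## The `q`-jet complex -/

section jetComplex

variable (p : ℕ) [Fact p.Prime] (m : ℕ) {d : ℕ}

lemma letterMul_mem_K (K' : MIdx d) {x : NP p d} (hx : x ∈ K p m d) :
    letterMul p K' x ∈ K p m d := by
  rw [letterMul]
  split_ifs
  · exact (K_isDGIdeal p m d).lmul_mem _ _ hx
  · exact zero_mem _

/-- Left multiplication by `(dξ)^{(K)_q}` on the `q`-jet complex, and `0` if `K = 0`. -/
def formMul (K' : MIdx d) : Om p m d →ₗ[Lam p] Om p m d :=
  (K p m d).mapQ (K p m d) (letterMul p K') fun _ hx => letterMul_mem_K p m K' hx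

lemma formMul_mkQ (K' : MIdx d) (x : NP p d) :
    formMul p m K' ((K p m d).mkQ x) = (K p m d).mkQ (letterMul p K' x) := rfl

lemma dOm_mkQ (x : NP p d) : dOm p m d ((K p m d).mkQ x) = (K p m d).mkQ (dNP p m x) := rfl

@[simp] lemma formMul_zero : formMul p m (0 : MIdx d) = 0 := by
  refine LinearMap.ext fun x => ?_
  obtain ⟨x, rfl⟩ := (K p m d).mkQ_surjective x
  rw [formMul_mkQ]
  simp

lemma cls_cons (k : Letter d) (w : List (Letter d)) :
    cls p m (k :: w) = formMul p m k.1 (cls p m w) := by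
  rw [cls, cls, formMul_mkQ, letterMul_single]

lemma formMul_letter (k : Letter d) : formMul p m k.1 = lmulOm p m k := by
  refine LinearMap.ext fun x => ?_
  obtain ⟨x, rfl⟩ := (K p m d).mkQ_surjective x
  rw [formMul_mkQ, letterMul_letter]
  rfl

lemma mkQ_single (w : List (Letter d)) (c : Lam p) :
    (K p m d).mkQ (Finsupp.single w c) = c • cls p m w := by
  rw [cls, ← map_smul, Finsupp.smul_single_one]

lemma span_range_cls : Submodule.span (Lam p) (Set.range (cls p m (d := d))) = ⊤ := by
  rw [eq_top_iff]
  rintro x -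
  obtain ⟨x, rfl⟩ := (K p m d).mkQ_surjective x
  induction x using Finsupp.induction_linear with
  | zero => rw [map_zero]; exact zero_mem _
  | add x y hx hy => rw [map_add]; exact add_mem hx hy
  | single w c =>
    rw [mkQ_single]
    exact Submodule.smul_mem _ _ (Submodule.subset_span ⟨w, rfl⟩)

lemma Om_ext {M : Type*} [AddCommGroup M] [Module (Lam p) M] {f g : Om p m d →ₗ[Lam p] M}
    (h : ∀ w, f (cls p m w) = g (cls p m w)) : f = g :=
  LinearMap.ext_on (span_range_cls p m) (by rintro _ ⟨w, rfl⟩; exact h w)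

/-- A submodule that contains `1` and is stable under left multiplication by forms is everything. -/
lemma eq_top_of_formMul_mem (P : Submodule (Lam p) (Om p m d)) (h1 : cls p m [] ∈ P)
    (h2 : ∀ K', ∀ x ∈ P, formMul p m K' x ∈ P) : P = ⊤ := by
  rw [← top_le_iff, ← span_range_cls p m, Submodule.span_le]
  rintro _ ⟨w, rfl⟩
  induction w with
  | nil => exact h1
  | cons k w ih => rw [cls_cons]; exact h2 _ _ ih

lemma single_mem_K {k : Letter d} (hk : p ^ m < weight k.1) :
    Finsupp.single [k] 1 ∈ K p m d :=
  (Submodule.mem_sInf).2 fun _ hJ => hJ.2 k hk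

lemma formMul_eq_zero {K' : MIdx d} (hK : p ^ m < weight K') : formMul p m K' = 0 := by
  have h0 : K' ≠ 0 := by rintro rfl; simp at hK
  refine Om_ext p m fun w => ?_
  have h1 := (K_isDGIdeal p m d).rmul_mem w _ (single_mem_K p m (k := ⟨K', h0⟩) hK)
  have h2 : rmul p w (Finsupp.single [⟨K', h0⟩] 1) = Finsupp.single (⟨K', h0⟩ :: w) 1 := by
    simp [rmul]
  rw [h2] at h1
  have h3 := cls_cons p m ⟨K', h0⟩ w
  simp only at h3
  rw [← h3, LinearMap.zero_apply, cls, Submodule.mkQ_apply, Submodule.Quotient.mk_eq_zero]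
  exact h1

lemma dOm_formMul (K' : MIdx d) (x : Om p m d) :
    dOm p m d (formMul p m K' x) = -formMul p m K' (dOm p m d x)
      - ∑ y ∈ antidiagonal K', angle p m K' y.1 • formMul p m y.1 (formMul p m y.2 x) := by
  obtain ⟨x, rfl⟩ := (K p m d).mkQ_surjective x
  simp only [formMul_mkQ, dOm_mkQ, dNP_letterMul, map_sub, map_neg, map_sum, map_smul]

lemma dOm_dOm (x : Om p m d) : dOm p m d (dOm p m d x) = 0 := by
  obtain ⟨x, rfl⟩ := (K p m d).mkQ_surjective x
  rw [dOm_mkQ, dOm_mkQ, dNP_dNP, map_zero]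

lemma dOm_one : dOm p m d (cls p m []) = 0 := by
  rw [cls, dOm_mkQ, dNP_single, dWord, smul_zero, map_zero]

/-- The differential of a vanishing letter vanishes. These are the quadratic relations of the
quotient algebra. -/
lemma sum_formMul_formMul {K' : MIdx d} (hK : p ^ m < weight K') (x : Om p m d) :
    ∑ y ∈ antidiagonal K', angle p m K' y.1 • formMul p m y.1 (formMul p m y.2 x) = 0 := by
  have := dOm_formMul p m K' x
  rw [formMul_eq_zero p m hK] at this
  simpa using this.symm

/-- Action of the tensor algebra defined by the action of the letters. -/
def wordAction {Y : Type*} [AddCommGroup Y] [Module (Lam p) Y]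
    (B : MIdx d → Y →ₗ[Lam p] Y) : NP p d →ₗ[Lam p] (Y →ₗ[Lam p] Y) :=
  Finsupp.linearCombination (Lam p) fun w => (w.map fun k : Letter d => B k.1).prod

/-! ### Actions of the tensor algebra that factor through the `q`-jet complex -/

section universal

variable {Y : Type*} [AddCommGroup Y] [Module (Lam p) Y] (B : MIdx d → Y →ₗ[Lam p] Y)

lemma wordAction_single (w : List (Letter d)) (c : Lam p) :
    wordAction p B (Finsupp.single w c) = c • (w.map fun k : Letter d => B k.1).prod := by
  simp [wordAction]

lemma wordAction_lmul (u : List (Letter d)) (x : NP p d) :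
    wordAction p B (lmul p u x) = (u.map fun k : Letter d => B k.1).prod * wordAction p B x := by
  induction x using Finsupp.induction_linear with
  | zero => simp
  | add x y hx hy => simp only [map_add, hx, hy, mul_add]
  | single w c => simp [lmul, wordAction_single]

lemma wordAction_rmul (u : List (Letter d)) (x : NP p d) :
    wordAction p B (rmul p u x) = wordAction p B x * (u.map fun k : Letter d => B k.1).prod := by
  induction x using Finsupp.induction_linear with
  | zero => simp
  | add x y hx hy => simp only [map_add, hx, hy, add_mul]
  | single w c => simp [rmul, wordAction_single]

lemma dWord_append (u v : List (Letter d)) :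
    dWord p m (u ++ v) = rmul p v (dWord p m u) + (-1 : Lam p) ^ u.length •
      lmul p u (dWord p m v) := by
  induction u with
  | nil =>
    have : lmul p ([] : List (Letter d)) = LinearMap.id := by
      refine Finsupp.lhom_ext fun w c => ?_
      simp [lmul]
    simp [dWord, this]
  | cons k u ih =>
    have h1 : ∀ x : NP p d, rmul p (u ++ v) x = rmul p v (rmul p u x) := by
      intro x
      induction x using Finsupp.induction_linear with
      | zero => simp
      | add x y hx hy => simp only [map_add, hx, hy]
      | single w c => simp [rmul]
    have h2 : ∀ x : NP p d, lmul p (k :: u) x = lmul p [k] (lmul p u x) := by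
      intro x
      induction x using Finsupp.induction_linear with
      | zero => simp
      | add x y hx hy => simp only [map_add, hx, hy]
      | single w c => simp [lmul]
    have h3 : ∀ x : NP p d, rmul p v (lmul p [k] x) = lmul p [k] (rmul p v x) := by
      intro x
      induction x using Finsupp.induction_linear with
      | zero => simp
      | add x y hx hy => simp only [map_add, hx, hy]
      | single w c => simp [lmul, rmul]
    rw [List.cons_append, dWord, ih, dWord, h1, map_sub, h3, map_add, map_smul, ← h2,
      List.length_cons, pow_succ]
    module

lemma wordAction_dNP_lmul (u : List (Letter d)) (x : NP p d) :
    wordAction p B (dNP p m (lmul p u x)) = wordAction p B (dWord p m u) * wordAction p B x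
      + (-1 : Lam p) ^ u.length • ((u.map fun k : Letter d => B k.1).prod *
        wordAction p B (dNP p m x)) := by
  induction x using Finsupp.induction_linear with
  | zero => simp
  | add x y hx hy => simp only [map_add, hx, hy, mul_add, smul_add]; abel
  | single w c =>
    have : lmul p u (Finsupp.single w c) = Finsupp.single (u ++ w) c := by simp [lmul]
    rw [this, dNP_single, dNP_single, dWord_append, map_smul, map_smul, map_add, map_smul,
      wordAction_rmul, wordAction_lmul, wordAction_single, mul_smul_comm, mul_smul_comm]
    module

/-- Replacing B by -B realizes the sign (-1)^deg, so that the Leibniz rule for `rmul` can be stated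
for inhomogeneous elements. -/
lemma wordAction_neg_single (w : List (Letter d)) (c : Lam p) :
    wordAction p (-B) (Finsupp.single w c) = (-1 : Lam p) ^ w.length •
      wordAction p B (Finsupp.single w c) := by
  rw [wordAction_single, wordAction_single, smul_comm]
  congr 1
  induction w with
  | nil => simp
  | cons k w ih =>
    rw [List.map_cons, List.prod_cons, ih, Pi.neg_apply, neg_mul, mul_smul_comm,
      List.length_cons, pow_succ, mul_neg_one, neg_smul, List.map_cons, List.prod_cons]

lemma wordAction_dNP_rmul (u : List (Letter d)) (x : NP p d) :
    wordAction p B (dNP p m (rmul p u x)) =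
      wordAction p B (dNP p m x) * (u.map fun k : Letter d => B k.1).prod
      + wordAction p (-B) x * wordAction p B (dWord p m u) := by
  induction x using Finsupp.induction_linear with
  | zero => simp
  | add x y hx hy => simp only [map_add, hx, hy, add_mul]; abel
  | single w c =>
    have : rmul p u (Finsupp.single w c) = Finsupp.single (w ++ u) c := by simp [rmul]
    rw [this, dNP_single, dNP_single, dWord_append, map_smul, map_smul, map_add, map_smul,
      wordAction_rmul, wordAction_lmul, wordAction_neg_single, wordAction_single, smul_mul_assoc,
      smul_mul_assoc, smul_mul_assoc]
    module

variable {B} in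
lemma wordAction_mem {P : Submodule (Lam p) Y} (hP : ∀ k, ∀ y ∈ P, B k y ∈ P) (x : NP p d) :
    ∀ y ∈ P, wordAction p B x y ∈ P := by
  intro y hy
  induction x using Finsupp.induction_linear with
  | zero => simp
  | add x z hx hz => rw [map_add]; exact add_mem hx hz
  | single w c =>
    rw [wordAction_single]
    refine Submodule.smul_mem _ _ ?_
    induction w with
    | nil => simpa using hy
    | cons k w ih => rw [List.map_cons, List.prod_cons]; exact hP _ _ ih

lemma wordAction_letterMul (h0 : B 0 = 0) (k : MIdx d) (x : NP p d) :
    wordAction p B (letterMul p k x) = B k * wordAction p B x := by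
  by_cases hk : k = 0
  · simp [hk, h0]
  · have := letterMul_letter p ⟨k, hk⟩
    simp only at this
    rw [this, wordAction_lmul]
    simp

/-- Endomorphisms that satisfy the defining relations of the `q`-jet complex on a stable
submodule. -/
structure IsFormAction (P : Submodule (Lam p) Y) : Prop where
  zero : B 0 = 0
  mem : ∀ k, ∀ y ∈ P, B k y ∈ P
  big : ∀ k, p ^ m < weight k → ∀ y ∈ P, B k y = 0
  rel : ∀ k, p ^ m < weight k → ∀ y ∈ P,
    ∑ x ∈ antidiagonal k, angle p m k x.1 • B x.1 (B x.2 y) = 0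

variable {B} {P : Submodule (Lam p) Y}

lemma IsFormAction.neg (hB : IsFormAction p m B P) : IsFormAction p m (-B) P where
  zero := by simp [hB.zero]
  mem k y hy := by simpa using hB.mem k y hy
  big k hk y hy := by simpa using hB.big k hk y hy
  rel k hk y hy := by simpa using hB.rel k hk y hy

lemma IsFormAction.letter (hB : IsFormAction p m B P) {k : Letter d}
    (hk : p ^ m < weight k.1) {y : Y} (hy : y ∈ P) :
    wordAction p B (Finsupp.single [k] 1) y = 0 ∧
      wordAction p B (dNP p m (Finsupp.single [k] 1)) y = 0 := by
  constructor
  · simpa [wordAction_single] using hB.big k.1 hk y hy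
  · rw [← letterMul_single, dNP_letterMul, dNP_single, dWord, smul_zero, map_zero, neg_zero,
      zero_sub, map_neg, map_sum]
    simp only [map_smul, wordAction_letterMul p B hB.zero, LinearMap.neg_apply,
      LinearMap.sum_apply, LinearMap.smul_apply, Module.End.mul_apply]
    rw [neg_eq_zero]
    simpa [wordAction_single] using hB.rel k.1 hk y hy

/-- As d² = 0, the DG-ideal needs nothing beyond the large letters and their differentials; it
suffices that these act as zero. -/
lemma IsFormAction.wordAction_eq_zero (hB : IsFormAction p m B P) {x : NP p d}
    (hx : x ∈ K p m d) {y : Y} (hy : y ∈ P) : wordAction p B x y = 0 := by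
  -- Imposing the condition on dx makes J stable under d. Imposing it for -B as well makes J stable
  -- under right multiplication, where the sign of the Leibniz rule turns B into -B.
  let J : Submodule (Lam p) (NP p d) :=
    { carrier := {x | ∀ y ∈ P, (wordAction p B x y = 0 ∧ wordAction p B (dNP p m x) y = 0) ∧
        (wordAction p (-B) x y = 0 ∧ wordAction p (-B) (dNP p m x) y = 0)}
      add_mem' := by
        intro a b ha hb y hy
        simp [ha y hy, hb y hy]
      zero_mem' := by simp
      smul_mem' := by
        intro c a ha y hy
        simp [ha y hy] }
  have hJ : K p m d ≤ J := by
    refine sInf_le ⟨⟨?_, ?_, ?_⟩, ?_⟩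
    · intro u x hx y hy
      obtain ⟨⟨h1, h2⟩, h3, h4⟩ := hx y hy
      simp [wordAction_lmul, wordAction_dNP_lmul, h1, h2, h3, h4]
    · intro v x hx y hy
      have e1 : ∀ y ∈ P, (v.map fun k : Letter d => B k.1).prod y ∈ P := fun y hy => by
        simpa [wordAction_single] using wordAction_mem p hB.mem (Finsupp.single v 1) y hy
      have e2 : ∀ y ∈ P, (v.map fun k : Letter d => (-B) k.1).prod y ∈ P := fun y hy => by
        simpa [wordAction_single] using wordAction_mem p (hB.neg p m).mem (Finsupp.single v 1) y hy
      have e3 := wordAction_mem p hB.mem (dWord p m v)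
      have e4 := wordAction_mem p (hB.neg p m).mem (dWord p m v)
      rw [wordAction_rmul, wordAction_dNP_rmul, wordAction_rmul, wordAction_dNP_rmul, neg_neg]
      simp only [Module.End.mul_apply, LinearMap.add_apply]
      rw [(hx _ (e1 y hy)).1.1, (hx _ (e1 y hy)).1.2, (hx _ (e3 y hy)).2.1,
        (hx _ (e2 y hy)).2.1, (hx _ (e2 y hy)).2.2, (hx _ (e4 y hy)).1.1]
      simp
    · intro x hx y hy
      obtain ⟨⟨h1, h2⟩, h3, h4⟩ := hx y hy
      simp [dNP_dNP, h2, h4]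
    · intro k hk y hy
      exact ⟨hB.letter p m hk hy, (hB.neg p m).letter p m hk hy⟩
  exact (hJ hx y hy).1.1

/-- The orbit map of an action of the `q`-jet complex. -/
lemma IsFormAction.exists_lift (hB : IsFormAction p m B P) {y : Y} (hy : y ∈ P) :
    ∃ f : Om p m d →ₗ[Lam p] Y, f (cls p m []) = y ∧
      ∀ k x, f (formMul p m k x) = B k (f x) := by
  refine ⟨(K p m d).liftQ ((wordAction p B).flip y) fun x hx => ?_, ?_, fun k x => ?_⟩
  · exact hB.wordAction_eq_zero p m hx hy
  · change wordAction p B (Finsupp.single [] 1) y = y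
    simp [wordAction_single]
  · obtain ⟨x, rfl⟩ := (K p m d).mkQ_surjective x
    change wordAction p B (letterMul p k x) y = B k (wordAction p B x y)
    rw [wordAction_letterMul p B hB.zero, Module.End.mul_apply]

end universal

/-- A linear map on the `q`-jet complex is determined by its value at `1` and a recursion for left
multiplication by forms, and each recursion compatible with the relations is allowed. -/
lemma exists_extension {X : Type*} [AddCommGroup X] [Module (Lam p) X]
    (M : MIdx d → Om p m d →ₗ[Lam p] X) (L : MIdx d → X →ₗ[Lam p] X)
    (hM0 : M 0 = 0) (hL0 : L 0 = 0)
    (hM : ∀ k, p ^ m < weight k → M k = 0) (hL : ∀ k, p ^ m < weight k → L k = 0)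
    (hML : ∀ k, p ^ m < weight k → ∀ w, ∑ x ∈ antidiagonal k, angle p m k x.1 •
      (M x.1 (formMul p m x.2 w) + L x.1 (M x.2 w)) = 0)
    (hLL : ∀ k, p ^ m < weight k → ∀ z, ∑ x ∈ antidiagonal k, angle p m k x.1 •
      L x.1 (L x.2 z) = 0) (x₀ : X) :
    ∃ f : Om p m d →ₗ[Lam p] X, f (cls p m []) = x₀ ∧
      ∀ k w, f (formMul p m k w) = M k w + L k (f w) := by
  -- The recursion is read as a triangular action on Ω × X; the second component of the orbit of (1,
  -- x₀) is the desired map.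
  let B : MIdx d → (Om p m d × X) →ₗ[Lam p] (Om p m d × X) := fun k =>
    (formMul p m k ∘ₗ LinearMap.fst _ _ _).prod
      (M k ∘ₗ LinearMap.fst _ _ _ + L k ∘ₗ LinearMap.snd _ _ _)
  have hB : IsFormAction p m B ⊤ :=
    { zero := by
        refine LinearMap.ext fun y => ?_
        simp [B, hM0, hL0]
      mem := fun _ _ _ => trivial
      big := fun k hk y _ => by simp [B, hM k hk, hL k hk, formMul_eq_zero p m hk]
      rel := fun k hk y _ => by
        refine Prod.ext ?_ ?_
        · simpa [B, Prod.fst_sum] using sum_formMul_formMul p m hk y.1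
        · have h1 := hML k hk y.1
          have h2 := hLL k hk y.2
          have h3 := congrArg₂ (· + ·) h1 h2
          simp only [← Finset.sum_add_distrib, add_zero] at h3
          rw [Prod.snd_sum, Prod.snd_zero, ← h3]
          refine Finset.sum_congr rfl fun x _ => ?_
          simp [B, add_assoc] }
  obtain ⟨f, h1, h2⟩ := hB.exists_lift p m (y := (cls p m [], x₀)) trivial
  have h3 : LinearMap.fst _ _ _ ∘ₗ f = LinearMap.id := by
    refine Om_ext p m fun w => ?_
    induction w with
    | nil => simp [h1]
    | cons k w ih =>
      simp only [LinearMap.comp_apply, LinearMap.fst_apply, LinearMap.id_apply] at ih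
      simp [cls_cons, h2, B, ih]
  refine ⟨LinearMap.snd _ _ _ ∘ₗ f, by simp [h1], fun k w => ?_⟩
  have h4 : (f w).1 = w := LinearMap.congr_fun h3 w
  simp [h2, B, h4]

end jetComplex

/-! ## Operators on the linearized `q`-jet complex -/

section operators

variable (p : ℕ) [Fact p.Prime] (m : ℕ) {d n : ℕ} (A : Type*) [CommRing A] [Algebra (Lam p) A]

lemma hatMap_of (f : PDPoly d A →ₗ[A] PDPoly d A) (x : PDPoly d A) :
    hatMap p A f (AdicCompletion.of (adicIdeal p A) (PDPoly d A) x) =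
      AdicCompletion.of (adicIdeal p A) (PDPoly d A) (f x) :=
  AdicCompletion.map_of _ _ _

lemma hatMap_hatMap (f g : PDPoly d A →ₗ[A] PDPoly d A) (y : PDHat p d A) :
    hatMap p A f (hatMap p A g y) = hatMap p A (f ∘ₗ g) y :=
  AdicCompletion.map_comp_apply _ _ _ _

lemma hatMap_id (y : PDHat p d A) : hatMap p A LinearMap.id y = y := by
  change AdicCompletion.map (adicIdeal p A) LinearMap.id y = y
  rw [AdicCompletion.map_id]
  rfl

lemma hatMap_smul (c : Lam p) (f : PDPoly d A →ₗ[A] PDPoly d A) (y : PDHat p d A) :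
    hatMap p A (c • f) y = c • hatMap p A f y := by
  obtain ⟨x, rfl⟩ := AdicCompletion.mk_surjective _ _ y
  refine AdicCompletion.ext fun k => ?_
  rfl

/-- The element `ξ^{K}`. -/
def mono (K' : MIdx d) : PDHat p d A :=
  AdicCompletion.of (adicIdeal p A) (PDPoly d A) (Finsupp.single K' 1)

lemma gen_eq (K' : MIdx d) (w : List (Letter d)) :
    gen p m A K' w = mono p A K' ⊗ₜ[Lam p] cls p m w := rfl

/-- The extension of `shift b` to the completion. -/
def lower (b : MIdx d) : PDHat p d A →ₗ[A] PDHat p d A := hatMap p A (shift p m A b)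

lemma shift_single (b k : MIdx d) (c : A) : shift p m A b (Finsupp.single k c) =
    angle p m k b • Finsupp.single (k - b) c := by
  rw [shift, Finsupp.linearCombination_single]
  split_ifs with h
  · rw [Finsupp.smul_single, Finsupp.smul_single, smul_eq_mul, Algebra.smul_def, mul_comm]
  · push Not at h
    obtain ⟨i, hi⟩ := h
    have : angle p m k b = 0 :=
      Finset.prod_eq_zero (Finset.mem_univ i) (angle₁_eq_zero p m hi)
    rw [this, smul_zero, zero_smul]

lemma lower_mono (b k : MIdx d) :
    lower p m A b (mono p A k) = angle p m k b • mono p A (k - b) := by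
  rw [lower, mono, hatMap_of, shift_single]
  exact LinearMap.map_smul_of_tower _ _ _

lemma poly_ext {f g : PDPoly d A →ₗ[A] PDPoly d A}
    (h : ∀ k, f (Finsupp.single k 1) = g (Finsupp.single k 1)) : f = g := by
  refine Finsupp.lhom_ext' fun k => LinearMap.ext_ring ?_
  exact h k

/-- The lowering operators multiply like divided powers; `angle_mul_angle_sub` is the coefficient
identity behind this. -/
lemma lower_lower (a b : MIdx d) (y : PDHat p d A) :
    lower p m A a (lower p m A b y) = angle p m (a + b) a • lower p m A (a + b) y := by
  rw [lower, lower, lower, hatMap_hatMap, ← hatMap_smul]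
  congr 2
  refine poly_ext A fun k => ?_
  simp only [LinearMap.comp_apply, LinearMap.smul_apply, shift_single,
    LinearMap.map_smul_of_tower, smul_smul]
  rw [tsub_tsub, add_comm b a, angle_mul_angle_sub]

lemma lower_zero (y : PDHat p d A) : lower p m A 0 y = y := by
  conv_rhs => rw [← hatMap_id p A y]
  rw [lower]
  congr 2
  refine poly_ext A fun k => ?_
  simp [shift_single]

/-- The map `ξ^{(a, k)} ↦ ⟨k + l, k⟩⁻¹ ξ^{(a, k + l)}` if `p ^ m ∣ k`, and `0` otherwise. -/
def raisePoly (l : ℕ) : PDPoly (n + 1) A →ₗ[A] PDPoly (n + 1) A :=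
  Finsupp.linearCombination A fun k =>
    if p ^ m ∣ k (Fin.last n) then
      Ring.inverse (angle₁ p m (k (Fin.last n) + l) (k (Fin.last n))) •
        Finsupp.single (k + snocIdx 0 l) 1
    else 0

/-- The extension of `raisePoly` to the completion. -/
def raise (l : ℕ) : PDHat p (n + 1) A →ₗ[A] PDHat p (n + 1) A := hatMap p A (raisePoly p m A l)

lemma raisePoly_single (a : MIdx n) (k l : ℕ) :
    raisePoly p m A l (Finsupp.single (snocIdx a k) 1) =
      if p ^ m ∣ k then
        Ring.inverse (angle₁ p m (k + l) k) • Finsupp.single (snocIdx a (k + l)) 1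
      else 0 := by
  rw [raisePoly, Finsupp.linearCombination_single, one_smul]
  have h : (snocIdx a k) (Fin.last n) = k := by simp [snocIdx]
  rw [h, snocIdx_add, add_zero]

lemma raise_mono (a : MIdx n) (k l : ℕ) :
    raise p m A l (mono p A (snocIdx a k)) =
      if p ^ m ∣ k then
        Ring.inverse (angle₁ p m (k + l) k) • mono p A (snocIdx a (k + l)) else 0 := by
  rw [raise, mono, hatMap_of, raisePoly_single]
  split_ifs
  · exact LinearMap.map_smul_of_tower _ _ _
  · exact map_zero _

/-- With p^m ∣ k both coefficients that are inverted are units, and after clearing them the claim is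
a trinomial identity for (k, j, l - j). The index `l - j = 0` is allowed: `raise` at 0 is the
projector onto last exponents divisible by p^m. -/
lemma lower_raise {j l : ℕ} (hj : j ≤ l) (y : PDHat p (n + 1) A) :
    lower p m A (snocIdx 0 j) (raise p m A l y) = angle₁ p m l j • raise p m A (l - j) y := by
  rw [lower, raise, raise, hatMap_hatMap, ← hatMap_smul]
  congr 2
  refine poly_ext A fun k => ?_
  obtain ⟨a, k, rfl⟩ := exists_snocIdx k
  rw [LinearMap.comp_apply, LinearMap.smul_apply, raisePoly_single, raisePoly_single]
  split_ifs with h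
  · rw [LinearMap.map_smul_of_tower, shift_single, smul_smul, smul_smul, snocIdx_sub, tsub_zero,
      Nat.add_sub_assoc hj, angle_snocIdx, angle_zero_right, one_mul]
    congr 1
    have h1 := isUnit_angle₁_of_dvd p m h l
    have h2 := isUnit_angle₁_of_dvd p m h (l - j)
    have h3 := angle₁_mul_angle₁_sub p m (k + l) j k
    have h4 := angle₁_mul_angle₁_sub p m (k + l) k j
    rw [Nat.add_sub_cancel_left, add_comm j k] at h3
    rw [angle₁_symm p m (rfl : k + j = k + j), ← h3, Nat.add_sub_assoc hj] at h4
    refine h1.mul_left_cancel (h2.mul_left_cancel ?_)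
    calc _ = (angle₁ p m (k + l) k * Ring.inverse (angle₁ p m (k + l) k)) *
          (angle₁ p m (k + l) j * angle₁ p m (k + (l - j)) k) := by ring
      _ = (angle₁ p m (k + (l - j)) k * Ring.inverse (angle₁ p m (k + (l - j)) k)) *
          (angle₁ p m (k + l) k * angle₁ p m l j) := by
        rw [Ring.mul_inverse_cancel _ h1, Ring.mul_inverse_cancel _ h2, h4]
      _ = _ := by ring
  · simp

lemma lower_raise_comm (a : MIdx n) (l : ℕ) (y : PDHat p (n + 1) A) :
    lower p m A (snocIdx a 0) (raise p m A l y) =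
      raise p m A l (lower p m A (snocIdx a 0) y) := by
  rw [lower, raise, hatMap_hatMap, hatMap_hatMap]
  congr 2
  refine poly_ext A fun k => ?_
  obtain ⟨b, k, rfl⟩ := exists_snocIdx k
  rw [LinearMap.comp_apply, LinearMap.comp_apply, shift_single, LinearMap.map_smul_of_tower,
    raisePoly_single, snocIdx_sub, raisePoly_single]
  split_ifs with h h' h'
  · rw [LinearMap.map_smul_of_tower, shift_single, snocIdx_sub, angle_snocIdx, angle_snocIdx,
      angle₁_zero_right, angle₁_zero_right, smul_comm]
    rfl
  · exact absurd h h'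
  · exact absurd h' h
  · simp

/-- Multiplication from the left by a form in the first variables, on the linearized complex:
`ξ_d^{t} ↦ ∑ ⟨t, j⟩ ξ_d^{t - j} (dξ̂)^{(a)_q} (dξ_d)^{(j)_q}`. -/
def bimul (a : MIdx n) : LOm p m (n + 1) A →ₗ[A] LOm p m (n + 1) A :=
  ∑ j ∈ Finset.range (p ^ m + 1),
    TensorProduct.AlgebraTensorModule.map (lower p m A (snocIdx 0 j))
      (formMul p m (snocIdx a j))

lemma bimul_tmul (a : MIdx n) (y : PDHat p (n + 1) A) (w : Om p m (n + 1)) :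
    bimul p m A a (y ⊗ₜ[Lam p] w) = ∑ j ∈ Finset.range (p ^ m + 1),
      lower p m A (snocIdx 0 j) y ⊗ₜ[Lam p] formMul p m (snocIdx a j) w := by
  simp [bimul, LinearMap.sum_apply]

/-- The differential of the second factor. -/
def dForm : LOm p m (n + 1) A →ₗ[A] LOm p m (n + 1) A :=
  TensorProduct.AlgebraTensorModule.map LinearMap.id (dOm p m (n + 1))

lemma dForm_tmul (y : PDHat p (n + 1) A) (w : Om p m (n + 1)) :
    dForm p m A (y ⊗ₜ[Lam p] w) = y ⊗ₜ[Lam p] dOm p m (n + 1) w := rfl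

lemma LOm_ext {M : Type*} [AddCommGroup M] [Module A M]
    {f g : LOm p m d A →ₗ[A] M}
    (h : ∀ y w, f (y ⊗ₜ[Lam p] w) = g (y ⊗ₜ[Lam p] w)) : f = g := by
  refine LinearMap.ext fun z => ?_
  induction z using TensorProduct.induction_on with
  | zero => simp
  | tmul y w => exact h y w
  | add x y hx hy => rw [map_add, map_add, hx, hy]

lemma bimul_eq_zero {a : MIdx n} (ha : p ^ m < weight a) : bimul p m A a = 0 := by
  refine Finset.sum_eq_zero fun j _ => ?_
  refine LOm_ext p m A fun y w => ?_
  rw [formMul_eq_zero p m (by rw [weight_snocIdx]; omega)]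
  simp

/-- Composed lowerings combine into one lowering by t = i + j, with coefficient ⟨t, i⟩. Letting t
run up to 2 p^m adds only terms in which some letter is too large. -/
lemma bimul_bimul_tmul (a b : MIdx n) (y : PDHat p (n + 1) A) (w : Om p m (n + 1)) :
    bimul p m A a (bimul p m A b (y ⊗ₜ[Lam p] w)) =
      ∑ t ∈ Finset.range (p ^ m + p ^ m + 1), ∑ x ∈ antidiagonal t,
        angle₁ p m t x.1 • (lower p m A (snocIdx 0 t) y ⊗ₜ[Lam p]
          formMul p m (snocIdx a x.1) (formMul p m (snocIdx b x.2) w)) := by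
  rw [bimul_tmul, map_sum]
  simp only [bimul_tmul]
  rw [Finset.sum_comm, sum_range_range_eq_sum_antidiagonal]
  · refine Finset.sum_congr rfl fun t _ => Finset.sum_congr rfl fun x hx => ?_
    rw [mem_antidiagonal] at hx
    rw [lower_lower, snocIdx_add, hx, add_zero, angle_snocIdx, angle_self, one_mul,
      TensorProduct.smul_tmul']
  · intro i j hi
    rw [formMul_eq_zero p m (K' := snocIdx a i) (by rw [weight_snocIdx]; omega)]
    simp
  · intro i j hj
    rw [formMul_eq_zero p m (K' := snocIdx b j) (by rw [weight_snocIdx]; omega)]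
    simp

/-- For each lowering by t this is the Leibniz rule for the letter (k, t). The case k = 0 gives
`lastDiff` squared equal to zero; for |k| > p^m it gives the quadratic relations for `bimul`. -/
lemma sum_bimul_bimul (k : MIdx n) (z : LOm p m (n + 1) A) :
    dForm p m A (bimul p m A k z) + bimul p m A k (dForm p m A z) +
      ∑ x ∈ antidiagonal k, angle p m k x.1 • bimul p m A x.1 (bimul p m A x.2 z) = 0 := by
  induction z using TensorProduct.induction_on with
  | zero => simp
  | add x y hx hy =>
    have := congrArg₂ (· + ·) hx hy
    simp only [add_zero] at this
    rw [← this]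
    simp only [map_add, smul_add, Finset.sum_add_distrib]
    abel
  | tmul y w =>
    have h1 : ∑ x ∈ antidiagonal k, angle p m k x.1 •
        bimul p m A x.1 (bimul p m A x.2 (y ⊗ₜ[Lam p] w)) =
        ∑ t ∈ Finset.range (p ^ m + p ^ m + 1), lower p m A (snocIdx 0 t) y ⊗ₜ[Lam p]
          ∑ u ∈ antidiagonal (snocIdx k t), angle p m (snocIdx k t) u.1 •
            formMul p m u.1 (formMul p m u.2 w) := by
      simp only [bimul_bimul_tmul, Finset.smul_sum]
      rw [Finset.sum_comm]
      refine Finset.sum_congr rfl fun t _ => ?_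
      rw [sum_antidiagonal_snocIdx k t
        (fun a b => angle p m (snocIdx k t) a • formMul p m a (formMul p m b w)),
        TensorProduct.tmul_sum]
      refine Finset.sum_congr rfl fun x _ => ?_
      rw [TensorProduct.tmul_sum]
      refine Finset.sum_congr rfl fun u _ => ?_
      rw [angle_snocIdx, TensorProduct.tmul_smul, smul_smul]
    have h2 : Finset.range (p ^ m + 1) ⊆ Finset.range (p ^ m + p ^ m + 1) :=
      Finset.range_subset_range.2 (by omega)
    rw [h1, ← Finset.sum_subset h2, bimul_tmul, dForm_tmul, bimul_tmul, map_sum,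
      ← Finset.sum_add_distrib, ← Finset.sum_add_distrib]
    · refine Finset.sum_eq_zero fun t _ => ?_
      rw [dForm_tmul, dOm_formMul, ← TensorProduct.tmul_add, ← TensorProduct.tmul_add]
      rw [sub_add_eq_add_sub, neg_add_cancel, zero_sub, neg_add_cancel, TensorProduct.tmul_zero]
    · intro t _ ht
      rw [Finset.mem_range] at ht
      rw [sum_formMul_formMul p m (by rw [weight_snocIdx]; omega), TensorProduct.tmul_zero]

lemma sum_bimul_bimul_eq_zero {k : MIdx n} (hk : p ^ m < weight k) (z : LOm p m (n + 1) A) :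
    ∑ x ∈ antidiagonal k, angle p m k x.1 • bimul p m A x.1 (bimul p m A x.2 z) = 0 := by
  have := sum_bimul_bimul p m A k z
  rw [bimul_eq_zero p m A hk] at this
  simpa using this

end operators

/-! ## Construction of the integration map -/

section construction

variable (p : ℕ) [hp : Fact p.Prime] (m : ℕ) {n : ℕ} (A : Type*) [CommRing A] [Algebra (Lam p) A]

/-- The map `w ↦ (y ↦ f y ⊗ w)`. -/
def tensorRight (f : PDHat p (n + 1) A →ₗ[A] PDHat p (n + 1) A) :
    Om p m (n + 1) →ₗ[Lam p] (PDHat p (n + 1) A →ₗ[A] LOm p m (n + 1) A) where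
  toFun w :=
    { toFun := fun y => f y ⊗ₜ[Lam p] w
      map_add' := fun x y => by rw [map_add, TensorProduct.add_tmul]
      map_smul' := fun a y => by rw [map_smul]; rfl }
  map_add' v w := LinearMap.ext fun y => TensorProduct.tmul_add _ _ _
  map_smul' c w := LinearMap.ext fun y => TensorProduct.tmul_smul _ _ _

lemma tensorRight_apply (f : PDHat p (n + 1) A →ₗ[A] PDHat p (n + 1) A) (w : Om p m (n + 1))
    (y : PDHat p (n + 1) A) : tensorRight p m A f w y = f y ⊗ₜ[Lam p] w := rfl

/-- Composition with an endomorphism of `LΩ`. -/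
def postComp (f : LOm p m (n + 1) A →ₗ[A] LOm p m (n + 1) A) :
    (PDHat p (n + 1) A →ₗ[A] LOm p m (n + 1) A) →ₗ[Lam p]
      (PDHat p (n + 1) A →ₗ[A] LOm p m (n + 1) A) where
  toFun g := f ∘ₗ g
  map_add' _ _ := LinearMap.ext fun _ => map_add f _ _
  map_smul' c _ := LinearMap.ext fun _ => LinearMap.map_smul_of_tower f c _

lemma postComp_apply (f : LOm p m (n + 1) A →ₗ[A] LOm p m (n + 1) A)
    (g : PDHat p (n + 1) A →ₗ[A] LOm p m (n + 1) A) (y : PDHat p (n + 1) A) :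
    postComp p m A f g y = f (g y) := rfl

variable {A} in
/-- The action of a form `b` in the first variables by `bimul`; `0` for all other `b`. -/
def bimulComp (A : Type*) [CommRing A] [Algebra (Lam p) A] (b : MIdx (n + 1)) :
    (PDHat p (n + 1) A →ₗ[A] LOm p m (n + 1) A) →ₗ[Lam p]
      (PDHat p (n + 1) A →ₗ[A] LOm p m (n + 1) A) :=
  if b (Fin.last n) = 0 ∧ b ≠ 0 then
    postComp p m A (bimul p m A (Fin.init (α := fun _ => ℕ) b)) else 0

lemma bimulComp_snocIdx (a : MIdx n) (t : ℕ) : bimulComp p m A (snocIdx a t) =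
    if t = 0 ∧ a ≠ 0 then postComp p m A (bimul p m A a) else 0 := by
  have h1 : (snocIdx a t) (Fin.last n) = t := by simp [snocIdx]
  have h2 : Fin.init (α := fun _ => ℕ) (snocIdx a t) = a := by simp [snocIdx]
  rw [bimulComp, h1, h2]
  congr 1
  rw [eq_iff_iff, Ne, snocIdx_eq_zero]
  tauto

lemma bimulComp_zero : bimulComp p m A (0 : MIdx (n + 1)) = 0 := by
  simp [bimulComp]

lemma bimulComp_eq_zero {b : MIdx (n + 1)} (hb : p ^ m < weight b) : bimulComp p m A b = 0 := by
  obtain ⟨a, t, rfl⟩ := exists_snocIdx b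
  rw [weight_snocIdx] at hb
  rw [bimulComp_snocIdx]
  split_ifs with h
  · rw [bimul_eq_zero p m A (by omega)]
    rfl
  · rfl

/-- If the last entry is positive, one of the two factors always involves the last variable and acts
as zero; otherwise this is the relation for `bimul`. In the latter case the terms with index 0,
which `bimulComp` omits, vanish because the other index is too large. -/
lemma sum_bimulComp_bimulComp {b : MIdx (n + 1)} (hb : p ^ m < weight b)
    (z : PDHat p (n + 1) A →ₗ[A] LOm p m (n + 1) A) :
    ∑ x ∈ antidiagonal b, angle p m b x.1 • bimulComp p m A x.1 (bimulComp p m A x.2 z) = 0 := by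
  obtain ⟨a, t, rfl⟩ := exists_snocIdx b
  rw [weight_snocIdx] at hb
  rw [sum_antidiagonal_snocIdx a t (fun u v => angle p m (snocIdx a t) u •
    bimulComp p m A u (bimulComp p m A v z))]
  by_cases ht : t = 0
  · subst ht
    refine LinearMap.ext fun y => ?_
    rw [LinearMap.zero_apply, ← sum_bimul_bimul_eq_zero p m A (k := a) (by omega) (z y),
      LinearMap.sum_apply]
    refine Finset.sum_congr rfl fun x hx => ?_
    rw [mem_antidiagonal] at hx
    rw [Finset.Nat.antidiagonal_zero, Finset.sum_singleton, angle_snocIdx, angle₁_self, mul_one,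
      bimulComp_snocIdx, bimulComp_snocIdx, LinearMap.smul_apply]
    congr 1
    by_cases h1 : x.1 = 0
    · rw [h1, zero_add] at hx
      rw [hx, bimul_eq_zero p m A (a := a) (by omega)]
      simp [h1]
    · by_cases h2 : x.2 = 0
      · rw [h2, add_zero] at hx
        rw [hx, bimul_eq_zero p m A (a := a) (by omega)]
        simp [h2]
      · rw [if_pos ⟨rfl, h1⟩, if_pos ⟨rfl, h2⟩]
        rfl
  · refine Finset.sum_eq_zero fun x _ => Finset.sum_eq_zero fun y hy => ?_
    rw [mem_antidiagonal] at hy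
    rw [bimulComp_snocIdx, bimulComp_snocIdx]
    by_cases h1 : y.1 = 0
    · rw [if_neg (fun h => ht (by omega) : ¬ (y.2 = 0 ∧ x.2 ≠ 0))]
      simp
    · rw [if_neg (fun h => h1 h.1 : ¬ (y.1 = 0 ∧ x.1 ≠ 0))]
      simp

/-- The coefficient `⟨p^m + e, l⟩ ⟨p^m + e, p^m⟩⁻¹`. -/
def corrCoeff (e l : ℕ) : Lam p :=
  angle₁ p m (p ^ m + e) l * Ring.inverse (angle₁ p m (p ^ m + e) (p ^ m))

/-- After clearing two units, this combines the trinomial identities for p^m ≤ p^m + i ≤ p^m + e and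
for l ≤ p^m + i ≤ p^m + e. -/
lemma angle₁_mul_corrCoeff {e i l : ℕ} (hi : i ≤ e) (hl : l < p ^ m) :
    angle₁ p m e i * corrCoeff p m i l =
      corrCoeff p m e l * angle₁ p m (p ^ m + e - l) (p ^ m + i - l) := by
  have u1 := isUnit_angle₁_of_dvd p m (dvd_refl (p ^ m)) e
  have u2 := isUnit_angle₁_of_dvd p m (dvd_refl (p ^ m)) i
  have h1 : angle₁ p m (p ^ m + e) (p ^ m + i) * angle₁ p m (p ^ m + i) (p ^ m) =
      angle₁ p m (p ^ m + e) (p ^ m) * angle₁ p m e i :=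
    angle₁_assoc p m rfl (Nat.add_sub_of_le hi) (by omega)
  have h2 : angle₁ p m (p ^ m + e) (p ^ m + i) * angle₁ p m (p ^ m + i) l =
      angle₁ p m (p ^ m + e) l * angle₁ p m (p ^ m + e - l) (p ^ m + i - l) :=
    angle₁_assoc p m (b := p ^ m + i - l) (c := e - i) (by omega) (by omega) (by omega)
  rw [corrCoeff, corrCoeff]
  refine u1.mul_left_cancel (u2.mul_left_cancel ?_)
  have e1 := Ring.mul_inverse_cancel _ u1
  have e2 := Ring.mul_inverse_cancel _ u2
  linear_combination (angle₁ p m (p ^ m + e) (p ^ m) * angle₁ p m e i * angle₁ p m (p ^ m + i) l) * e2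
    - (angle₁ p m (p ^ m + i) (p ^ m) * angle₁ p m (p ^ m + e) l *
      angle₁ p m (p ^ m + e - l) (p ^ m + i - l)) * e1
    - angle₁ p m (p ^ m + i) l * h1 + angle₁ p m (p ^ m + i) (p ^ m) * h2

lemma corrCoeff_mul_angle₁ {e j l : ℕ} (hl : l + j < p ^ m) :
    corrCoeff p m e (l + j) * angle₁ p m (l + j) j =
      corrCoeff p m e l * angle₁ p m (p ^ m + e - l) j := by
  have h1 : angle₁ p m (p ^ m + e) (l + j) * angle₁ p m (l + j) l =
      angle₁ p m (p ^ m + e) l * angle₁ p m (p ^ m + e - l) j :=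
    angle₁_assoc p m (b := j) (c := p ^ m + e - l - j) (by omega) (by omega) (by omega)
  rw [angle₁_symm p m (rfl : l + j = l + j)] at h1
  rw [corrCoeff, corrCoeff]
  linear_combination Ring.inverse (angle₁ p m (p ^ m + e) (p ^ m)) * h1

/-- The sum `∑_{l < p^m} ⟨p^m + e, l⟩ ⟨p^m + e, p^m⟩⁻¹ R_l ⊗ (dξ)^{(a, p^m + e - l)}`, for the
operators `R_l = raise l`. -/
def corrSum (a : MIdx n) (e : ℕ) :
    Om p m (n + 1) →ₗ[Lam p] (PDHat p (n + 1) A →ₗ[A] LOm p m (n + 1) A) :=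
  ∑ l ∈ Finset.range (p ^ m), corrCoeff p m e l •
    (tensorRight p m A (raise p m A l) ∘ₗ formMul p m (snocIdx a (p ^ m + e - l)))

lemma corrSum_apply (a : MIdx n) (e : ℕ) (w : Om p m (n + 1)) (y : PDHat p (n + 1) A) :
    corrSum p m A a e w y = ∑ l ∈ Finset.range (p ^ m), corrCoeff p m e l •
      (raise p m A l y ⊗ₜ[Lam p] formMul p m (snocIdx a (p ^ m + e - l)) w) := by
  simp [corrSum, LinearMap.sum_apply, tensorRight_apply]

lemma corrSum_eq_zero {a : MIdx n} {e : ℕ} (h : p ^ m < weight (snocIdx a e)) :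
    corrSum p m A a e = 0 := by
  rw [weight_snocIdx] at h
  refine Finset.sum_eq_zero fun l hl => ?_
  rw [Finset.mem_range] at hl
  rw [formMul_eq_zero p m (by rw [weight_snocIdx]; omega), LinearMap.comp_zero, smul_zero]

lemma sum_range_sum_range_sub {M : Type*} [AddCommMonoid M] (N : ℕ) (f : ℕ → ℕ → M) :
    ∑ l ∈ Finset.range N, ∑ j ∈ Finset.range (l + 1), f (l - j) j =
      ∑ l ∈ Finset.range N, ∑ j ∈ Finset.range (N - l), f l j := by
  rw [Finset.sum_sigma', Finset.sum_sigma']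
  refine Finset.sum_bij' (fun z _ => ⟨z.1 - z.2, z.2⟩) (fun z _ => ⟨z.1 + z.2, z.2⟩) ?_ ?_ ?_ ?_ ?_
  all_goals
    rintro ⟨a, b⟩ h
    simp only [Finset.mem_sigma, Finset.mem_range] at h ⊢
  · omega
  · omega
  · congr 1; omega
  · congr 1; omega

/-- For fixed l < p^m, the coefficient of `raise l` collects all decompositions of (a, p^m + e - l),
so it is `corrCoeff p m e l` times a quadratic relation. Its weight exceeds p^m because |a| + e does
and l < p^m. -/
lemma corrSum_formMul_add_bimul {a : MIdx n} {e : ℕ} (h : p ^ m < weight (snocIdx a e))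
    (w : Om p m (n + 1)) (y : PDHat p (n + 1) A) :
    ∑ x ∈ antidiagonal a, angle p m a x.1 •
      (∑ i ∈ antidiagonal e, angle₁ p m e i.1 •
          corrSum p m A x.1 i.1 (formMul p m (snocIdx x.2 i.2) w) y +
        bimul p m A x.1 (corrSum p m A x.2 e w y)) = 0 := by
  rw [weight_snocIdx] at h
  -- By `lower_raise`, lowering by j turns `raise l` into `raise (l - j)`; the sum is then reindexed
  -- by l - j. For j > l the two letters have total weight above 2 p^m, so one of them vanishes.
  have h1 : ∀ x ∈ antidiagonal a, bimul p m A x.1 (corrSum p m A x.2 e w y) =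
      ∑ l ∈ Finset.range (p ^ m), ∑ j ∈ Finset.range (p ^ m - l),
        (corrCoeff p m e l * angle₁ p m (p ^ m + e - l) j) •
          (raise p m A l y ⊗ₜ[Lam p] formMul p m (snocIdx x.1 j)
            (formMul p m (snocIdx x.2 (p ^ m + e - l - j)) w)) := by
    intro x hx
    rw [mem_antidiagonal] at hx
    have hw : weight x.1 + weight x.2 = weight a := by rw [← hx, weight_add]
    rw [← sum_range_sum_range_sub, corrSum_apply, map_sum]
    refine Finset.sum_congr rfl fun l hl => ?_
    rw [Finset.mem_range] at hl
    rw [LinearMap.map_smul_of_tower, bimul_tmul, ← Finset.sum_subset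
      (Finset.range_subset_range.2 (show l + 1 ≤ p ^ m + 1 by omega)), Finset.smul_sum]
    · refine Finset.sum_congr rfl fun j hj => ?_
      rw [Finset.mem_range] at hj
      have hjl : l - j + j = l := by omega
      have := corrCoeff_mul_angle₁ p m (e := e) (j := j) (l := l - j) (by omega)
      rw [hjl] at this
      rw [lower_raise p m A (by omega), ← this, ← TensorProduct.smul_tmul', smul_smul,
        show p ^ m + e - (l - j) - j = p ^ m + e - l by omega]
    · intro j _ hj
      rw [Finset.mem_range] at hj
      by_cases h2 : p ^ m < weight (snocIdx x.1 j)
      · rw [formMul_eq_zero p m h2, LinearMap.zero_apply, TensorProduct.tmul_zero]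
      · rw [weight_snocIdx] at h2
        rw [formMul_eq_zero p m (K' := snocIdx x.2 _) (by rw [weight_snocIdx]; omega),
          LinearMap.zero_apply, map_zero, TensorProduct.tmul_zero]
  have h2 : ∀ x ∈ antidiagonal a, ∑ i ∈ antidiagonal e, angle₁ p m e i.1 •
      corrSum p m A x.1 i.1 (formMul p m (snocIdx x.2 i.2) w) y =
      ∑ l ∈ Finset.range (p ^ m), ∑ i ∈ Finset.range (e + 1),
        (corrCoeff p m e l * angle₁ p m (p ^ m + e - l) (p ^ m - l + i)) •
          (raise p m A l y ⊗ₜ[Lam p] formMul p m (snocIdx x.1 (p ^ m - l + i))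
            (formMul p m (snocIdx x.2 (p ^ m + e - l - (p ^ m - l + i))) w)) := by
    intro x _
    rw [Finset.Nat.sum_antidiagonal_eq_sum_range_succ (fun i j => angle₁ p m e i •
      corrSum p m A x.1 i (formMul p m (snocIdx x.2 j) w) y), Finset.sum_comm]
    refine Finset.sum_congr rfl fun i hi => ?_
    rw [Finset.mem_range] at hi
    rw [corrSum_apply, Finset.smul_sum]
    refine Finset.sum_congr rfl fun l hl => ?_
    rw [Finset.mem_range] at hl
    rw [smul_smul, angle₁_mul_corrCoeff p m (by omega) hl,
      show p ^ m - l + i = p ^ m + i - l by omega,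
      show p ^ m + e - l - (p ^ m + i - l) = e - i by omega]
  have h3 : ∀ x ∈ antidiagonal a, (∑ i ∈ antidiagonal e, angle₁ p m e i.1 •
          corrSum p m A x.1 i.1 (formMul p m (snocIdx x.2 i.2) w) y +
        bimul p m A x.1 (corrSum p m A x.2 e w y)) =
      ∑ l ∈ Finset.range (p ^ m), corrCoeff p m e l • (raise p m A l y ⊗ₜ[Lam p]
        ∑ j ∈ antidiagonal (p ^ m + e - l), angle₁ p m (p ^ m + e - l) j.1 •
          formMul p m (snocIdx x.1 j.1) (formMul p m (snocIdx x.2 j.2) w)) := by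
    intro x hx
    rw [h1 x hx, h2 x hx, ← Finset.sum_add_distrib]
    refine Finset.sum_congr rfl fun l hl => ?_
    rw [Finset.mem_range] at hl
    -- The p^m - l terms with smallest first index come from `bimul`, the remaining e + 1 from the
    -- corrections themselves.
    rw [Finset.Nat.sum_antidiagonal_eq_sum_range_succ (fun i j =>
      angle₁ p m (p ^ m + e - l) i • formMul p m (snocIdx x.1 i)
        (formMul p m (snocIdx x.2 j) w)),
      show (p ^ m + e - l).succ = (p ^ m - l) + (e + 1) by omega, Finset.sum_range_add _ (p ^ m - l) (e + 1)]
    refine (add_comm _ _).trans ?_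
    simp only [TensorProduct.tmul_add, TensorProduct.tmul_sum, TensorProduct.tmul_smul, smul_add,
      Finset.smul_sum, smul_smul]
  rw [Finset.sum_congr rfl fun x hx => by rw [h3 x hx]]
  simp only [Finset.smul_sum]
  rw [Finset.sum_comm]
  refine Finset.sum_eq_zero fun l hl => ?_
  rw [Finset.mem_range] at hl
  have h4 := sum_formMul_formMul p m (K' := snocIdx a (p ^ m + e - l))
    (by rw [weight_snocIdx]; omega) w
  rw [sum_antidiagonal_snocIdx a (p ^ m + e - l) (fun u v => angle p m
    (snocIdx a (p ^ m + e - l)) u • formMul p m u (formMul p m v w))] at h4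
  have h5 := congrArg (fun v => corrCoeff p m e l • (raise p m A l y ⊗ₜ[Lam p] v)) h4
  simp only [TensorProduct.tmul_zero, smul_zero] at h5
  rw [← h5, TensorProduct.tmul_sum, Finset.smul_sum]
  refine Finset.sum_congr rfl fun x _ => ?_
  rw [smul_comm, ← TensorProduct.tmul_smul, Finset.smul_sum]
  congr 2
  refine Finset.sum_congr rfl fun j _ => ?_
  rw [angle_snocIdx, smul_smul]

/-- The corrections `corrSum` for nonzero multi-indices. -/
def corr (b : MIdx (n + 1)) :
    Om p m (n + 1) →ₗ[Lam p] (PDHat p (n + 1) A →ₗ[A] LOm p m (n + 1) A) :=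
  if b = 0 then 0 else -corrSum p m A (Fin.init (α := fun _ => ℕ) b) (b (Fin.last n))

lemma corr_snocIdx {a : MIdx n} {t : ℕ} (h : ¬ (a = 0 ∧ t = 0)) :
    corr p m A (snocIdx a t) = -corrSum p m A a t := by
  rw [corr, if_neg (fun h' => h (snocIdx_eq_zero.1 h'))]
  simp [snocIdx]

/-- This is the compatibility needed for `topInt`. Only i = 0 survives in the second summand, since
`bimulComp` vanishes on forms that involve the last variable. -/
lemma sum_corr {b : MIdx (n + 1)} (hb : p ^ m < weight b) (w : Om p m (n + 1)) :
    ∑ x ∈ antidiagonal b, angle p m b x.1 • (corr p m A x.1 (formMul p m x.2 w) +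
      bimulComp p m A x.1 (corr p m A x.2 w)) = 0 := by
  obtain ⟨a, e, rfl⟩ := exists_snocIdx b
  refine LinearMap.ext fun y => ?_
  have key := corrSum_formMul_add_bimul p m A hb w y
  rw [← neg_eq_zero, ← Finset.sum_neg_distrib] at key
  rw [LinearMap.zero_apply, ← key, sum_antidiagonal_snocIdx a e (fun u v =>
    angle p m (snocIdx a e) u • (corr p m A u (formMul p m v w) +
      bimulComp p m A u (corr p m A v w))), LinearMap.sum_apply]
  refine Finset.sum_congr rfl fun x hx => ?_
  rw [mem_antidiagonal] at hx
  rw [LinearMap.sum_apply]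
  have hw : weight x.1 + weight x.2 = weight a := by rw [← hx, weight_add]
  rw [weight_snocIdx] at hb
  have h1 : ∀ i ∈ antidiagonal e,
      corr p m A (snocIdx x.1 i.1) (formMul p m (snocIdx x.2 i.2) w) y =
        -corrSum p m A x.1 i.1 (formMul p m (snocIdx x.2 i.2) w) y := by
    intro i hi
    rw [mem_antidiagonal] at hi
    -- At the index 0 `corr` is set to 0 and differs from `corrSum`; there the other letter carries
    -- the whole weight and vanishes.
    by_cases h : x.1 = 0 ∧ i.1 = 0
    · rw [formMul_eq_zero p m (K' := snocIdx x.2 i.2)]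
      · simp
      · rw [weight_snocIdx]
        rw [h.1, weight_zero] at hw
        omega
    · rw [corr_snocIdx p m A h]
      rfl
  have h2 : bimulComp p m A (snocIdx x.1 0) (corr p m A (snocIdx x.2 e) w) y =
      -bimul p m A x.1 (corrSum p m A x.2 e w y) := by
    rw [bimulComp_snocIdx]
    by_cases h3 : x.1 = 0
    · rw [if_neg (fun h => h.2 h3), corrSum_eq_zero p m A (a := x.2)]
      · simp
      · rw [weight_snocIdx]
        rw [h3, weight_zero] at hw
        omega
    · rw [if_pos ⟨rfl, h3⟩]
      by_cases h4 : x.2 = 0 ∧ e = 0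
      · rw [h4.1, weight_zero] at hw
        rw [bimul_eq_zero p m A (a := x.1) (by omega)]
        simp [postComp_apply]
      · rw [corr_snocIdx p m A h4, postComp_apply, LinearMap.neg_apply, LinearMap.neg_apply,
          map_neg]
  have h3 : ∀ i ∈ antidiagonal e, i ≠ (0, e) →
      bimulComp p m A (snocIdx x.1 i.1) (corr p m A (snocIdx x.2 i.2) w) y = 0 := by
    intro i hi hne
    rw [mem_antidiagonal] at hi
    rw [bimulComp_snocIdx, if_neg]
    · rfl
    · rintro ⟨h, -⟩
      exact hne (Prod.ext h (by simp only; omega))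
  simp only [LinearMap.smul_apply, LinearMap.add_apply, smul_add, Finset.sum_add_distrib]
  have h4 : ∑ i ∈ antidiagonal e, angle p m (snocIdx a e) (snocIdx x.1 i.1) •
      bimulComp p m A (snocIdx x.1 i.1) (corr p m A (snocIdx x.2 i.2) w) y =
      -(angle p m a x.1 • bimul p m A x.1 (corrSum p m A x.2 e w y)) := by
    rw [Finset.sum_eq_single_of_mem (0, e) (by simp), angle_snocIdx, angle₁_zero_right, mul_one,
      h2, smul_neg]
    intro i hi hne
    rw [h3 i hi hne, smul_zero]
  rw [h4, neg_add]
  congr 1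
  rw [Finset.smul_sum, ← Finset.sum_neg_distrib]
  refine Finset.sum_congr rfl fun i hi => ?_
  rw [h1 i hi, angle_snocIdx, smul_neg, smul_smul]

lemma exists_topInt : ∃ G : Om p m (n + 1) →ₗ[Lam p] (PDHat p (n + 1) A →ₗ[A] LOm p m (n + 1) A),
    G (cls p m []) = tensorRight p m A (raise p m A (p ^ m)) (cls p m []) ∧
      ∀ k w, G (formMul p m k w) = corr p m A k w + bimulComp p m A k (G w) := by
  refine exists_extension p m _ _ (by simp [corr]) (bimulComp_zero p m A) (fun k hk => ?_)
    (fun k hk => bimulComp_eq_zero p m A hk) (fun k hk w => sum_corr p m A hk w)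
    (fun k hk z => sum_bimulComp_bimulComp p m A hk z) _
  obtain ⟨a, e, rfl⟩ := exists_snocIdx k
  rw [corr_snocIdx, corrSum_eq_zero p m A hk]
  · exact LinearMap.ext fun w => by simp
  · rintro ⟨rfl, rfl⟩
    simp at hk

/-- The map `w ↦ (y ↦ h (y ⊗ (dξ_d)^{(p^m)_q} ⊗' w))` for the integration map `h`. -/
def topInt : Om p m (n + 1) →ₗ[Lam p] (PDHat p (n + 1) A →ₗ[A] LOm p m (n + 1) A) :=
  (exists_topInt p m A).choose

lemma topInt_one : topInt p m (n := n) A (cls p m []) =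
    tensorRight p m A (raise p m A (p ^ m)) (cls p m []) :=
  (exists_topInt p m A).choose_spec.1

lemma topInt_formMul (k : MIdx (n + 1)) (w : Om p m (n + 1)) :
    topInt p m A (formMul p m k w) = corr p m A k w + bimulComp p m A k (topInt p m A w) :=
  (exists_topInt p m A).choose_spec.2 k w

/-- The map `w ↦ (y ↦ h (y ⊗ (dξ_d)^{(l)_q} ⊗' w))` for the integration map `h`. -/
def powInt (l : ℕ) : Om p m (n + 1) →ₗ[Lam p] (PDHat p (n + 1) A →ₗ[A] LOm p m (n + 1) A) :=
  if l = p ^ m then topInt p m A else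
    if l ≠ 0 ∧ l < p ^ m then tensorRight p m A (raise p m A l) else 0

lemma powInt_zero : powInt p m (n := n) A 0 = 0 := by
  rw [powInt, if_neg (pow_pos hp.out.pos m).ne]
  simp

lemma powInt_of_lt {l : ℕ} (h0 : l ≠ 0) (hl : l < p ^ m) :
    powInt p m (n := n) A l = tensorRight p m A (raise p m A l) := by
  rw [powInt, if_neg hl.ne, if_pos ⟨h0, hl⟩]

lemma powInt_top : powInt p m (n := n) A (p ^ m) = topInt p m A := by
  rw [powInt, if_pos rfl]

lemma powInt_of_gt {l : ℕ} (hl : p ^ m < l) : powInt p m (n := n) A l = 0 := by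
  rw [powInt, if_neg hl.ne', if_neg (fun h => absurd h.2 hl.not_gt)]

/-- The map `w ↦ (y ↦ h (y ⊗ (dξ)^{(b)_q} ⊗' w))` for the integration map `h` and forms `b` that
involve the last variable. -/
def firstInt (b : MIdx (n + 1)) :
    Om p m (n + 1) →ₗ[Lam p] (PDHat p (n + 1) A →ₗ[A] LOm p m (n + 1) A) :=
  if Fin.init (α := fun _ => ℕ) b = 0 then powInt p m A (b (Fin.last n)) else 0

lemma firstInt_snocIdx (a : MIdx n) (t : ℕ) :
    firstInt p m A (snocIdx a t) = if a = 0 then powInt p m A t else 0 := by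
  simp [firstInt, snocIdx]

/-- The left side integrates the words (0, i) ⊗' (a, e - i) of the relation in multidegree (a, e);
the right side accounts for the word (a, 0) ⊗' (0, e). For e < p^m only `raise` occurs and
`lower_raise` gives the equality. For e ≥ p^m the recursion for `topInt` was chosen to make it true.
-/
lemma sum_powInt {a : MIdx n} {e : ℕ} (h : p ^ m < weight (snocIdx a e))
    (w : Om p m (n + 1)) (y : PDHat p (n + 1) A) :
    ∑ i ∈ Finset.range (e + 1), angle₁ p m e i •
        powInt p m A i (formMul p m (snocIdx a (e - i)) w) y =
      if a = 0 then 0 else bimul p m A a (powInt p m A e w y) := by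
  have hN : 0 < p ^ m := pow_pos hp.out.pos m
  rcases lt_or_ge e (p ^ m) with he | he
  · have ha : a ≠ 0 := by
      rintro rfl
      rw [weight_snocIdx, weight_zero] at h
      omega
    rw [if_neg ha]
    rw [weight_snocIdx] at h
    by_cases he0 : e = 0
    · subst he0
      simp [powInt_zero]
    rw [powInt_of_lt p m A he0 he, tensorRight_apply, bimul_tmul,
      ← Finset.sum_subset (Finset.range_subset_range.2 (show e + 1 ≤ p ^ m + 1 by omega)),
      ← Finset.sum_range_reflect]
    · refine Finset.sum_congr rfl fun j hj => ?_
      rw [Finset.mem_range] at hj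
      rw [show e + 1 - 1 - j = e - j by omega, show e - (e - j) = j by omega,
        lower_raise p m A (by omega)]
      by_cases hje : j = e
      · rw [formMul_eq_zero p m (K' := snocIdx a j) (by rw [weight_snocIdx]; omega)]
        simp
      · rw [powInt_of_lt p m A (by omega) (by omega), tensorRight_apply,
          angle₁_symm p m (show e - j + j = e by omega), TensorProduct.smul_tmul']
    · intro j _ hj
      rw [Finset.mem_range] at hj
      rw [formMul_eq_zero p m (by rw [weight_snocIdx]; omega), LinearMap.zero_apply,
        TensorProduct.tmul_zero]
  · obtain ⟨f, rfl⟩ := Nat.exists_eq_add_of_le he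
    have hne : ¬ (a = 0 ∧ f = 0) := by
      rintro ⟨rfl, rfl⟩
      rw [weight_snocIdx, weight_zero] at h
      omega
    have h1 : ∀ i ∈ Finset.range f, angle₁ p m (p ^ m + f) (p ^ m + 1 + i) •
        powInt p m A (p ^ m + 1 + i) (formMul p m (snocIdx a (p ^ m + f - (p ^ m + 1 + i))) w) y
          = 0 := by
      intro i _
      rw [powInt_of_gt p m A (by omega)]
      simp
    have u := isUnit_angle₁_of_dvd p m (dvd_refl (p ^ m)) f
    have h2 : ∑ i ∈ Finset.range (p ^ m), angle₁ p m (p ^ m + f) i •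
        powInt p m A i (formMul p m (snocIdx a (p ^ m + f - i)) w) y =
        angle₁ p m (p ^ m + f) (p ^ m) • corrSum p m A a f w y := by
      rw [corrSum_apply, Finset.smul_sum]
      refine Finset.sum_congr rfl fun i hi => ?_
      rw [Finset.mem_range] at hi
      rw [smul_smul, corrCoeff, mul_left_comm, Ring.mul_inverse_cancel _ u, mul_one]
      -- `powInt` is 0 at i = 0 while `corrSum` has an l = 0 term; that term contains the letter (a,
      -- p^m + f), which is too large.
      by_cases hi0 : i = 0
      · subst hi0
        rw [formMul_eq_zero p m (K' := snocIdx a (p ^ m + f - 0)) h]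
        simp
      · rw [powInt_of_lt p m A hi0 hi, tensorRight_apply]
    rw [show p ^ m + f + 1 = p ^ m + 1 + f by omega, Finset.sum_range_add _ (p ^ m + 1) f,
      Finset.sum_eq_zero h1, add_zero, Finset.sum_range_succ, h2, powInt_top,
      Nat.add_sub_cancel_left, topInt_formMul, corr_snocIdx p m A hne, LinearMap.neg_apply,
      LinearMap.add_apply, LinearMap.neg_apply, smul_add, smul_neg, add_neg_cancel_left,
      bimulComp_snocIdx]
    by_cases ha : a = 0
    · rw [if_pos ha, if_neg (fun h => h.2 ha)]
      simp
    · rw [if_neg ha]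
      by_cases hf : f = 0
      · rw [if_pos ⟨hf, ha⟩, hf, add_zero, angle₁_self, one_smul, powInt_top]
        rfl
      · rw [if_neg (fun h => hf h.1), powInt_of_gt p m A (by omega)]
        simp

/-- Mixed letters contribute nothing, so only first letters (0, i), or the pair (a, 0), (0, e),
survive in the relation; `sum_powInt` says that these cancel. -/
lemma sum_firstInt {b : MIdx (n + 1)} (hb : p ^ m < weight b) (w : Om p m (n + 1)) :
    ∑ x ∈ antidiagonal b, angle p m b x.1 • (firstInt p m A x.1 (formMul p m x.2 w) +
      (-bimulComp p m A x.1) (firstInt p m A x.2 w)) = 0 := by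
  obtain ⟨a, e, rfl⟩ := exists_snocIdx b
  refine LinearMap.ext fun y => ?_
  have key := sum_powInt p m A hb w y
  rw [sum_antidiagonal_snocIdx a e (fun u v => angle p m (snocIdx a e) u •
    (firstInt p m A u (formMul p m v w) + (-bimulComp p m A u) (firstInt p m A v w)))]
  simp only [smul_add, Finset.sum_add_distrib, LinearMap.add_apply]
  have h1 : (∑ x ∈ antidiagonal a, ∑ i ∈ antidiagonal e,
      angle p m (snocIdx a e) (snocIdx x.1 i.1) • firstInt p m A (snocIdx x.1 i.1)
        (formMul p m (snocIdx x.2 i.2) w)) y = ∑ i ∈ Finset.range (e + 1), angle₁ p m e i •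
        powInt p m A i (formMul p m (snocIdx a (e - i)) w) y := by
    rw [Finset.sum_eq_single_of_mem (0, a) (by simp [mem_antidiagonal]),
      Finset.Nat.sum_antidiagonal_eq_sum_range_succ (fun i j =>
        angle p m (snocIdx a e) (snocIdx 0 i) • firstInt p m A (snocIdx 0 i)
        (formMul p m (snocIdx a j) w)), LinearMap.sum_apply]
    · refine Finset.sum_congr rfl fun i _ => ?_
      rw [angle_snocIdx, angle_zero_right, one_mul, firstInt_snocIdx, if_pos rfl]
      rfl
    · rintro ⟨x, x'⟩ hx hne
      refine Finset.sum_eq_zero fun i _ => ?_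
      rw [firstInt_snocIdx, if_neg]
      · simp
      · rintro rfl
        rw [mem_antidiagonal, zero_add] at hx
        exact hne (Prod.ext rfl hx)
  have h2 : (∑ x ∈ antidiagonal a, ∑ i ∈ antidiagonal e,
      angle p m (snocIdx a e) (snocIdx x.1 i.1) • (-bimulComp p m A (snocIdx x.1 i.1))
        (firstInt p m A (snocIdx x.2 i.2) w)) y =
      -if a = 0 then 0 else bimul p m A a (powInt p m A e w y) := by
    rw [Finset.sum_eq_single_of_mem (a, 0) (by simp [mem_antidiagonal]),
      Finset.sum_eq_single_of_mem (0, e) (by simp [mem_antidiagonal])]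
    · rw [angle_snocIdx, angle_self, angle₁_zero_right, mul_one, one_smul, bimulComp_snocIdx,
        firstInt_snocIdx, if_pos rfl]
      by_cases ha : a = 0
      · simp [ha]
      · rw [if_pos ⟨rfl, ha⟩, if_neg ha]
        rfl
    · rintro ⟨i, j⟩ hi hne
      rw [bimulComp_snocIdx, if_neg]
      · simp
      · rintro ⟨h, -⟩
        simp only at h
        subst h
        rw [mem_antidiagonal, zero_add] at hi
        exact hne (by rw [← hi])
    · rintro ⟨x, x'⟩ hx hne
      refine Finset.sum_eq_zero fun i _ => ?_
      rw [firstInt_snocIdx, if_neg]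
      · simp
      · rintro rfl
        rw [mem_antidiagonal, add_zero] at hx
        exact hne (by rw [← hx])
  rw [h1, h2, key, add_neg_cancel, LinearMap.zero_apply]

lemma exists_curriedInt :
    ∃ H : Om p m (n + 1) →ₗ[Lam p] (PDHat p (n + 1) A →ₗ[A] LOm p m (n + 1) A),
    H (cls p m []) = 0 ∧
      ∀ k w, H (formMul p m k w) = firstInt p m A k w + (-bimulComp p m A k) (H w) := by
  refine exists_extension p m (firstInt p m A) (fun k => -bimulComp p m A k) (by simp [firstInt, powInt_zero, Fin.init_def])
    (LinearMap.ext fun z => by simp [bimulComp_zero]) (fun k hk => ?_)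
    (fun k hk => LinearMap.ext fun z => by simp [bimulComp_eq_zero p m A hk])
    (fun k hk w => sum_firstInt p m A hk w)
    (fun k hk z => ?_) _
  · obtain ⟨a, e, rfl⟩ := exists_snocIdx k
    rw [firstInt_snocIdx]
    split_ifs with ha
    · rw [ha, weight_snocIdx, weight_zero, zero_add] at hk
      rw [powInt_of_gt p m A hk]
    · rfl
  · simpa using sum_bimulComp_bimulComp p m A hk z

/-- The integration map in curried form. -/
def curriedInt : Om p m (n + 1) →ₗ[Lam p] (PDHat p (n + 1) A →ₗ[A] LOm p m (n + 1) A) :=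
  (exists_curriedInt p m A).choose

lemma curriedInt_one : curriedInt p m (n := n) A (cls p m []) = 0 :=
  (exists_curriedInt p m A).choose_spec.1

lemma curriedInt_formMul (k : MIdx (n + 1)) (w : Om p m (n + 1)) :
    curriedInt p m A (formMul p m k w) =
      firstInt p m A k w - bimulComp p m A k (curriedInt p m A w) := by
  rw [sub_eq_add_neg]
  exact (exists_curriedInt p m A).choose_spec.2 k w

/-- The integration map. -/
def integration : LOm p m (n + 1) A →ₗ[A] LOm p m (n + 1) A :=
  TensorProduct.AlgebraTensorModule.lift
    { toFun := fun y =>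
        { toFun := fun w => curriedInt p m A w y
          map_add' := fun v w => by rw [map_add]; rfl
          map_smul' := fun c w => by rw [map_smul]; rfl }
      map_add' := fun x y => LinearMap.ext fun w => (curriedInt p m A w).map_add x y
      map_smul' := fun a y => LinearMap.ext fun w => (curriedInt p m A w).map_smul a y }

lemma integration_tmul (y : PDHat p (n + 1) A) (w : Om p m (n + 1)) :
    integration p m A (y ⊗ₜ[Lam p] w) = curriedInt p m A w y := rfl

end construction

/-! ## The homotopy identity -/

section homotopy

variable (p : ℕ) [hp : Fact p.Prime] (m : ℕ) {n : ℕ} (A : Type*) [CommRing A] [Algebra (Lam p) A]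

/-- In the expansion of `bimul a` the terms with j > 0 start with a mixed letter and are killed by
the integration map; the term j = 0 is one step of its recursion. -/
lemma integration_bimul {a : MIdx n} (ha : a ≠ 0) (z : LOm p m (n + 1) A) :
    integration p m A (bimul p m A a z) = -bimul p m A a (integration p m A z) := by
  induction z using TensorProduct.induction_on with
  | zero => simp
  | add x y hx hy => simp only [map_add, hx, hy, neg_add]
  | tmul y w =>
    rw [bimul_tmul, map_sum, Finset.sum_eq_single_of_mem 0 (by simp)]
    · rw [integration_tmul, curriedInt_formMul, firstInt_snocIdx, if_neg ha, bimulComp_snocIdx,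
        if_pos ⟨rfl, ha⟩, snocIdx_zero, lower_zero, integration_tmul]
      simp [postComp_apply]
    · intro j _ hj
      rw [integration_tmul, curriedInt_formMul, firstInt_snocIdx, if_neg ha, bimulComp_snocIdx,
        if_neg (fun h => hj h.1)]
      simp

/-- If a class of maps contains the maps `y ↦ R_l y ⊗ w` and is stable under `bimul`, then it
contains the integration map in curried form. -/
lemma curriedInt_mem
    (P : Submodule (Lam p) (PDHat p (n + 1) A →ₗ[A] LOm p m (n + 1) A))
    (h1 : ∀ l w, tensorRight p m A (raise p m A l) w ∈ P)
    (h2 : ∀ a, ∀ g ∈ P, postComp p m A (bimul p m A a) g ∈ P) (w : Om p m (n + 1)) :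
    curriedInt p m A w ∈ P := by
  have hb : ∀ b, ∀ g ∈ P, bimulComp p m A b g ∈ P := by
    intro b g hg
    rw [bimulComp]
    split_ifs
    · exact h2 _ g hg
    · exact zero_mem _
  have hc : ∀ b w, corr p m A b w ∈ P := by
    intro b w
    rw [corr]
    split_ifs
    · exact zero_mem _
    · rw [LinearMap.neg_apply, corrSum, LinearMap.sum_apply]
      exact neg_mem (sum_mem fun l _ => Submodule.smul_mem _ _ (h1 _ _))
  have ht : ∀ w, topInt p m A w ∈ P := by
    have : P.comap (topInt p m A) = ⊤ := by
      refine eq_top_of_formMul_mem p m _ ?_ fun k w hw => ?_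
      · rw [Submodule.mem_comap, topInt_one]
        exact h1 _ _
      · rw [Submodule.mem_comap, topInt_formMul]
        exact add_mem (hc _ _) (hb _ _ hw)
    intro w
    have hw : w ∈ P.comap (topInt p m A) := this ▸ Submodule.mem_top
    exact hw
  have hf : ∀ b w, firstInt p m A b w ∈ P := by
    intro b w
    rw [firstInt, powInt]
    split_ifs
    · exact ht _
    · exact h1 _ _
    · exact zero_mem _
    · exact zero_mem _
  have : P.comap (curriedInt p m A) = ⊤ := by
    refine eq_top_of_formMul_mem p m _ ?_ fun k w hw => ?_
    · rw [Submodule.mem_comap, curriedInt_one]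
      exact zero_mem _
    · rw [Submodule.mem_comap, curriedInt_formMul]
      exact sub_mem (hf _ _) (hb _ _ hw)
  have hw : w ∈ P.comap (curriedInt p m A) := this ▸ Submodule.mem_top
  exact hw

/-- The operator `lower (a, 0)` on the first factor. -/
def hatLower (a : MIdx n) : LOm p m (n + 1) A →ₗ[A] LOm p m (n + 1) A :=
  TensorProduct.AlgebraTensorModule.map (lower p m A (snocIdx a 0)) LinearMap.id

lemma hatLower_tmul (a : MIdx n) (y : PDHat p (n + 1) A) (w : Om p m (n + 1)) :
    hatLower p m A a (y ⊗ₜ[Lam p] w) = lower p m A (snocIdx a 0) y ⊗ₜ[Lam p] w := rfl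

lemma lower_snocIdx (a : MIdx n) (j : ℕ) (y : PDHat p (n + 1) A) :
    lower p m A (snocIdx a 0) (lower p m A (snocIdx 0 j) y) = lower p m A (snocIdx a j) y := by
  rw [lower_lower, snocIdx_add, add_zero, zero_add, angle_snocIdx, angle_self, angle₁_zero_right,
    one_mul, one_smul]

lemma lower_comm (a b : MIdx n) (y : PDHat p n A) :
    lower p m A a (lower p m A b y) = lower p m A b (lower p m A a y) := by
  rw [lower_lower, lower_lower, add_comm b a, angle_symm p m (rfl : a + b = a + b)]

lemma hatLower_bimul (a b : MIdx n) (z : LOm p m (n + 1) A) :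
    hatLower p m A a (bimul p m A b z) = bimul p m A b (hatLower p m A a z) := by
  induction z using TensorProduct.induction_on with
  | zero => simp
  | add x y hx hy => simp only [map_add, hx, hy]
  | tmul y w =>
    rw [bimul_tmul, map_sum, hatLower_tmul, bimul_tmul]
    refine Finset.sum_congr rfl fun j _ => ?_
    rw [hatLower_tmul, lower_comm]

lemma integration_hatLower (a : MIdx n) (z : LOm p m (n + 1) A) :
    integration p m A (hatLower p m A a z) = hatLower p m A a (integration p m A z) := by
  induction z using TensorProduct.induction_on with
  | zero => simp
  | add x y hx hy => simp only [map_add, hx, hy]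
  | tmul y w =>
    rw [hatLower_tmul, integration_tmul, integration_tmul]
    let P : Submodule (Lam p) (PDHat p (n + 1) A →ₗ[A] LOm p m (n + 1) A) :=
      { carrier := {g | ∀ y, g (lower p m A (snocIdx a 0) y) = hatLower p m A a (g y)}
        add_mem' := fun {f g} hf hg y => by
          rw [LinearMap.add_apply, hf y, hg y, LinearMap.add_apply, map_add]
        zero_mem' := fun y => by simp
        smul_mem' := fun c g hg y => by
          rw [LinearMap.smul_apply, hg y, LinearMap.smul_apply, LinearMap.map_smul_of_tower] }
    refine curriedInt_mem p m A P (fun l w y => ?_) (fun b g hg y => ?_) w y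
    · rw [tensorRight_apply, tensorRight_apply, hatLower_tmul, lower_raise_comm]
    · rw [postComp_apply, postComp_apply, hg y, hatLower_bimul]

/-- Each `raise l` kills such a monomial, and by `curriedInt_mem` the integration map is assembled
from these operators by composition on the target side. -/
lemma curriedInt_mono_of_not_dvd (a : MIdx n) {k : ℕ} (hk : ¬ p ^ m ∣ k) (w : Om p m (n + 1)) :
    curriedInt p m A w (mono p A (snocIdx a k)) = 0 := by
  let P : Submodule (Lam p) (PDHat p (n + 1) A →ₗ[A] LOm p m (n + 1) A) :=
    { carrier := {g | g (mono p A (snocIdx a k)) = 0}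
      add_mem' := fun {f g} hf hg => by
        rw [Set.mem_ofPred_eq, LinearMap.add_apply, hf, hg, add_zero]
      zero_mem' := rfl
      smul_mem' := fun c g hg => by
        rw [Set.mem_ofPred_eq, LinearMap.smul_apply, hg, smul_zero] }
  refine curriedInt_mem p m A P (fun l w => ?_) (fun b g hg => ?_) w
  · change tensorRight p m A (raise p m A l) w (mono p A (snocIdx a k)) = 0
    rw [tensorRight_apply, raise_mono, if_neg hk, TensorProduct.zero_tmul]
  · change postComp p m A (bimul p m A b) g (mono p A (snocIdx a k)) = 0
    rw [postComp_apply, hg, map_zero]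

/-- The part of the differential of `LΩ` that does not differentiate the first variables. -/
def lastDiff : LOm p m (n + 1) A →ₗ[A] LOm p m (n + 1) A := dForm p m A + bimul p m A 0

lemma dForm_dForm (z : LOm p m (n + 1) A) : dForm p m A (dForm p m A z) = 0 := by
  induction z using TensorProduct.induction_on with
  | zero => simp
  | add x y hx hy => simp only [map_add, hx, hy, add_zero]
  | tmul y w => rw [dForm_tmul, dForm_tmul, dOm_dOm, TensorProduct.tmul_zero]

lemma lastDiff_lastDiff (z : LOm p m (n + 1) A) : lastDiff p m A (lastDiff p m A z) = 0 := by
  have h := sum_bimul_bimul p m A 0 z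
  have h0 : antidiagonal (0 : MIdx n) = {(0, 0)} := by
    ext x
    simp [Prod.ext_iff]
  rw [h0, Finset.sum_singleton, angle_self, one_smul] at h
  simp only [lastDiff, LinearMap.add_apply, map_add, dForm_dForm, zero_add]
  rw [← h]
  abel

/-- The sum of the products `bimul x₁ ∘ bimul x₂` over the proper decompositions of `a`. -/
def properSum (a : MIdx n) : LOm p m (n + 1) A →ₗ[A] LOm p m (n + 1) A :=
  ∑ x ∈ (antidiagonal a).filter (fun x => x.1 ≠ 0 ∧ x.2 ≠ 0),
    angle p m a x.1 • (bimul p m A x.1 ∘ₗ bimul p m A x.2)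

lemma integration_properSum (a : MIdx n) (z : LOm p m (n + 1) A) :
    integration p m A (properSum p m A a z) = properSum p m A a (integration p m A z) := by
  simp only [properSum, LinearMap.sum_apply, LinearMap.smul_apply, LinearMap.comp_apply, map_sum,
    LinearMap.map_smul_of_tower]
  refine Finset.sum_congr rfl fun x hx => ?_
  rw [Finset.mem_filter] at hx
  rw [integration_bimul p m A hx.2.1, integration_bimul p m A hx.2.2, map_neg, neg_neg]

/-- The extreme terms of `sum_bimul_bimul` are `bimul 0 ∘ bimul a` and its reverse, and they
complete `dForm` to `lastDiff`. The remaining terms form `properSum`, which commutes with the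
integration map because two signs cancel. -/
lemma lastDiff_bimul {a : MIdx n} (ha : a ≠ 0) (z : LOm p m (n + 1) A) :
    lastDiff p m A (bimul p m A a z) =
      -bimul p m A a (lastDiff p m A z) - properSum p m A a z := by
  have h := sum_bimul_bimul p m A a z
  rw [← Finset.sum_filter_add_sum_filter_not _ (fun x : MIdx n × MIdx n => x.1 ≠ 0 ∧ x.2 ≠ 0)] at h
  have h1 : (antidiagonal a).filter (fun x : MIdx n × MIdx n => ¬ (x.1 ≠ 0 ∧ x.2 ≠ 0)) =
      {(0, a), (a, 0)} := by
    ext ⟨x, y⟩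
    simp only [Finset.mem_filter, mem_antidiagonal, Finset.mem_insert, Finset.mem_singleton,
      Prod.mk.injEq]
    constructor
    · rintro ⟨h1, h2⟩
      by_cases hx : x = 0
      · left
        exact ⟨hx, by rw [← h1, hx, zero_add]⟩
      · have hy : y = 0 := by
          by_contra hy
          exact h2 ⟨hx, hy⟩
        right
        exact ⟨by rw [← h1, hy, add_zero], hy⟩
    · rintro (⟨rfl, rfl⟩ | ⟨rfl, rfl⟩) <;> simp
  rw [h1, Finset.sum_pair (by simp [Prod.ext_iff, ha]), angle_zero_right, angle_self, one_smul,
    one_smul] at h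
  have h2 : properSum p m A a z = ∑ x ∈ (antidiagonal a).filter (fun x => x.1 ≠ 0 ∧ x.2 ≠ 0),
      angle p m a x.1 • bimul p m A x.1 (bimul p m A x.2 z) := by
    simp [properSum, LinearMap.sum_apply]
  rw [← h2] at h
  simp only [lastDiff, LinearMap.add_apply, map_add]
  rw [← sub_eq_zero, ← h]
  abel

/-! ### Compatibility of the projector with the operators -/

lemma piOm_mkQ (x : NP p (n + 1)) :
    piOm p m ((K p m (n + 1)).mkQ x) = (K p m (n + 1)).mkQ (piNP p n x) := rfl

lemma piOm_one : piOm p m (n := n) (cls p m []) = cls p m [] := by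
  rw [cls, piOm_mkQ, piNP_single, if_pos (by simp)]

lemma piOm_dOm (w : Om p m (n + 1)) :
    piOm p m (dOm p m (n + 1) w) = dOm p m (n + 1) (piOm p m w) := by
  obtain ⟨x, rfl⟩ := (K p m (n + 1)).mkQ_surjective w
  rw [dOm_mkQ, piOm_mkQ, piOm_mkQ, dOm_mkQ, piNP_dNP]

lemma piOm_formMul (a : MIdx n) (t : ℕ) (w : Om p m (n + 1)) :
    piOm p m (formMul p m (snocIdx a t) w) =
      if t = 0 then formMul p m (snocIdx a t) (piOm p m w) else 0 := by
  by_cases h : snocIdx a t = 0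
  · rw [h]
    simp
  · obtain ⟨x, rfl⟩ := (K p m (n + 1)).mkQ_surjective w
    have h1 := letterMul_letter p ⟨snocIdx a t, h⟩
    have h2 : (snocIdx a t) (Fin.last n) = t := by simp [snocIdx]
    simp only at h1
    rw [piOm_mkQ, formMul_mkQ, formMul_mkQ, piOm_mkQ, h1, piNP_lmul]
    simp only [List.forall_mem_singleton, h2]
    split_ifs
    · rfl
    · exact map_zero _

lemma piLOm_mono (a : MIdx n) (k : ℕ) (w : Om p m (n + 1)) :
    piLOm p m A n (mono p A (snocIdx a k) ⊗ₜ[Lam p] w) =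
      if k = 0 then mono p A (snocIdx a k) ⊗ₜ[Lam p] piOm p m w else 0 := by
  have h2 : (snocIdx a k) (Fin.last n) = k := by simp [snocIdx]
  rw [piLOm, TensorProduct.AlgebraTensorModule.map_tmul, mono, hatMap_of, piPoly,
    Finsupp.linearCombination_single, one_smul, h2]
  split_ifs
  · rfl
  · rw [map_zero, TensorProduct.zero_tmul]

lemma bimul_mono (a b : MIdx n) (k : ℕ) (w : Om p m (n + 1)) :
    bimul p m A b (mono p A (snocIdx a k) ⊗ₜ[Lam p] w) =
      ∑ j ∈ Finset.range (p ^ m + 1), angle₁ p m k j •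
        (mono p A (snocIdx a (k - j)) ⊗ₜ[Lam p] formMul p m (snocIdx b j) w) := by
  rw [bimul_tmul]
  refine Finset.sum_congr rfl fun j _ => ?_
  rw [lower_mono, snocIdx_sub, tsub_zero, angle_snocIdx, angle_zero_right, one_mul,
    TensorProduct.smul_tmul']

/-- A term with j > 0 contains (dξ_d)^{(j)_q}, hence is killed by the projector; if k = 0 its
coefficient is already zero. -/
lemma piLOm_bimul (a b : MIdx n) (k : ℕ) (w : Om p m (n + 1)) :
    piLOm p m A n (bimul p m A b (mono p A (snocIdx a k) ⊗ₜ[Lam p] w)) =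
      bimul p m A b (piLOm p m A n (mono p A (snocIdx a k) ⊗ₜ[Lam p] w)) := by
  rw [bimul_mono, map_sum, piLOm_mono]
  simp only [LinearMap.map_smul_of_tower, piLOm_mono, piOm_formMul]
  split_ifs with hk
  · rw [bimul_mono]
    refine Finset.sum_congr rfl fun j _ => ?_
    by_cases hj : j = 0
    · simp [hj, hk]
    · rw [angle₁_eq_zero p m (by omega), zero_smul, zero_smul]
  · rw [map_zero]
    refine Finset.sum_eq_zero fun j _ => ?_
    by_cases hj : j = 0
    · rw [if_neg (by omega), smul_zero]
    · simp [hj]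

lemma piLOm_lastDiff (a : MIdx n) (k : ℕ) (w : Om p m (n + 1)) :
    piLOm p m A n (lastDiff p m A (mono p A (snocIdx a k) ⊗ₜ[Lam p] w)) =
      lastDiff p m A (piLOm p m A n (mono p A (snocIdx a k) ⊗ₜ[Lam p] w)) := by
  rw [lastDiff, LinearMap.add_apply, LinearMap.add_apply, map_add, piLOm_bimul, dForm_tmul,
    piLOm_mono, piLOm_mono]
  congr 1
  split_ifs
  · rw [dForm_tmul, piOm_dOm]
  · rw [map_zero]

/-- The difference of `h d + d h` and `id - π`, for the differential `lastDiff`. -/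
def defect : LOm p m (n + 1) A →ₗ[A] LOm p m (n + 1) A :=
  integration p m A ∘ₗ lastDiff p m A + lastDiff p m A ∘ₗ integration p m A -
    LinearMap.id + piLOm p m A n

lemma defect_apply (z : LOm p m (n + 1) A) :
    defect p m A z = integration p m A (lastDiff p m A z) + lastDiff p m A (integration p m A z)
      - z + piLOm p m A n z := rfl

/-- The defect commutes with `bimul b`: the signs from h and from the differential cancel, and so do
the two `properSum` contributions. -/
lemma defect_bimul (a : MIdx n) {b : MIdx n} (hb : b ≠ 0) (k : ℕ) (w : Om p m (n + 1))
    (h : defect p m A (mono p A (snocIdx a k) ⊗ₜ[Lam p] w) = 0) :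
    defect p m A (bimul p m A b (mono p A (snocIdx a k) ⊗ₜ[Lam p] w)) = 0 := by
  have h1 := congrArg (bimul p m A b) h
  rw [defect_apply, piLOm_bimul, lastDiff_bimul p m A hb, integration_bimul p m A hb, map_sub,
    map_neg, map_neg, integration_bimul p m A hb, lastDiff_bimul p m A hb, integration_properSum]
  rw [defect_apply, map_add, map_sub, map_add, map_zero] at h1
  rw [← h1]
  abel

lemma defect_lastDiff (a : MIdx n) (k : ℕ) (w : Om p m (n + 1))
    (h : defect p m A (mono p A (snocIdx a k) ⊗ₜ[Lam p] w) = 0) :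
    defect p m A (lastDiff p m A (mono p A (snocIdx a k) ⊗ₜ[Lam p] w)) = 0 := by
  have h1 := congrArg (lastDiff p m A) h
  rw [defect_apply, piLOm_lastDiff, lastDiff_lastDiff, map_zero, zero_add]
  rw [defect_apply, map_add, map_sub, map_add, map_zero, lastDiff_lastDiff, add_zero] at h1
  exact h1

lemma integration_lastDiff_mono (a : MIdx n) (k : ℕ) (w : Om p m (n + 1)) :
    integration p m A (lastDiff p m A (mono p A (snocIdx a k) ⊗ₜ[Lam p] w)) =
      curriedInt p m A (dOm p m (n + 1) w) (mono p A (snocIdx a k)) +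
      ∑ j ∈ Finset.range (p ^ m + 1), angle₁ p m k j •
        powInt p m A j w (mono p A (snocIdx a (k - j))) := by
  rw [lastDiff, LinearMap.add_apply, map_add, dForm_tmul, integration_tmul, bimul_mono, map_sum]
  congr 1
  refine Finset.sum_congr rfl fun j _ => ?_
  rw [LinearMap.map_smul_of_tower, integration_tmul, curriedInt_formMul, firstInt_snocIdx,
    if_pos rfl, bimulComp_snocIdx, if_neg (fun h => h.2 rfl), LinearMap.zero_apply, sub_zero]

lemma powInt_mono_of_not_dvd (a : MIdx n) {j k : ℕ} (hk : ¬ p ^ m ∣ k)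
    (w : Om p m (n + 1)) : powInt p m A j w (mono p A (snocIdx a k)) = 0 := by
  have h := curriedInt_mono_of_not_dvd p m A a hk (formMul p m (snocIdx 0 j) w)
  rwa [curriedInt_formMul, firstInt_snocIdx, if_pos rfl, bimulComp_snocIdx,
    if_neg (fun h => h.2 rfl), LinearMap.zero_apply, sub_zero] at h

lemma angle₁_smul_inverse_smul {M : Type*} [AddCommGroup M] [Module (Lam p) M] {k j : ℕ}
    (hj : j ≤ k) (hk : p ^ m ∣ k - j) (x : M) :
    angle₁ p m k j • Ring.inverse (angle₁ p m (k - j + j) (k - j)) • x = x := by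
  have u := isUnit_angle₁_of_dvd p m hk j
  rw [smul_smul, angle₁_symm p m (Nat.add_sub_of_le hj)]
  rw [show k - j + j = k by omega] at u ⊢
  rw [Ring.mul_inverse_cancel _ u, one_smul]

/-- Here h vanishes on all ξ^{k} w, so only h of the differential remains. In it, the only j ≤ p^m
for which k - j can be divisible by p^m is k mod p^m, and lowering followed by raising restores
ξ^{k}. -/
lemma defect_of_not_dvd (a : MIdx n) {k : ℕ} (hk : ¬ p ^ m ∣ k) (w : Om p m (n + 1)) :
    defect p m A (mono p A (snocIdx a k) ⊗ₜ[Lam p] w) = 0 := by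
  have hN : 0 < p ^ m := pow_pos hp.out.pos m
  have hk0 : k ≠ 0 := by
    rintro rfl
    exact hk (dvd_zero _)
  have hlt := Nat.mod_lt k hN
  have hle := Nat.mod_le k (p ^ m)
  have hs : k % p ^ m ≠ 0 := fun h => hk (Nat.dvd_of_mod_eq_zero h)
  rw [defect_apply, integration_tmul, curriedInt_mono_of_not_dvd p m A a hk, piLOm_mono,
    if_neg hk0, integration_lastDiff_mono, curriedInt_mono_of_not_dvd p m A a hk, map_zero,
    zero_add, add_zero, add_zero, sub_eq_zero,
    Finset.sum_eq_single_of_mem (k % p ^ m) (Finset.mem_range.2 (by omega))]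
  · rw [powInt_of_lt p m A hs hlt, tensorRight_apply, raise_mono, if_pos (Nat.dvd_sub_mod k),
      ← TensorProduct.smul_tmul', angle₁_smul_inverse_smul p m hle (Nat.dvd_sub_mod k),
      Nat.sub_add_cancel hle]
  · intro j hj hne
    rw [Finset.mem_range] at hj
    by_cases hjk : k < j
    · rw [angle₁_eq_zero p m hjk, zero_smul]
    · by_cases hd : p ^ m ∣ k - j
      · exfalso
        have h1 : k ≡ j [MOD p ^ m] := ((Nat.modEq_iff_dvd' (by omega)).2 hd).symm
        have h2 : k % p ^ m = j % p ^ m := h1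
        rcases Nat.lt_or_ge j (p ^ m) with h3 | h3
        · rw [Nat.mod_eq_of_lt h3] at h2
          exact hne h2.symm
        · have h4 : j = p ^ m := by omega
          rw [h4, Nat.mod_self] at h2
          exact hs h2
      · rw [powInt_mono_of_not_dvd p m A a hd, smul_zero]

/-- If p^m ∣ k and k > 0, only j = p^m contributes, and `raise (p ^ m)` inverts the lowering; for k
= 0 the projector is the identity on this element. -/
lemma defect_one (a : MIdx n) (k : ℕ) :
    defect p m A (mono p A (snocIdx a k) ⊗ₜ[Lam p] cls p m []) = 0 := by
  have hN : 0 < p ^ m := pow_pos hp.out.pos m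
  by_cases hk : p ^ m ∣ k
  · rw [defect_apply, integration_tmul, curriedInt_one, LinearMap.zero_apply, map_zero,
      integration_lastDiff_mono, dOm_one, map_zero, LinearMap.zero_apply, zero_add, add_zero,
      piLOm_mono]
    by_cases hk0 : k = 0
    · subst hk0
      rw [if_pos rfl, piOm_one, sub_add_cancel]
      refine Finset.sum_eq_zero fun j _ => ?_
      by_cases hj : j = 0
      · rw [hj, powInt_zero]
        simp
      · rw [angle₁_eq_zero p m (by omega), zero_smul]
    · have hle : p ^ m ≤ k := Nat.le_of_dvd (Nat.pos_of_ne_zero hk0) hk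
      have hd : p ^ m ∣ k - p ^ m := Nat.dvd_sub hk (dvd_refl _)
      rw [if_neg hk0, add_zero, sub_eq_zero,
        Finset.sum_eq_single_of_mem (p ^ m) (Finset.mem_range.2 (by omega))]
      · rw [powInt_top, topInt_one, tensorRight_apply, raise_mono, if_pos hd,
          ← TensorProduct.smul_tmul', angle₁_smul_inverse_smul p m hle hd, Nat.sub_add_cancel hle]
      · intro j hj hne
        rw [Finset.mem_range] at hj
        by_cases hj0 : j = 0
        · rw [hj0, powInt_zero]
          simp
        · rw [powInt_mono_of_not_dvd p m A a, smul_zero]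
          intro hd
          have := (Nat.dvd_sub_iff_right (by omega) hk).1 hd
          exact absurd (Nat.le_of_dvd (by omega) this) (by omega)
  · exact defect_of_not_dvd p m A a hk _

/-- The elements `w` for which `h d + d h = id - π` on all `ξ^{k} w`. -/
def goodForms : Submodule (Lam p) (Om p m (n + 1)) where
  carrier := {w | ∀ a k, defect p m A (mono p A (snocIdx a k) ⊗ₜ[Lam p] w) = 0}
  add_mem' := fun {v w} hv hw a k => by
    rw [TensorProduct.tmul_add, map_add, hv, hw, add_zero]
  zero_mem' := fun a k => by rw [TensorProduct.tmul_zero, map_zero]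
  smul_mem' := fun c w hw a k => by
    rw [TensorProduct.tmul_smul, LinearMap.map_smul_of_tower, hw, smul_zero]

lemma not_dvd_sub_of_ne {N k t j : ℕ} (hk : N ∣ k) (hj : j ≤ k + t) (h1 : j < t + N)
    (h2 : t < j + N) (hne : j ≠ t) : ¬ N ∣ k + t - j := by
  intro h
  rcases Nat.lt_or_ge t j with h3 | h3
  · have h4 : N ∣ k - (k + t - j) := Nat.dvd_sub hk h
    rw [show k - (k + t - j) = j - t by omega] at h4
    exact absurd (Nat.le_of_dvd (by omega) h4) (by omega)
  · have h4 : N ∣ (k + t - j) - k := Nat.dvd_sub h hk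
    rw [show (k + t - j) - k = t - j by omega] at h4
    exact absurd (Nat.le_of_dvd (by omega) h4) (by omega)

lemma eq_zero_of_angle₁_smul {M : Type*} [AddCommGroup M] [Module (Lam p) M] {k t : ℕ}
    (hk : p ^ m ∣ k) {x : M} (h : angle₁ p m (k + t) t • x = 0) : x = 0 := by
  have u := isUnit_angle₁_of_dvd p m hk t
  rw [angle₁_symm p m (rfl : k + t = k + t)] at u
  exact (u.smul_eq_zero).1 h

/-- Only exponents k divisible by p^m need an argument. The element ξ_d^{k} (dξ)^{(b,t)} w occurs
with unit coefficient in `bimul b` or `lastDiff` of ξ_d^{k+t} w. Every other term has a vanishing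
coefficient or form, or a last exponent that p^m does not divide, since |j - t| < p^m. -/
lemma formMul_mem_goodForms {w : Om p m (n + 1)} (hw : w ∈ goodForms p m A)
    (hdw : dOm p m (n + 1) w ∈ goodForms p m A) (b : MIdx (n + 1)) :
    formMul p m b w ∈ goodForms p m A := by
  obtain ⟨b, t, rfl⟩ := exists_snocIdx b
  by_cases hbig : p ^ m < weight (snocIdx b t)
  · rw [formMul_eq_zero p m hbig]
    exact zero_mem _
  rw [weight_snocIdx] at hbig
  intro a k
  by_cases hk : p ^ m ∣ k
  swap
  · exact defect_of_not_dvd p m A a hk _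
  have hterm : ∀ j, j < p ^ m + t → t < j + p ^ m → j ≠ t →
      angle₁ p m (k + t) j • defect p m A
        (mono p A (snocIdx a (k + t - j)) ⊗ₜ[Lam p] formMul p m (snocIdx b j) w) = 0 := by
    intro j h1 h2 hne
    by_cases hj : k + t < j
    · rw [angle₁_eq_zero p m hj, zero_smul]
    · rw [defect_of_not_dvd p m A a (not_dvd_sub_of_ne hk (by omega) (by omega) h2 hne), smul_zero]
  by_cases hb : b = 0
  · subst hb
    by_cases ht : t = 0
    · subst ht
      simp
    -- `lastDiff` replaces `bimul` when b = 0; its extra term ξ^{k+t} dw is the reason for the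
    -- hypothesis on dw.
    · have h1 := defect_lastDiff p m A a (k + t) w (hw a (k + t))
      rw [lastDiff, LinearMap.add_apply, map_add, dForm_tmul, hdw a (k + t), zero_add, bimul_mono,
        map_sum, Finset.sum_eq_single_of_mem t (Finset.mem_range.2 (by omega)),
        LinearMap.map_smul_of_tower, Nat.add_sub_cancel] at h1
      · exact eq_zero_of_angle₁_smul p m hk h1
      · intro j hj hne
        rw [Finset.mem_range] at hj
        rw [LinearMap.map_smul_of_tower]
        by_cases hj0 : j = 0
        · subst hj0
          simp
        · exact hterm j (by omega) (by omega) hne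
  · have hb' : 0 < weight b := Nat.pos_of_ne_zero (fun h => hb (weight_eq_zero.1 h))
    have h1 := defect_bimul p m A a hb (k + t) w (hw a (k + t))
    rw [bimul_mono, map_sum, Finset.sum_eq_single_of_mem t (Finset.mem_range.2 (by omega)),
      LinearMap.map_smul_of_tower, Nat.add_sub_cancel] at h1
    · exact eq_zero_of_angle₁_smul p m hk h1
    · intro j hj hne
      rw [Finset.mem_range] at hj
      rw [LinearMap.map_smul_of_tower]
      -- Only j = p^m could lie at distance p^m from t, namely for t = 0; the letter (b, p^m) is too
      -- large because b ≠ 0.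
      by_cases hj0 : j = p ^ m
      · rw [formMul_eq_zero p m (K' := snocIdx b j) (by rw [weight_snocIdx]; omega)]
        simp
      · exact hterm j (by omega) (by omega) hne

/-- By the Leibniz rule the only new forms are (dξ)^{x₁} ⊗' (dξ)^{x₂} w with x₂ of smaller weight
than b, so induction on the weight supplies the hypothesis on d of (dξ)^{x₂} w. -/
lemma dOm_formMul_mem_goodForms (b : MIdx (n + 1)) {w : Om p m (n + 1)}
    (hw : w ∈ goodForms p m A) (hdw : dOm p m (n + 1) w ∈ goodForms p m A) :
    dOm p m (n + 1) (formMul p m b w) ∈ goodForms p m A := by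
  induction hb : weight b using Nat.strong_induction_on generalizing b w with
  | _ W ih =>
    subst hb
    rw [dOm_formMul]
    refine sub_mem (neg_mem (formMul_mem_goodForms p m A hdw ?_ _)) (sum_mem fun x hx => ?_)
    · rw [dOm_dOm]
      exact zero_mem _
    · rw [mem_antidiagonal] at hx
      refine Submodule.smul_mem _ _ ?_
      by_cases h1 : x.1 = 0
      · rw [h1, formMul_zero]
        exact zero_mem _
      · have hlt : weight x.2 < weight b := by
          rw [← hx, weight_add]
          have := Nat.pos_of_ne_zero (fun h => h1 (weight_eq_zero.1 h))
          omega
        exact formMul_mem_goodForms p m A (formMul_mem_goodForms p m A hw hdw _)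
          (ih _ hlt x.2 hw hdw rfl) _

lemma goodForms_eq_top : goodForms p m (n := n) A = ⊤ := by
  have : goodForms p m (n := n) A ⊓ (goodForms p m A).comap (dOm p m (n + 1)) = ⊤ := by
    refine eq_top_of_formMul_mem p m _ ⟨fun a k => defect_one p m A a k, ?_⟩ ?_
    · rw [SetLike.mem_coe, Submodule.mem_comap, dOm_one]
      exact zero_mem _
    · rintro b w ⟨h1, h2⟩
      exact ⟨formMul_mem_goodForms p m A h1 h2 b, dOm_formMul_mem_goodForms p m A b h1 h2⟩
  exact top_le_iff.1 (this ▸ inf_le_left)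

lemma defect_mono (k : MIdx (n + 1)) (w : Om p m (n + 1)) :
    defect p m A (mono p A k ⊗ₜ[Lam p] w) = 0 := by
  obtain ⟨a, k, rfl⟩ := exists_snocIdx k
  have hw : w ∈ goodForms p m A := goodForms_eq_top p m (n := n) A ▸ Submodule.mem_top
  exact hw a k

/-- A lowering by (a, j) factors as one by (a, 0) after one by (0, j), so the letters with fixed a
add up to `hatLower a ∘ bimul a`. -/
lemma dLOm_eq : dLOm p m (n + 1) A = lastDiff p m A +
    ∑ a ∈ (Finset.Iic (fun _ : Fin n => p ^ m)).erase 0, hatLower p m A a ∘ₗ bimul p m A a := by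
  let f : MIdx (n + 1) → LOm p m (n + 1) A →ₗ[A] LOm p m (n + 1) A := fun b =>
    TensorProduct.AlgebraTensorModule.map (lower p m A b) (formMul p m b)
  have f0 : ∀ b, formMul p m b = 0 → f b = 0 := by
    intro b hb
    refine LOm_ext p m A fun y w => ?_
    simp [f, hb]
  have h1 : ∑ b ∈ smallLetters p m (n + 1),
      TensorProduct.AlgebraTensorModule.map (hatMap p A (shift p m A b.1)) (lmulOm p m b) =
      ∑ b ∈ Finset.Iic (fun _ : Fin (n + 1) => p ^ m), f b := by
    refine Finset.sum_bij_ne_zero (fun b _ _ => b.1) ?_ ?_ ?_ ?_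
    · intro b hb _
      simp only [smallLetters, Finset.mem_filter, Finset.mem_subtype] at hb
      exact hb.1
    · intro b _ _ c _ _ h
      exact Subtype.ext h
    · intro b hb hne
      have hb0 : b ≠ 0 := by
        rintro rfl
        exact hne (f0 _ (formMul_zero p m))
      have hb1 : weight b ≤ p ^ m := by
        by_contra hc
        exact hne (f0 _ (formMul_eq_zero p m (by omega)))
      refine ⟨⟨b, hb0⟩, ?_, ?_, rfl⟩
      · simp only [smallLetters, Finset.mem_filter, Finset.mem_subtype]
        exact ⟨hb, hb1⟩
      · rw [← formMul_letter]
        exact hne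
    · intro b _ _
      rw [← formMul_letter]
      rfl
  have h2 : ∑ b ∈ Finset.Iic (fun _ : Fin (n + 1) => p ^ m), f b =
      ∑ a ∈ Finset.Iic (fun _ : Fin n => p ^ m), ∑ j ∈ Finset.range (p ^ m + 1),
        f (snocIdx a j) := by
    rw [← Finset.sum_product']
    symm
    refine Finset.sum_nbij (fun z => snocIdx z.1 z.2) ?_ ?_ ?_ ?_
    · rintro ⟨a, j⟩ h
      simp only [Finset.mem_product, Finset.mem_Iic, Finset.mem_range] at h ⊢
      intro i
      refine Fin.lastCases ?_ (fun i => ?_) i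
      · simp only [snocIdx, Fin.snoc_last]
        omega
      · simpa [snocIdx] using h.1 i
    · rintro ⟨a, j⟩ _ ⟨b, i⟩ _ h
      have := snocIdx_injective2.1 h
      exact Prod.ext this.1 this.2
    · intro b hb
      obtain ⟨a, j, rfl⟩ := exists_snocIdx b
      rw [Finset.mem_coe, Finset.mem_Iic] at hb
      refine ⟨(a, j), ?_, rfl⟩
      simp only [Finset.coe_product, Set.mem_prod, Finset.mem_coe, Finset.mem_Iic,
        Finset.mem_range]
      refine ⟨fun i => by simpa [snocIdx] using hb i.castSucc, ?_⟩
      have := hb (Fin.last n)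
      simp only [snocIdx, Fin.snoc_last] at this
      omega
    · intro _ _
      rfl
  have h3 : ∀ a, ∑ j ∈ Finset.range (p ^ m + 1), f (snocIdx a j) =
      hatLower p m A a ∘ₗ bimul p m A a := by
    intro a
    refine LOm_ext p m A fun y w => ?_
    rw [LinearMap.comp_apply, bimul_tmul, map_sum, LinearMap.sum_apply]
    refine Finset.sum_congr rfl fun j _ => ?_
    rw [hatLower_tmul, lower_snocIdx]
    rfl
  have h4 : hatLower p m A (0 : MIdx n) ∘ₗ bimul p m A 0 = bimul p m A 0 := by
    refine LOm_ext p m A fun y w => ?_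
    rw [LinearMap.comp_apply, bimul_tmul, map_sum]
    refine Finset.sum_congr rfl fun j _ => ?_
    rw [hatLower_tmul, snocIdx_zero, lower_zero]
  rw [dLOm, h1, h2, Finset.sum_congr rfl fun a _ => h3 a,
    ← Finset.add_sum_erase _ _ (Finset.mem_Iic.2 (zero_le (a := fun _ : Fin n => p ^ m))), h4,
    lastDiff]
  change _ + dForm p m A = _
  abel

/-- The contributions of a ≠ 0 cancel because h commutes with `hatLower a` and anticommutes with
`bimul a`; what is left is the vanishing of `defect`. -/
lemma homotopy_mono (k : MIdx (n + 1)) (w : Om p m (n + 1)) :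
    integration p m A (dLOm p m (n + 1) A (mono p A k ⊗ₜ[Lam p] w)) +
      dLOm p m (n + 1) A (integration p m A (mono p A k ⊗ₜ[Lam p] w)) =
      mono p A k ⊗ₜ[Lam p] w - piLOm p m A n (mono p A k ⊗ₜ[Lam p] w) := by
  have h1 := defect_mono p m A k w
  rw [defect_apply] at h1
  generalize mono p A k ⊗ₜ[Lam p] w = z at h1 ⊢
  have h2 : integration p m A ((∑ a ∈ (Finset.Iic (fun _ : Fin n => p ^ m)).erase 0,
        hatLower p m A a ∘ₗ bimul p m A a) z) +
      (∑ a ∈ (Finset.Iic (fun _ : Fin n => p ^ m)).erase 0,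
        hatLower p m A a ∘ₗ bimul p m A a) (integration p m A z) = 0 := by
    rw [LinearMap.sum_apply, LinearMap.sum_apply, map_sum, ← Finset.sum_add_distrib]
    refine Finset.sum_eq_zero fun a ha => ?_
    rw [LinearMap.comp_apply, LinearMap.comp_apply, integration_hatLower,
      integration_bimul p m A (Finset.ne_of_mem_erase ha), map_neg, neg_add_cancel]
  rw [dLOm_eq, LinearMap.add_apply, LinearMap.add_apply, map_add, add_add_add_comm, h2, add_zero,
    ← sub_eq_zero, ← h1]
  abel

end homotopy

/-! ## Heads of multi-indices -/

section heads

variable (p m : ℕ) {d : ℕ}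

/-- A chain of moduli that goes from `(0, …, 0)` to `(1, …, 1)`, one coordinate at a time, through
the powers `p^m, …, p, 1`. -/
def moduli (s : ℕ) (j : Fin d) : ℕ :=
  if s / d + (if j.1 < s % d then 1 else 0) = 0 then 0
  else p ^ (m + 1 - (s / d + (if j.1 < s % d then 1 else 0)))

/-- The length of the chain of moduli. -/
def chainLength (d : ℕ) : ℕ := (m + 1) * d

lemma moduli_zero : moduli p m 0 = (0 : MIdx d) := by
  funext j
  simp [moduli]

lemma moduli_chainLength : moduli p m (chainLength m d) = (1 : MIdx d) := by
  funext j
  have hd : 0 < d := j.pos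
  simp [moduli, chainLength, hd]

/-- For s = d u + i the coordinates before i have modulus p^(m-u), the others p^(m+1-u), or 0 if u =
0. The step from s to s + 1 refines coordinate i alone, and f = m - u. -/
lemma moduli_succ {s : ℕ} (hs : s < chainLength m d) :
    ∃ (i : Fin d) (f : ℕ), f ≤ m ∧ (∀ j ≠ i, moduli p m (s + 1) j = moduli p m s j) ∧
      moduli p m (s + 1) i = p ^ f ∧
      ((moduli p m s i = 0 ∧ f = m) ∨ (moduli p m s i = p ^ (f + 1) ∧ f < m)) ∧
      ∀ j : Fin d, p ^ f ∣ moduli p m s j := by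
  have hd : 0 < d := Nat.pos_of_ne_zero fun h => by simp [chainLength, h] at hs
  have hu : s / d < m + 1 := Nat.div_lt_of_lt_mul (by rwa [mul_comm])
  have hi : s % d < d := Nat.mod_lt _ hd
  have hs' : s = d * (s / d) + s % d := (Nat.div_add_mod s d).symm
  generalize s / d = u at *
  generalize s % d = i at *
  have e0 : ∀ j : Fin d, moduli p m s j = if u + (if j.1 < i then 1 else 0) = 0 then 0
      else p ^ (m + 1 - (u + (if j.1 < i then 1 else 0))) := by
    intro j
    have h1 : s / d = u := by
      rw [hs', Nat.mul_add_div hd, Nat.div_eq_of_lt hi, add_zero]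
    have h2 : s % d = i := by rw [hs', Nat.mul_add_mod, Nat.mod_eq_of_lt hi]
    rw [moduli, h1, h2]
  have e1 : ∀ j : Fin d, moduli p m (s + 1) j = if u + (if j.1 < i + 1 then 1 else 0) = 0 then 0
      else p ^ (m + 1 - (u + (if j.1 < i + 1 then 1 else 0))) := by
    intro j
    rcases Nat.lt_or_ge (i + 1) d with h | h
    · have h1 : (s + 1) / d = u := by
        rw [hs', add_assoc, Nat.mul_add_div hd, Nat.div_eq_of_lt h, add_zero]
      have h2 : (s + 1) % d = i + 1 := by rw [hs', add_assoc, Nat.mul_add_mod, Nat.mod_eq_of_lt h]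
      rw [moduli, h1, h2]
    · have h0 : s + 1 = d * (u + 1) := by rw [hs', mul_add]; omega
      have h1 : (s + 1) / d = u + 1 := by rw [h0, Nat.mul_div_cancel_left _ hd]
      have h2 : (s + 1) % d = 0 := by rw [h0, Nat.mul_mod_right]
      rw [moduli, h1, h2]
      have : j.1 < i + 1 := by omega
      simp [this]
  refine ⟨⟨i, hi⟩, m - u, by omega, fun j hj => ?_, ?_, ?_, fun j => ?_⟩
  · have : (j.1 < i + 1) ↔ j.1 < i := by
      have : j.1 ≠ i := fun h => hj (Fin.ext h)
      omega
    rw [e0, e1]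
    simp only [this]
  · rw [e1]
    simp
  · rw [e0]
    by_cases h : u = 0
    · simp [h]
    · right
      have : m + 1 - u = m - u + 1 := by omega
      simp only [lt_irrefl, if_false, add_zero, h, this]
      exact ⟨trivial, by omega⟩
  · rw [e0]
    split_ifs
    · exact dvd_zero _
    · exact pow_dvd_pow _ (by omega)
    · exact dvd_zero _
    · exact pow_dvd_pow _ (by omega)

lemma moduli_dvd {s t : ℕ} (hst : s ≤ t) (ht : t ≤ chainLength m d) (j : Fin d) :
    moduli p m t j ∣ moduli p m s j := by
  induction t, hst using Nat.le_induction with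
  | base => exact dvd_rfl
  | succ t _ ih =>
    refine Dvd.dvd.trans ?_ (ih (by omega))
    obtain ⟨i, f, -, h1, h2, -, h3⟩ := moduli_succ p m (d := d) (s := t) (by omega)
    by_cases hj : j = i
    · rw [hj, h2]; exact h3 i
    · rw [h1 j hj]

/-- A multi-index, rounded down to multiples of the moduli. -/
def trunc (s : ℕ) (k : MIdx d) : MIdx d := fun j => k j / moduli p m s j * moduli p m s j

lemma trunc_le (s : ℕ) (k : MIdx d) : trunc p m s k ≤ k := fun _ => Nat.div_mul_le_self _ _

lemma trunc_zero (k : MIdx d) : trunc p m 0 k = 0 := by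
  funext j
  simp [trunc, moduli_zero]

lemma trunc_chainLength (k : MIdx d) : trunc p m (chainLength m d) k = k := by
  funext j
  simp [trunc, moduli_chainLength]

lemma trunc_mono {s : ℕ} {k l : MIdx d} (h : k ≤ l) : trunc p m s k ≤ trunc p m s l :=
  fun j => Nat.mul_le_mul_right _ (Nat.div_le_div_right (h j))

lemma trunc_add_le (s : ℕ) (k l : MIdx d) :
    trunc p m s k + trunc p m s l ≤ trunc p m s (k + l) := fun j => by
  simp only [trunc, Pi.add_apply, ← add_mul]
  exact Nat.mul_le_mul_right _ (Nat.div_add_div_le_add_div)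

lemma trunc_eq_iff {s : ℕ} {k l : MIdx d} : trunc p m s k = trunc p m s l ↔
    ∀ j, moduli p m s j = 0 ∨ k j / moduli p m s j = l j / moduli p m s j := by
  rw [funext_iff]
  refine forall_congr' fun j => ?_
  rcases Nat.eq_zero_or_pos (moduli p m s j) with h | h
  · simp [trunc, h]
  · simp only [trunc, Nat.mul_left_inj h.ne', h.ne', false_or]

lemma trunc_eq_self_iff {s : ℕ} {k : MIdx d} :
    trunc p m s k = k ↔ ∀ j, moduli p m s j ∣ k j := by
  rw [funext_iff]
  exact forall_congr' fun j => (Nat.dvd_iff_div_mul_eq _ _).symm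

lemma trunc_eq_of_le {s t : ℕ} (hst : s ≤ t) (ht : t ≤ chainLength m d) {k l : MIdx d}
    (h : trunc p m t k = trunc p m t l) : trunc p m s k = trunc p m s l := by
  rw [trunc_eq_iff] at h ⊢
  intro j
  obtain ⟨c, hc⟩ := moduli_dvd p m hst ht j
  rcases h j with h | h
  · left; rw [hc, h, zero_mul]
  · right; rw [hc, ← Nat.div_div_eq_div_mul, ← Nat.div_div_eq_div_mul, h]

lemma trunc_eq_self_of_le {s t : ℕ} (hst : s ≤ t) (ht : t ≤ chainLength m d) {k : MIdx d}
    (h : trunc p m s k = k) : trunc p m t k = k := by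
  rw [trunc_eq_self_iff] at h ⊢
  exact fun j => (moduli_dvd p m hst ht j).trans (h j)

lemma weight_mono {k l : MIdx d} (h : k ≤ l) : weight k ≤ weight l :=
  Finset.sum_le_sum fun i _ => h i

lemma eq_of_le_of_weight_le {k l : MIdx d} (h : k ≤ l) (hw : weight l ≤ weight k) : k = l := by
  funext j
  exact (Finset.sum_eq_sum_iff_of_le fun i _ => h i).1 (le_antisymm (weight_mono h) hw) j
    (Finset.mem_univ j)

lemma weight_trunc_le {s t : ℕ} (hst : s ≤ t) (ht : t ≤ chainLength m d) (k : MIdx d) :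
    weight (trunc p m s k) ≤ weight (trunc p m t k) := by
  have h : trunc p m s (trunc p m t k) = trunc p m s k :=
    trunc_eq_of_le p m hst ht (by
      rw [trunc_eq_self_iff]
      exact fun _ => Dvd.intro_left _ rfl)
  rw [← h]
  exact weight_mono (trunc_le _ _ _ _)

/-- The rank of a multi-index, for which the head of `K` is the largest part of weight at most
`p^m`. -/
def rank (k : MIdx d) : ℕ := ∑ s ∈ Finset.range (chainLength m d + 1), weight (trunc p m s k)

/-- One coordinate is refined at a time, so the weight after each step determines the new value of
that coordinate. -/
lemma eq_of_weight_trunc {k l : MIdx d}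
    (h : ∀ s ≤ chainLength m d, weight (trunc p m s k) = weight (trunc p m s l)) : k = l := by
  have key : ∀ s ≤ chainLength m d, trunc p m s k = trunc p m s l := by
    intro s
    induction s with
    | zero => intro _; rw [trunc_zero, trunc_zero]
    | succ s ih =>
      intro hs
      have h0 := h _ hs
      obtain ⟨i, f, -, h1, -⟩ := moduli_succ p m (d := d) (s := s) (by omega)
      have h2 : ∀ j ≠ i, trunc p m (s + 1) k j = trunc p m (s + 1) l j := by
        intro j hj
        have := congrFun (ih (by omega)) j
        simpa only [trunc, h1 j hj] using this
      funext j
      by_cases hj : j = i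
      · subst hj
        simp only [weight] at h0
        rw [← Finset.add_sum_erase _ _ (Finset.mem_univ j),
          ← Finset.add_sum_erase _ (trunc p m (s + 1) l) (Finset.mem_univ j),
          Finset.sum_congr rfl fun x hx => h2 x (Finset.ne_of_mem_erase hx)] at h0
        exact Nat.add_right_cancel h0
      · exact h2 j hj
  rw [← trunc_chainLength p m k, ← trunc_chainLength p m l]
  exact key _ le_rfl

/-- The head of `K`: the part of weight `p^m` that takes the digits of highest value first. -/
structure IsHead (K a : MIdx d) : Prop where
  le : a ≤ K
  weight_trunc : ∀ s ≤ chainLength m d,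
    weight (trunc p m s a) = min (weight (trunc p m s K)) (p ^ m)

variable {p m}

/-- The head attains at every s the largest truncated weight possible for a part of K of weight at
most p^m; equality at all s forces equality of the multi-indices. -/
lemma IsHead.rank_lt {K a k : MIdx d} (h : IsHead p m K a) (hk : k ≤ K)
    (hw : weight k ≤ p ^ m) (hne : k ≠ a) : rank p m k < rank p m a := by
  have h1 : ∀ s ∈ Finset.range (chainLength m d + 1),
      weight (trunc p m s k) ≤ weight (trunc p m s a) := by
    intro s hs
    rw [h.weight_trunc s (by simpa [Nat.lt_succ_iff] using hs)]
    exact le_min (weight_mono (trunc_mono p m hk)) ((weight_mono (trunc_le p m s k)).trans hw)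
  refine lt_of_le_of_ne (Finset.sum_le_sum h1) fun h2 => hne ?_
  refine eq_of_weight_trunc p m fun s hs => ?_
  exact (Finset.sum_eq_sum_iff_of_le h1).1 h2 s (by simpa [Nat.lt_succ_iff] using hs)

lemma IsHead.weight_eq {K a : MIdx d} (h : IsHead p m K a) (hK : p ^ m < weight K) :
    weight a = p ^ m := by
  have := h.weight_trunc _ le_rfl
  rw [trunc_chainLength, trunc_chainLength] at this
  omega

lemma IsHead.eq {K a b : MIdx d} (ha : IsHead p m K a) (hb : IsHead p m K b) : a = b :=
  eq_of_weight_trunc p m fun s hs => by rw [ha.weight_trunc s hs, hb.weight_trunc s hs]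

variable (p m)

lemma add_div_of_div_eq {P K g : ℕ} (hg : g ≤ K) (h : P ∣ g ∨ g / P = K / P) :
    (g + (K - g)) / P = g / P + (K - g) / P := by
  rcases Nat.eq_zero_or_pos P with rfl | hP
  · simp
  rcases h with ⟨c, rfl⟩ | h
  · rw [Nat.mul_add_div hP, Nat.mul_div_cancel_left _ hP]
  · rw [Nat.add_sub_cancel' hg, h]
    suffices h0 : K - g < P by rw [Nat.div_eq_of_lt h0, add_zero]
    have h1 := Nat.div_add_mod g P
    have h2 := Nat.div_add_mod K P
    have h3 := Nat.mod_lt K hP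
    rw [h] at h1
    omega

/-- Digits are taken greedily until the weight would exceed p^m, and the last digit block is cut so
that the weight is exactly p^m. In each coordinate, at each of the powers p, …, p^m, the part taken
either has zero lower digits or has the same upper digits as K. Hence there are no carries and the
coefficient is a unit. -/
lemma exists_isHead [hp : Fact p.Prime] {K : MIdx d} (hK : p ^ m < weight K) :
    ∃ a, IsHead p m K a ∧ IsUnit (angle p m K a) := by
  have hex : ∃ s, s ≤ chainLength m d ∧ p ^ m < weight (trunc p m s K) :=
    ⟨_, le_rfl, by rwa [trunc_chainLength]⟩
  classical
  obtain ⟨hs1, hs2⟩ := Nat.find_spec hex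
  have hs3 := fun s (hs : s < Nat.find hex) => Nat.find_min hex hs
  generalize Nat.find hex = s at hs1 hs2 hs3
  obtain _ | s := s
  · simp [trunc_zero] at hs2
  have hs4 : weight (trunc p m s K) ≤ p ^ m := by
    by_contra h
    exact hs3 s (Nat.lt_succ_self s) ⟨by omega, by omega⟩
  obtain ⟨i, f, hf, h1, h2, h3, h4⟩ := moduli_succ p m (d := d) (s := s) (by omega)
  obtain ⟨R, hR⟩ := Nat.exists_eq_add_of_le hs4
  -- At s everything fits, at s + 1 it does not; the deficit R is put into coordinate i, the only
  -- one that changes in this step.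
  set a : MIdx d := Function.update (trunc p m s K) i (trunc p m s K i + R) with ha
  have hai : a i = K i / moduli p m s i * moduli p m s i + R := by simp [ha, trunc]
  have haj : ∀ j ≠ i, a j = K j / moduli p m s j * moduli p m s j := fun j hj => by
    simp [ha, hj, trunc]
  have hdvd : ∀ j, p ^ f ∣ trunc p m s K j := fun j => (h4 j).trans (Dvd.intro_left _ rfl)
  -- Both p^m and the weight already taken are multiples of p^f, so the cut respects the digit being
  -- filled.
  have hRdvd : p ^ f ∣ R := by
    have : p ^ f ∣ weight (trunc p m s K) := Finset.dvd_sum fun j _ => hdvd j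
    exact (Nat.dvd_add_right this).1 (hR ▸ pow_dvd_pow p hf)
  have hRlt : K i / moduli p m s i * moduli p m s i + R < K i / p ^ f * p ^ f := by
    have e1 : weight (trunc p m s K) = trunc p m s K i +
        ∑ x ∈ Finset.univ.erase i, trunc p m s K x :=
      (Finset.add_sum_erase _ _ (Finset.mem_univ i)).symm
    have e2 : weight (trunc p m (s + 1) K) = trunc p m (s + 1) K i +
        ∑ x ∈ Finset.univ.erase i, trunc p m (s + 1) K x :=
      (Finset.add_sum_erase _ _ (Finset.mem_univ i)).symm
    have e3 : ∑ x ∈ Finset.univ.erase i, trunc p m (s + 1) K x =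
        ∑ x ∈ Finset.univ.erase i, trunc p m s K x :=
      Finset.sum_congr rfl fun x hx => by
        simp only [trunc, h1 x (Finset.ne_of_mem_erase hx)]
    have e4 : trunc p m (s + 1) K i = K i / p ^ f * p ^ f := by simp only [trunc, h2]
    have e5 : trunc p m s K i = K i / moduli p m s i * moduli p m s i := rfl
    omega
  have hle : a ≤ K := by
    intro j
    by_cases hj : j = i
    · rw [hj, hai]
      exact hRlt.le.trans (Nat.div_mul_le_self _ _)
    · rw [haj j hj]
      exact Nat.div_mul_le_self _ _
  have hwa : weight a = p ^ m := by
    rw [hR]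
    have e1 : weight (trunc p m s K) = trunc p m s K i +
        ∑ x ∈ Finset.univ.erase i, trunc p m s K x :=
      (Finset.add_sum_erase _ _ (Finset.mem_univ i)).symm
    have e2 : weight a = a i + ∑ x ∈ Finset.univ.erase i, a x :=
      (Finset.add_sum_erase _ _ (Finset.mem_univ i)).symm
    have e3 : ∑ x ∈ Finset.univ.erase i, a x = ∑ x ∈ Finset.univ.erase i, trunc p m s K x :=
      Finset.sum_congr rfl fun x hx => haj x (Finset.ne_of_mem_erase hx)
    have e5 : trunc p m s K i = K i / moduli p m s i * moduli p m s i := rfl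
    omega
  have hdiv : ∀ j, moduli p m s j = 0 ∨ a j / moduli p m s j = K j / moduli p m s j := by
    intro j
    rcases Nat.eq_zero_or_pos (moduli p m s j) with h | h
    · exact Or.inl h
    right
    by_cases hj : j = i
    · subst hj
      suffices e0 : R < moduli p m s j by
        rw [hai, mul_comm, Nat.mul_add_div h, Nat.div_eq_of_lt e0, add_zero]
      have e1 := Nat.div_mul_le_self (K j) (p ^ f)
      have e2 := Nat.div_add_mod' (K j) (moduli p m s j)
      have e3 := Nat.mod_lt (K j) h
      omega
    · rw [haj j hj, Nat.mul_div_cancel _ h]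
  have hself : trunc p m (s + 1) a = a := by
    rw [trunc_eq_self_iff]
    intro j
    by_cases hj : j = i
    · rw [hj, h2, hai]
      exact dvd_add (hdvd i) hRdvd
    · rw [h1 j hj, haj j hj]
      exact Dvd.intro_left _ rfl
  refine ⟨a, ⟨hle, fun t ht => ?_⟩, ?_⟩
  · rcases Nat.lt_or_ge s t with hst | hst
    · rw [trunc_eq_self_of_le p m hst ht hself, hwa, min_eq_right]
      exact (hs2.le).trans (weight_trunc_le p m hst ht K)
    · rw [trunc_eq_of_le p m hst (by omega) ((trunc_eq_iff p m).2 hdiv), min_eq_left]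
      exact (weight_trunc_le p m hst (by omega) K).trans hs4
  · rw [angle]
    refine (Finset.univ).prod_induction _ IsUnit (fun _ _ => IsUnit.mul) isUnit_one fun j _ => ?_
    rw [← Nat.add_sub_cancel' (hle j)]
    refine isUnit_angle₁ p m fun c hc => ?_
    refine add_div_of_div_eq (hle j) ?_
    -- A coordinate with modulus p^e has no digits of `a` below p^e and all digits of K from p^e on,
    -- so each p^(c+1) falls under one of the two alternatives.
    have aux : ∀ e, (c + 1 ≤ e → p ^ e ∣ a j) → (e < c + 1 → a j / p ^ e = K j / p ^ e) →
        (p ^ (c + 1) ∣ a j ∨ a j / p ^ (c + 1) = K j / p ^ (c + 1)) := by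
      intro e he1 he2
      rcases Nat.lt_or_ge e (c + 1) with h | h
      · right
        obtain ⟨t, ht⟩ := pow_dvd_pow p h.le
        rw [ht, ← Nat.div_div_eq_div_mul, ← Nat.div_div_eq_div_mul, he2 h]
      · exact Or.inl ((pow_dvd_pow p h).trans (he1 h))
    by_cases hj : j = i
    · subst hj
      rcases h3 with ⟨h5, h6⟩ | ⟨h5, h6⟩
      · left
        have : p ^ f ∣ a j := by rw [hai]; exact dvd_add (hdvd j) hRdvd
        exact (pow_dvd_pow p (by omega)).trans this
      · rcases hdiv j with h7 | h7
        · rw [h5] at h7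
          exact absurd h7 (pow_pos hp.out.pos _).ne'
        · rw [h5] at h7
          rcases Nat.lt_or_ge f (c + 1) with h | h
          · right
            obtain ⟨t, ht⟩ := pow_dvd_pow p (show f + 1 ≤ c + 1 from h)
            rw [ht, ← Nat.div_div_eq_div_mul, ← Nat.div_div_eq_div_mul, h7]
          · left
            have : p ^ f ∣ a j := by rw [hai]; exact dvd_add (hdvd j) hRdvd
            exact (pow_dvd_pow p h).trans this
    · rcases hdiv j with h7 | h7
      · left
        rw [haj j hj, h7]
        simp
      · by_cases h0 : moduli p m s j = 0
        · left
          rw [haj j hj, h0]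
          simp
        have : ∃ e, moduli p m s j = p ^ e := by
          rw [moduli] at h0 ⊢
          split_ifs at h0 ⊢ <;> first | exact absurd rfl h0 | exact ⟨_, rfl⟩
        obtain ⟨e, he⟩ := this
        rw [he] at h7
        exact aux e (fun _ => by rw [haj j hj, he]; exact Dvd.intro_left _ rfl) fun _ => h7

variable {p m}

/-- This makes overlaps resolvable. Until the truncation of a reaches weight p^m, neither b nor b +
c contributes at that level. At the critical step, c could change the upper digits of a + b only by
a carry, and the condition that b is the head of b + c excludes this. -/
lemma IsHead.trans [hp : Fact p.Prime] {a b c : MIdx d} (hab : p ^ m < weight (a + b))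
    (hbc : p ^ m < weight (b + c)) (ha : IsHead p m (a + b) a) (hb : IsHead p m (b + c) b) :
    IsHead p m (a + b + c) a := by
  have hwa := ha.weight_eq hab
  have hwb := hb.weight_eq hbc
  have h_le : a ≤ a + b + c := le_self_add.trans le_self_add
  have small : ∀ s ≤ chainLength m d, weight (trunc p m s a) < p ^ m →
      trunc p m s (a + b) = trunc p m s a ∧ trunc p m s (b + c) = 0 := by
    intro s hs h
    have h1 := ha.weight_trunc s hs
    have h2 := weight_mono (trunc_add_le p m s a b)
    rw [weight_add] at h2
    have h3 := hb.weight_trunc s hs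
    have h4 : 0 < p ^ m := pow_pos hp.out.pos m
    refine ⟨(eq_of_le_of_weight_le (trunc_mono p m le_self_add) (by omega)).symm, ?_⟩
    rw [← weight_eq_zero]
    omega
  have h0 : 0 < p ^ m := pow_pos hp.out.pos m
  have hex : ∃ s, s ≤ chainLength m d ∧ p ^ m ≤ weight (trunc p m s a) :=
    ⟨_, le_rfl, by rw [trunc_chainLength, hwa]⟩
  classical
  obtain ⟨hs1, hs2⟩ := Nat.find_spec hex
  have hs3 := fun s (hs : s < Nat.find hex) => Nat.find_min hex hs
  generalize Nat.find hex = s at hs1 hs2 hs3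
  obtain _ | s := s
  · rw [trunc_zero, weight_zero] at hs2
    omega
  have hs4 : weight (trunc p m s a) < p ^ m := by
    by_contra h
    exact hs3 s (Nat.lt_succ_self s) ⟨by omega, by omega⟩
  obtain ⟨i, f, hf, h1, h2, h3, h4⟩ := moduli_succ p m (d := d) (s := s) (by omega)
  obtain ⟨t1, t2⟩ := small s (by omega) hs4
  have hself : ∀ j, moduli p m (s + 1) j ∣ a j := by
    rw [← trunc_eq_self_iff]
    exact eq_of_le_of_weight_le (trunc_le _ _ _ _) (by rw [hwa]; exact hs2)
  have hbc0 : ∀ j, moduli p m s j ≠ 0 → b j + c j < moduli p m s j := by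
    intro j hj
    have := congrFun t2 j
    simp only [trunc, Pi.add_apply, Pi.zero_apply, mul_eq_zero, hj, or_false] at this
    exact (Nat.div_eq_zero_iff.1 this).resolve_left hj
  have key : trunc p m s (a + b + c) = trunc p m s a := by
    rw [trunc_eq_iff]
    intro j
    rcases Nat.eq_zero_or_pos (moduli p m s j) with h | h
    · exact Or.inl h
    right
    have hb0 := hbc0 j h.ne'
    by_cases hj : j = i
    · subst hj
      rcases h3 with ⟨h5, -⟩ | ⟨h5, h6⟩
      · omega
      have hq : 0 < p ^ f := pow_pos hp.out.pos f
      -- Otherwise b would equal its truncation and be concentrated in coordinate j, with value p^m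
      -- ≥ p^(f+1); but b j + c j is less than p^(f+1).
      have hNb : weight (trunc p m (s + 1) b) < p ^ m := by
        by_contra hcon
        have e1 : trunc p m (s + 1) b = b :=
          eq_of_le_of_weight_le (trunc_le _ _ _ _) (by omega)
        have e2 : ∀ l ≠ j, b l = 0 := by
          intro l hl
          have e3 := congrFun e1 l
          have e4 := congrFun t2 l
          simp only [trunc, h1 l hl, Pi.add_apply, Pi.zero_apply] at e3 e4
          rw [← e3]
          refine Nat.eq_zero_of_le_zero (le_trans ?_ e4.le)
          exact Nat.mul_le_mul_right _ (Nat.div_le_div_right (Nat.le_add_right _ _))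
        have e5 : weight b = b j := Finset.sum_eq_single j (fun l _ hl => e2 l hl) (by simp)
        have e6 : p ^ (f + 1) ≤ p ^ m := Nat.pow_le_pow_right hp.out.pos h6
        omega
      have e1 : (b j + c j) / p ^ f = b j / p ^ f := by
        have e2 := hb.weight_trunc (s + 1) hs1
        have e3 : trunc p m (s + 1) b = trunc p m (s + 1) (b + c) :=
          eq_of_le_of_weight_le (trunc_mono p m le_self_add) (by omega)
        rcases (trunc_eq_iff p m).1 e3 j with e4 | e4
        · rw [h2] at e4; omega
        · rw [h2] at e4; exact e4.symm
      have e2 : (a j + b j) / p ^ (f + 1) = a j / p ^ (f + 1) := by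
        rcases (trunc_eq_iff p m).1 t1 j with e4 | e4
        · omega
        · rwa [h5] at e4
      rw [h5]
      obtain ⟨x, hx⟩ := hself j
      rw [h2] at hx
      simp only [Pi.add_apply]
      rw [← e2, pow_succ, ← Nat.div_div_eq_div_mul, ← Nat.div_div_eq_div_mul, hx, add_assoc,
        Nat.mul_add_div hq, Nat.mul_add_div hq, e1]
    · obtain ⟨x, hx⟩ := hself j
      rw [h1 j hj] at hx
      simp only [Pi.add_apply]
      rw [add_assoc, hx, Nat.mul_add_div h, Nat.mul_div_cancel_left _ h, Nat.div_eq_of_lt hb0,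
        add_zero]
  refine ⟨h_le, fun t ht => ?_⟩
  rcases Nat.lt_or_ge s t with hst | hst
  · have e1 : p ^ m ≤ weight (trunc p m t a) := hs2.trans (weight_trunc_le p m hst ht a)
    have e2 := weight_mono (trunc_le p m t a)
    have e3 := weight_mono (trunc_mono p m (s := t) h_le)
    omega
  · have e1 := trunc_eq_of_le p m hst (by omega) key
    have e2 := weight_trunc_le p m hst (by omega) a
    rw [e1]
    omega

end heads

/-! ## Normal words -/

section normalWords

variable (p m : ℕ) {d : ℕ}

variable {p m} in
-- Every first letter of admissible weight other than the head has smaller rank, so a relation can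
-- be solved for the word that starts with the head.
lemma sum_antidiagonal_of_isHead {M : Type*} [AddCommGroup M] {K g : MIdx d} (h : IsHead p m K g)
    (F : MIdx d → MIdx d → M)
    (hF : ∀ a b, p ^ m < weight a → F a b = 0) :
    ∑ x ∈ antidiagonal K, F x.1 x.2 =
      (∑ x ∈ antidiagonal K, if rank p m x.1 < rank p m g then F x.1 x.2 else 0) +
        F g (K - g) := by
  classical
  have hmem : (g, K - g) ∈ antidiagonal K :=
    mem_antidiagonal.2 (add_tsub_cancel_of_le h.le)
  rw [← Finset.sum_erase_add _ _ hmem, ← Finset.sum_erase_add (antidiagonal K)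
    (fun x => if rank p m x.1 < rank p m g then F x.1 x.2 else 0) hmem, if_neg (lt_irrefl _),
    add_zero]
  congr 1
  refine Finset.sum_congr rfl fun x hx => ?_
  rw [Finset.mem_erase, mem_antidiagonal] at hx
  split_ifs with hr
  · rfl
  refine hF _ _ (lt_of_not_ge fun hw => hr (h.rank_lt (hx.2 ▸ le_self_add) hw fun hg => hx.1 ?_))
  refine Prod.ext hg ?_
  simp only
  rw [← hx.2, ← hg, add_tsub_cancel_left]

variable [hp : Fact p.Prime]

/-- The word `b ⊗' c` is the leading term of the relation in the multidegree `b + c`. -/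
def IsLeading (b c : MIdx d) : Prop := p ^ m < weight (b + c) ∧ IsHead p m (b + c) b

/-- The words that are reduced with respect to the leading terms of the relations. -/
def IsNormal (w : List (Letter d)) : Prop :=
  (∀ k ∈ w, weight k.1 ≤ p ^ m) ∧ w.IsChain fun b c => ¬ IsLeading p m b.1 c.1

variable {p m} in
lemma isUnit_angle_of_isHead {K a : MIdx d} (hK : p ^ m < weight K) (h : IsHead p m K a) :
    IsUnit (angle p m K a) := by
  obtain ⟨b, hb, hu⟩ := exists_isHead p m hK
  rwa [h.eq hb]

open Classical in
/-- Left multiplication by the letter `b`, followed by reduction; `prev` is the operator for shorter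
words. -/
def reduceStep (prev : MIdx d → NP p d →ₗ[Lam p] NP p d) (b : MIdx d) : NP p d →ₗ[Lam p] NP p d :=
  if hb : b = 0 ∨ p ^ m < weight b then 0
  else Finsupp.linearCombination (Lam p) fun w =>
    match w with
    | [] => Finsupp.single [⟨b, fun h => hb (Or.inl h)⟩] 1
    | c :: w =>
      if IsLeading p m b c.1 then
        -(Ring.inverse (angle p m (b + c.1) b) • ∑ x ∈ antidiagonal (b + c.1),
          if _h : rank p m x.1 < rank p m b then
            angle p m (b + c.1) x.1 • reduceStep prev x.1 (prev x.2 (Finsupp.single w 1))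
          else 0)
      else Finsupp.single (⟨b, fun h => hb (Or.inl h)⟩ :: c :: w) 1
  termination_by rank p m b

lemma reduceStep_eq_zero (prev : MIdx d → NP p d →ₗ[Lam p] NP p d) {b : MIdx d}
    (hb : b = 0 ∨ p ^ m < weight b) : reduceStep p m prev b = 0 := by
  rw [reduceStep, dif_pos hb]

lemma reduceStep_nil (prev : MIdx d → NP p d →ₗ[Lam p] NP p d) (b : Letter d)
    (hb : weight b.1 ≤ p ^ m) (c : Lam p) :
    reduceStep p m prev b.1 (Finsupp.single [] c) = Finsupp.single [b] c := by
  rw [reduceStep, dif_neg (not_or.2 ⟨b.2, hb.not_gt⟩)]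
  simp

lemma reduceStep_of_not (prev : MIdx d → NP p d →ₗ[Lam p] NP p d) (b c : Letter d)
    (hb : weight b.1 ≤ p ^ m) (hbc : ¬ IsLeading p m b.1 c.1) (w : List (Letter d)) (r : Lam p) :
    reduceStep p m prev b.1 (Finsupp.single (c :: w) r) = Finsupp.single (b :: c :: w) r := by
  rw [reduceStep, dif_neg (not_or.2 ⟨b.2, hb.not_gt⟩)]
  simp [hbc]

lemma reduceStep_of_isLeading (prev : MIdx d → NP p d →ₗ[Lam p] NP p d) (b c : Letter d)
    (hb : weight b.1 ≤ p ^ m) (hbc : IsLeading p m b.1 c.1) (w : List (Letter d)) :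
    reduceStep p m prev b.1 (Finsupp.single (c :: w) 1) =
      -(Ring.inverse (angle p m (b.1 + c.1) b.1) • ∑ x ∈ antidiagonal (b.1 + c.1),
        if rank p m x.1 < rank p m b.1 then
          angle p m (b.1 + c.1) x.1 • reduceStep p m prev x.1 (prev x.2 (Finsupp.single w 1))
        else 0) := by
  rw [reduceStep, dif_neg (not_or.2 ⟨b.2, hb.not_gt⟩)]
  simp [hbc]

/-- Left multiplication by the letter `b`, followed by reduction, on words of length `s`. -/
def reduceLen : ℕ → MIdx d → NP p d →ₗ[Lam p] NP p d
  | 0 => reduceStep p m 0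
  | s + 1 => reduceStep p m (reduceLen s)

/-- Left multiplication by the letter `b`, followed by reduction. -/
def reduce (b : MIdx d) : NP p d →ₗ[Lam p] NP p d :=
  Finsupp.linearCombination (Lam p) fun w => reduceLen p m w.length b (Finsupp.single w 1)

lemma reduceLen_eq_zero {b : MIdx d} (hb : b = 0 ∨ p ^ m < weight b) (s : ℕ) :
    reduceLen p m s b = 0 := by
  cases s <;> exact reduceStep_eq_zero p m _ hb

lemma reduce_single (b : MIdx d) (w : List (Letter d)) :
    reduce p m b (Finsupp.single w 1) = reduceLen p m w.length b (Finsupp.single w 1) := by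
  simp [reduce]

lemma reduce_eq_zero {b : MIdx d} (hb : b = 0 ∨ p ^ m < weight b) : reduce p m b = 0 := by
  refine Finsupp.lhom_ext' fun w => LinearMap.ext_ring ?_
  simp [reduce_single, reduceLen_eq_zero p m hb]

variable (d) in
/-- The combinations of words of length `s`. -/
def lengthPart (s : ℕ) : Submodule (Lam p) (NP p d) :=
  Finsupp.supported (Lam p) (Lam p) {w | w.length = s}

lemma reduce_eq_reduceLen {s : ℕ} {x : NP p d} (hx : x ∈ lengthPart p d s) (b : MIdx d) :
    reduce p m b x = reduceLen p m s b x := by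
  rw [lengthPart, Finsupp.supported_eq_span_single] at hx
  induction hx using Submodule.span_induction with
  | mem x hx =>
    obtain ⟨w, rfl, rfl⟩ := hx
    exact reduce_single p m b w
  | zero => simp
  | add x y _ _ hx hy => rw [map_add, map_add, hx, hy]
  | smul c x _ hx => rw [map_smul, map_smul, hx]

lemma single_mem_lengthPart (w : List (Letter d)) (c : Lam p) :
    Finsupp.single w c ∈ lengthPart p d w.length :=
  Finsupp.single_mem_supported _ _ rfl

/-- The relations are homogeneous in the word length; this lets the family `reduceLen`, indexed by
length, be merged into the single operator `reduce`. -/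
lemma reduceLen_mem (s : ℕ) (b : MIdx d) {x : NP p d} (hx : x ∈ lengthPart p d s) :
    reduceLen p m s b x ∈ lengthPart p d (s + 1) := by
  induction s generalizing b x with
  | zero =>
    by_cases hb : b = 0 ∨ p ^ m < weight b
    · rw [reduceLen_eq_zero p m hb]; exact zero_mem _
    push Not at hb
    rw [lengthPart, Finsupp.supported_eq_span_single] at hx
    induction hx using Submodule.span_induction with
    | mem x hx =>
      obtain ⟨w, hw, rfl⟩ := hx
      obtain rfl := List.length_eq_zero_iff.1 hw
      rw [reduceLen, reduceStep_nil p m 0 ⟨b, hb.1⟩ hb.2]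
      exact single_mem_lengthPart p _ _
    | zero => simp
    | add x y _ _ hx hy => rw [map_add]; exact add_mem hx hy
    | smul c x _ hx => rw [map_smul]; exact Submodule.smul_mem _ _ hx
  | succ s ih =>
    induction hr : rank p m b using Nat.strong_induction_on generalizing b x with
    | _ r ihr =>
    by_cases hb : b = 0 ∨ p ^ m < weight b
    · rw [reduceLen_eq_zero p m hb]; exact zero_mem _
    push Not at hb
    rw [lengthPart, Finsupp.supported_eq_span_single] at hx
    induction hx using Submodule.span_induction with
    | mem x hx =>
      obtain ⟨w, hw, rfl⟩ := hx
      obtain _ | ⟨c, w⟩ := w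
      · simp at hw
      obtain rfl : w.length = s := by simpa using hw
      by_cases hbc : IsLeading p m b c.1
      · rw [reduceLen, reduceStep_of_isLeading p m _ ⟨b, hb.1⟩ c hb.2 hbc]
        refine neg_mem (Submodule.smul_mem _ _ (sum_mem fun x _ => ?_))
        split_ifs with hx
        · refine Submodule.smul_mem _ _ (ihr _ (hr ▸ hx) _ (ih _ ?_) rfl)
          exact single_mem_lengthPart p _ _
        · exact zero_mem _
      · rw [reduceLen, reduceStep_of_not p m _ ⟨b, hb.1⟩ c hb.2 hbc]
        exact single_mem_lengthPart p _ _
    | zero => simp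
    | add x y _ _ hx hy => rw [map_add]; exact add_mem hx hy
    | smul c x _ hx => rw [map_smul]; exact Submodule.smul_mem _ _ hx

lemma reduce_nil (b : Letter d) (hb : weight b.1 ≤ p ^ m) :
    reduce p m b.1 (Finsupp.single [] 1) = Finsupp.single [b] 1 := by
  rw [reduce_single]
  exact reduceStep_nil p m _ b hb 1

lemma reduce_of_not (b c : Letter d) (hb : weight b.1 ≤ p ^ m)
    (hbc : ¬ IsLeading p m b.1 c.1) (w : List (Letter d)) :
    reduce p m b.1 (Finsupp.single (c :: w) 1) = Finsupp.single (b :: c :: w) 1 := by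
  rw [reduce_single]
  exact reduceStep_of_not p m _ b c hb hbc w 1

lemma reduce_of_isLeading (b c : Letter d) (hb : weight b.1 ≤ p ^ m)
    (hbc : IsLeading p m b.1 c.1) (w : List (Letter d)) :
    reduce p m b.1 (Finsupp.single (c :: w) 1) =
      -(Ring.inverse (angle p m (b.1 + c.1) b.1) • ∑ x ∈ antidiagonal (b.1 + c.1),
        if rank p m x.1 < rank p m b.1 then
          angle p m (b.1 + c.1) x.1 • reduce p m x.1 (reduce p m x.2 (Finsupp.single w 1))
        else 0) := by
  rw [reduce_single, List.length_cons, reduceLen, reduceStep_of_isLeading p m _ b c hb hbc]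
  congr 2
  refine Finset.sum_congr rfl fun x _ => ?_
  have h := reduceLen_mem p m w.length x.2 (single_mem_lengthPart p w 1)
  rw [reduce_single, reduce_eq_reduceLen p m h]
  rfl

variable (d) in
/-- The combinations of normal words of length `s`. -/
def normalPart (s : ℕ) : Submodule (Lam p) (NP p d) :=
  Finsupp.supported (Lam p) (Lam p) {w | w.length = s ∧ IsNormal p m w}

variable {p m} in
lemma IsNormal.single_mem {w : List (Letter d)} (hw : IsNormal p m w) (c : Lam p) :
    Finsupp.single w c ∈ normalPart p m d w.length :=
  Finsupp.single_mem_supported _ _ ⟨rfl, hw⟩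

variable {p m} in
lemma normalPart_induction {s : ℕ} {C : NP p d → Prop} (hz : C 0)
    (ha : ∀ x y, C x → C y → C (x + y)) (hc : ∀ (c : Lam p) x, C x → C (c • x))
    (h : ∀ w : List (Letter d), w.length = s → IsNormal p m w → C (Finsupp.single w 1))
    {x : NP p d} (hx : x ∈ normalPart p m d s) : C x := by
  rw [normalPart, Finsupp.supported_eq_span_single] at hx
  induction hx using Submodule.span_induction with
  | mem x hx =>
    obtain ⟨w, hw, rfl⟩ := hx
    exact h w hw.1 hw.2
  | zero => exact hz
  | add x y _ _ hx hy => exact ha _ _ hx hy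
  | smul c x _ hx => exact hc _ _ hx

lemma reduce_mem (s : ℕ) (b : MIdx d) {x : NP p d} (hx : x ∈ normalPart p m d s) :
    reduce p m b x ∈ normalPart p m d (s + 1) := by
  induction s using Nat.strong_induction_on generalizing b x with
  | _ s ih =>
  induction hr : rank p m b using Nat.strong_induction_on generalizing b x with
  | _ r ihr =>
  by_cases hb : b = 0 ∨ p ^ m < weight b
  · rw [reduce_eq_zero p m hb]; exact zero_mem _
  push Not at hb
  refine normalPart_induction (C := fun x => reduce p m b x ∈ normalPart p m d (s + 1))
    (by simp) (fun x y hx hy => by rw [map_add]; exact add_mem hx hy)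
    (fun c x hx => by rw [map_smul]; exact Submodule.smul_mem _ _ hx) (fun w hws hw => ?_) hx
  subst hws
  obtain _ | ⟨c, w⟩ := w
  · rw [reduce_nil p m ⟨b, hb.1⟩ hb.2]
    refine IsNormal.single_mem (w := [⟨b, hb.1⟩]) ⟨by simpa using hb.2, by simp⟩ 1
  · by_cases hbc : IsLeading p m b c.1
    · rw [reduce_of_isLeading p m ⟨b, hb.1⟩ c hb.2 hbc]
      refine neg_mem (Submodule.smul_mem _ _ (sum_mem fun x _ => ?_))
      split_ifs with hx
      · refine Submodule.smul_mem _ _ (ihr _ (hr ▸ hx) _ (ih _ (by simp) _ ?_) rfl)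
        exact IsNormal.single_mem ⟨fun k hk => hw.1 k (List.mem_cons_of_mem _ hk), hw.2.tail⟩ 1
      · exact zero_mem _
    · rw [reduce_of_not p m ⟨b, hb.1⟩ c hb.2 hbc]
      refine IsNormal.single_mem (w := ⟨b, hb.1⟩ :: c :: w) ⟨?_, ?_⟩ 1
      · rw [List.forall_mem_cons]
        exact ⟨hb.2, hw.1⟩
      · exact List.isChain_cons_cons.2 ⟨hbc, hw.2⟩

/-- The element of the relation in the multidegree `K`, applied to `y`. -/
def relator (K : MIdx d) (y : NP p d) : NP p d :=
  ∑ x ∈ antidiagonal K, angle p m K x.1 • reduce p m x.1 (reduce p m x.2 y)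

lemma relator_add (K : MIdx d) (x y : NP p d) :
    relator p m K (x + y) = relator p m K x + relator p m K y := by
  simp [relator, Finset.sum_add_distrib]

lemma relator_zero (K : MIdx d) : relator p m K 0 = 0 := by simp [relator]

lemma relator_smul (K : MIdx d) (c : Lam p) (y : NP p d) :
    relator p m K (c • y) = c • relator p m K y := by
  simp only [relator, map_smul, Finset.smul_sum]
  exact Finset.sum_congr rfl fun x _ => smul_comm _ _ _

lemma relator_eq_zero_of_lt {K : MIdx d} (hK : p ^ m + p ^ m < weight K) (y : NP p d) :
    relator p m K y = 0 := by
  refine Finset.sum_eq_zero fun x hx => ?_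
  have h1 := weight_add x.1 x.2
  rw [mem_antidiagonal.1 hx] at h1
  rcases Nat.lt_or_ge (p ^ m) (weight x.1) with h | h
  · simp [reduce_eq_zero p m (Or.inr h)]
  · have h2 : p ^ m < weight x.2 := by omega
    simp [reduce_eq_zero p m (Or.inr h2)]

/-- If multiplying v by K - g needs no reduction, then multiplying by g afterwards rewrites exactly
the leading word of this relation, so the head term cancels the others by definition. -/
lemma relator_eq_zero_of_reduce {K g : MIdx d} (hK : p ^ m < weight K) (hg : IsHead p m K g)
    {v : List (Letter d)} (hb : K - g ≠ 0)
    (h : reduce p m (K - g) (Finsupp.single v 1) = Finsupp.single (⟨K - g, hb⟩ :: v) 1) :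
    relator p m K (Finsupp.single v 1) = 0 := by
  have hsub : g + (K - g) = K := add_tsub_cancel_of_le hg.le
  have hg0 : g ≠ 0 := by
    rintro rfl
    have := hg.weight_eq hK
    rw [weight_zero] at this
    exact (pow_pos hp.out.pos m).ne this
  have hlead : IsLeading p m g (K - g) := by
    rw [IsLeading, hsub]
    exact ⟨hK, hg⟩
  have h1 := reduce_of_isLeading p m ⟨g, hg0⟩ ⟨K - g, hb⟩ (hg.weight_eq hK).le hlead v
  simp only [hsub] at h1
  rw [relator, sum_antidiagonal_of_isHead hg
    (fun a b => angle p m K a • reduce p m a (reduce p m b (Finsupp.single v 1)))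
    (fun a b ha => by simp [reduce_eq_zero p m (Or.inr ha)]), h, h1, smul_neg, smul_smul,
    Ring.mul_inverse_cancel _ (isUnit_angle_of_isHead hK hg), one_smul, add_neg_cancel]

/-- Coassociativity: both sides are the threefold products of total multidegree L, bracketed in two
ways. It replaces the usual computation of S-polynomials. -/
lemma sum_relator (L : MIdx d) (y : NP p d) :
    ∑ x ∈ antidiagonal L, angle p m L x.1 • relator p m x.1 (reduce p m x.2 y) =
      ∑ x ∈ antidiagonal L, angle p m L x.1 • reduce p m x.1 (relator p m x.2 y) := by
  have := angle_sum_assoc p m L fun a b c => reduce p m a (reduce p m b (reduce p m c y))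
  simpa only [relator, map_sum, map_smul, Finset.smul_sum, smul_smul] using this

/-- The induction is on the length of the word, then on the rank of the head g of K, then on the
rank of K - g. The critical case is an overlap g, K - g, c. There `sum_relator` in multidegree K + c
expresses a nonzero multiple of the wanted relator by relators that vanish by induction, and `Lam p`
has no zero divisors. -/
lemma relator_eq_zero {K : MIdx d} (hK : p ^ m < weight K) {s : ℕ} {y : NP p d}
    (hy : y ∈ normalPart p m d s) : relator p m K y = 0 := by
  induction s using Nat.strong_induction_on generalizing K y with
  | _ s ih =>
  obtain ⟨g, hg, -⟩ := exists_isHead p m hK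
  induction hr : rank p m g using Nat.strong_induction_on generalizing K y g with
  | _ r ihr =>
  induction ht : rank p m (K - g) using Nat.strong_induction_on generalizing K y with
  | _ t iht =>
  rcases Nat.lt_or_ge (p ^ m + p ^ m) (weight K) with hbig | hbig
  · exact relator_eq_zero_of_lt p m hbig y
  have hsub : g + (K - g) = K := add_tsub_cancel_of_le hg.le
  have hwg := hg.weight_eq hK
  have hwK := weight_add g (K - g)
  rw [hsub] at hwK
  have hb : K - g ≠ 0 := by
    intro h
    rw [h, weight_zero] at hwK
    omega
  have hwb : weight (K - g) ≤ p ^ m := by omega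
  refine normalPart_induction (C := fun y => relator p m K y = 0) (relator_zero p m K)
    (fun x y hx hy => by rw [relator_add, hx, hy, add_zero])
    (fun c x hx => by rw [relator_smul, hx, smul_zero]) (fun v hvs hv => ?_) hy
  subst hvs
  obtain _ | ⟨c, v⟩ := v
  · exact relator_eq_zero_of_reduce p m hK hg hb (reduce_nil p m ⟨K - g, hb⟩ hwb)
  by_cases hbc : IsLeading p m (K - g) c.1
  swap
  · exact relator_eq_zero_of_reduce p m hK hg hb (reduce_of_not p m ⟨K - g, hb⟩ c hwb hbc v)
  have hv' : IsNormal p m v :=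
    ⟨fun k hk => hv.1 k (List.mem_cons_of_mem _ hk), hv.2.tail⟩
  have hc : weight c.1 ≤ p ^ m := hv.1 c (by simp)
  -- Hence every first factor K' in a decomposition of K + c has a head of rank at most that of g.
  have hgL : IsHead p m (K + c.1) g := by
    have h1 := IsHead.trans (a := g) (b := K - g) (c := c.1) (by rwa [hsub]) hbc.1
      (by rwa [hsub]) hbc.2
    rwa [hsub] at h1
  have hwL : p ^ m + p ^ m < weight (K + c.1) := by
    have h1 := hbc.1
    rw [weight_add] at h1 ⊢
    omega
  have hcv : reduce p m c.1 (Finsupp.single v 1) = Finsupp.single (c :: v) 1 := by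
    obtain _ | ⟨c', v⟩ := v
    · exact reduce_nil p m c hc
    · exact reduce_of_not p m c c' hc (List.isChain_cons_cons.1 hv.2).1 v
  have key := sum_relator p m (K + c.1) (Finsupp.single v 1)
  rw [Finset.sum_eq_zero (s := antidiagonal (K + c.1))
    (f := fun x => angle p m (K + c.1) x.1 • reduce p m x.1 (relator p m x.2 _)),
    Finset.sum_eq_single (K, c.1)] at key
  · simp only [hcv] at key
    exact (smul_eq_zero.1 key).resolve_left (angle_ne_zero p m le_self_add)
  · rintro ⟨K', c'⟩ hx hne
    have hL : K' + c' = K + c.1 := mem_antidiagonal.1 hx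
    simp only
    by_cases hc' : c' = 0 ∨ p ^ m < weight c'
    · rw [reduce_eq_zero p m hc', LinearMap.zero_apply, relator_zero, smul_zero]
    push Not at hc'
    have hwL' := weight_add K' c'
    rw [hL] at hwL'
    have hwK' : p ^ m < weight K' := by omega
    have hmem := reduce_mem p m v.length c' (hv'.single_mem 1)
    obtain ⟨g', hg', -⟩ := exists_isHead p m hwK'
    have hg'w := hg'.weight_eq hwK'
    have hK'le : K' ≤ K + c.1 := hL ▸ le_self_add
    by_cases hgg : g' = g
    · subst hgg
      rcases Nat.lt_or_ge (p ^ m + p ^ m) (weight K') with h2 | h2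
      · rw [relator_eq_zero_of_lt p m h2, smul_zero]
      have hsub' : g' + (K' - g') = K' := add_tsub_cancel_of_le hg'.le
      have h3 := weight_add g' (K' - g')
      rw [hsub'] at h3
      have h4 : K' - g' ≤ K - g' + c.1 := by
        intro j
        have e1 := congrFun hsub j
        have e2 := congrFun hL j
        simp only [Pi.add_apply, Pi.sub_apply] at e1 e2 ⊢
        omega
      have h5 : K' - g' ≠ K - g' := by
        intro h6
        have h7 : K' = K := by rw [← hsub, ← hsub', h6]
        -- K' = K would force c' = c, the one term that is kept. So K' - g differs from K - g, which
        -- is the head of K - g + c, and has smaller rank.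
        subst h7
        exact hne (Prod.ext rfl (add_left_cancel hL))
      have h8 := hbc.2.rank_lt h4 (by omega) h5
      rw [iht _ (ht ▸ h8) hwK' hmem hg' rfl, smul_zero]
    · have h4 := hgL.rank_lt (hg'.le.trans hK'le) hg'w.le hgg
      rw [ihr _ (hr ▸ h4) hwK' hmem g' hg' rfl, smul_zero]
  · have h : (K, c.1) ∈ antidiagonal (K + c.1) := mem_antidiagonal.2 (Eq.refl (K + c.1))
    exact fun h' => absurd h h'
  · rintro ⟨a, K'⟩ hx
    have hL : a + K' = K + c.1 := mem_antidiagonal.1 hx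
    simp only
    rcases Nat.lt_or_ge (p ^ m) (weight a) with h | h
    · rw [reduce_eq_zero p m (Or.inr h), LinearMap.zero_apply, smul_zero]
    · have h1 := weight_add a K'
      rw [hL] at h1
      -- As |K + c| > 2 p^m and |a| ≤ p^m, the relator inside has weight above p^m, and it is
      -- applied to a shorter word.
      rw [ih v.length (by simp) (by omega) (hv'.single_mem 1), map_zero, smul_zero]

variable (d) in
/-- The combinations of normal words. -/
def normalSpan : Submodule (Lam p) (NP p d) :=
  Finsupp.supported (Lam p) (Lam p) {w | IsNormal p m w}

lemma normalPart_le (s : ℕ) : normalPart p m d s ≤ normalSpan p m d :=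
  Finsupp.supported_mono fun _ h => h.2

variable {p m} in
lemma normalSpan_induction {C : NP p d → Prop} (hz : C 0)
    (ha : ∀ x y, C x → C y → C (x + y)) (hc : ∀ (c : Lam p) x, C x → C (c • x))
    (h : ∀ s, ∀ x ∈ normalPart p m d s, C x)
    {x : NP p d} (hx : x ∈ normalSpan p m d) : C x := by
  rw [normalSpan, Finsupp.supported_eq_span_single] at hx
  induction hx using Submodule.span_induction with
  | mem x hx =>
    obtain ⟨w, hw, rfl⟩ := hx
    exact h _ _ (IsNormal.single_mem hw _)
  | zero => exact hz
  | add x y _ _ hx hy => exact ha _ _ hx hy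
  | smul c x _ hx => exact hc _ _ hx

lemma isFormAction_reduce : IsFormAction p m (reduce p m) (normalSpan p m d) where
  zero := reduce_eq_zero p m (Or.inl rfl)
  mem k y hy := normalSpan_induction (C := fun y => reduce p m k y ∈ normalSpan p m d)
    (by simp) (fun x y hx hy => by rw [map_add]; exact add_mem hx hy)
    (fun c x hx => by rw [map_smul]; exact Submodule.smul_mem _ _ hx)
    (fun s x hx => normalPart_le p m _ (reduce_mem p m s k hx)) hy
  big k hk y _ := by rw [reduce_eq_zero p m (Or.inr hk), LinearMap.zero_apply]
  rel k hk y hy := normalSpan_induction (C := fun y => relator p m k y = 0)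
    (relator_zero p m k) (fun x y hx hy => by rw [relator_add, hx, hy, add_zero])
    (fun c x hx => by rw [relator_smul, hx, smul_zero])
    (fun s x hx => relator_eq_zero p m hk hx) hy

/-- Each rewriting step uses a relation that holds in the quotient, so reduction does not change the
class. The two nested inductions follow the recursion of `reduceStep`. -/
lemma mkQ_reduce (b : MIdx d) (w : List (Letter d)) :
    (K p m d).mkQ (reduce p m b (Finsupp.single w 1)) = formMul p m b (cls p m w) := by
  suffices h : ∀ s, ∀ x ∈ lengthPart p d s,
      (K p m d).mkQ (reduce p m b x) = formMul p m b ((K p m d).mkQ x) from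
    h _ _ (single_mem_lengthPart p w 1)
  intro s
  induction s using Nat.strong_induction_on generalizing b with
  | _ s ih =>
  induction hr : rank p m b using Nat.strong_induction_on generalizing b with
  | _ r ihr =>
  intro x hx
  by_cases hb : b = 0 ∨ p ^ m < weight b
  · rw [reduce_eq_zero p m hb, LinearMap.zero_apply, map_zero]
    rcases hb with rfl | hb
    · simp
    · rw [formMul_eq_zero p m hb, LinearMap.zero_apply]
  push Not at hb
  rw [lengthPart, Finsupp.supported_eq_span_single] at hx
  induction hx using Submodule.span_induction with
  | mem x hx =>
    obtain ⟨w, rfl, rfl⟩ := hx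
    change _ = formMul p m b (cls p m w)
    obtain _ | ⟨c, w⟩ := w
    · rw [reduce_nil p m ⟨b, hb.1⟩ hb.2]
      exact cls_cons p m ⟨b, hb.1⟩ []
    by_cases hbc : IsLeading p m b c.1
    · rw [reduce_of_isLeading p m ⟨b, hb.1⟩ c hb.2 hbc, map_neg, map_smul, map_sum]
      have h1 := sum_formMul_formMul p m hbc.1 (cls p m w)
      rw [sum_antidiagonal_of_isHead hbc.2
        (fun y z => angle p m (b + c.1) y • formMul p m y (formMul p m z (cls p m w)))
        (fun y z hy => by simp [formMul_eq_zero p m hy])] at h1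
      have h2 : ∀ x ∈ antidiagonal (b + c.1), (K p m d).mkQ (if rank p m x.1 < rank p m b then
          angle p m (b + c.1) x.1 • reduce p m x.1 (reduce p m x.2 (Finsupp.single w 1)) else 0) =
          if rank p m x.1 < rank p m b then
          angle p m (b + c.1) x.1 • formMul p m x.1 (formMul p m x.2 (cls p m w)) else 0 := by
        intro x _
        split_ifs with hx
        · have h3 := reduceLen_mem p m w.length x.2 (single_mem_lengthPart p w 1)
          rw [← reduce_eq_reduceLen p m (single_mem_lengthPart p w 1)] at h3
          rw [map_smul, ihr _ (hr ▸ hx) x.1 rfl _ h3,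
            ih w.length (by simp) x.2 _ (single_mem_lengthPart p w 1)]
          rfl
        · simp
      rw [Finset.sum_congr rfl h2, eq_neg_of_add_eq_zero_left h1, add_tsub_cancel_left, smul_neg,
        neg_neg, smul_smul, Ring.inverse_mul_cancel _ (isUnit_angle_of_isHead hbc.1 hbc.2),
        one_smul, cls_cons]
    · rw [reduce_of_not p m ⟨b, hb.1⟩ c hb.2 hbc]
      exact cls_cons p m ⟨b, hb.1⟩ (c :: w)
  | zero => simp
  | add x y _ _ hx hy => simp only [map_add, hx, hy]
  | smul c x _ hx => simp only [map_smul, hx]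

variable (d) in
/-- The `q`-jet complex is a retract of a free module. -/
lemma exists_section : ∃ f : Om p m d →ₗ[Lam p] NP p d, (K p m d).mkQ ∘ₗ f = LinearMap.id := by
  have hnil : IsNormal p m ([] : List (Letter d)) := ⟨by simp, by simp⟩
  obtain ⟨f, h1, h2⟩ := (isFormAction_reduce p m).exists_lift p m
    (normalPart_le p m _ (hnil.single_mem 1))
  -- The orbit of the empty word under `reduce` is the normal form map; its compatibility with the
  -- projection makes it a section.
  have h3 : ∀ b, (K p m d).mkQ ∘ₗ reduce p m b = formMul p m b ∘ₗ (K p m d).mkQ := fun b =>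
    Finsupp.lhom_ext' fun w => LinearMap.ext_ring (mkQ_reduce p m b w)
  refine ⟨f, Om_ext p m fun w => ?_⟩
  induction w with
  | nil =>
    rw [LinearMap.comp_apply, h1]
    rfl
  | cons k w ih =>
    rw [LinearMap.comp_apply, cls_cons, h2, ← LinearMap.comp_apply (K p m d).mkQ, h3,
      LinearMap.comp_apply, ← LinearMap.comp_apply (K p m d).mkQ, ih]
    rfl

end normalWords

/-! ## Density of the generators -/

section density

variable (p : ℕ) [hp : Fact p.Prime] (m : ℕ) {d : ℕ} (A : Type*) [CommRing A] [Algebra (Lam p) A]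

lemma adicIdeal_fg : (adicIdeal p A).FG :=
  Submodule.fg_span (Set.toFinite _)

/-- A-linear maps preserve the adic filtration, hence are continuous, and the target is separated.
Finite generation of the ideal is needed to identify the kernel of the n-th evaluation with I^n
times the completion. -/
lemma hat_eq_zero {f : PDHat p d A →ₗ[A] PDHat p d A} (h : ∀ k, f (mono p A k) = 0) : f = 0 := by
  have h1 : ∀ x, f (AdicCompletion.of (adicIdeal p A) (PDPoly d A) x) = 0 := by
    intro x
    have h2 : f ∘ₗ AdicCompletion.of (adicIdeal p A) (PDPoly d A) = 0 :=
      Finsupp.lhom_ext' fun k => LinearMap.ext_ring (h k)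
    exact LinearMap.congr_fun h2 x
  refine LinearMap.ext fun y => ?_
  refine IsHausdorff.haus (I := adicIdeal p A) inferInstance (f y) fun n => ?_
  obtain ⟨x, hx⟩ := Submodule.Quotient.mk_surjective _ (AdicCompletion.eval (adicIdeal p A) (PDPoly d A) n y)
  have h2 : y - AdicCompletion.of (adicIdeal p A) (PDPoly d A) x ∈
      (adicIdeal p A ^ n • ⊤ : Submodule A (PDHat p d A)) := by
    rw [AdicCompletion.pow_smul_top_eq_ker_eval (adicIdeal_fg p A), LinearMap.mem_ker, map_sub,
      ← hx, sub_eq_zero]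
    rfl
  rw [SModEq.zero]
  have h3 : f y = f (y - AdicCompletion.of (adicIdeal p A) (PDPoly d A) x) := by
    rw [map_sub, h1, sub_zero]
  rw [h3]
  exact Submodule.smul_top_le_comap_smul_top _ f h2

/-- The coordinates of an element of `LΩ` with respect to the words, for a section `s` of the
projection from the tensor algebra. -/
def wordCoord (s : Om p m d →ₗ[Lam p] NP p d) (w : List (Letter d)) :
    LOm p m d A →ₗ[A] PDHat p d A :=
  Finsupp.lapply w ∘ₗ (TensorProduct.finsuppScalarRight (Lam p) A (PDHat p d A)
    (List (Letter d))).toLinearMap ∘ₗ TensorProduct.AlgebraTensorModule.map LinearMap.id s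

lemma eq_zero_of_wordCoord {s : Om p m d →ₗ[Lam p] NP p d}
    (hs : (K p m d).mkQ ∘ₗ s = LinearMap.id) {z : LOm p m d A}
    (h : ∀ w, wordCoord p m A s w z = 0) : z = 0 := by
  have h1 : TensorProduct.AlgebraTensorModule.map (LinearMap.id : _ →ₗ[A] PDHat p d A) s z = 0 := by
    refine (TensorProduct.finsuppScalarRight (Lam p) A (PDHat p d A)
      (List (Letter d))).injective ?_
    rw [map_zero]
    exact Finsupp.ext h
  have h2 : TensorProduct.AlgebraTensorModule.map (LinearMap.id : _ →ₗ[A] PDHat p d A)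
      (K p m d).mkQ (TensorProduct.AlgebraTensorModule.map
        (LinearMap.id : _ →ₗ[A] PDHat p d A) s z) = z := by
    rw [← LinearMap.comp_apply, ← TensorProduct.AlgebraTensorModule.map_comp, hs,
      LinearMap.id_comp, TensorProduct.AlgebraTensorModule.map_id, LinearMap.id_apply]
  rw [← h2, h1, map_zero]

/-- A section of the projection embeds LΩ into finitely supported families of elements of the
completion; each coordinate is a map to a separated module, to which `hat_eq_zero` applies. -/
lemma LOm_hom_ext {f g : LOm p m d A →ₗ[A] LOm p m d A}
    (h : ∀ k w, f (gen p m A k w) = g (gen p m A k w)) : f = g := by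
  obtain ⟨s, hs⟩ := exists_section p m d
  refine LOm_ext p m A fun y w => ?_
  have hw : w ∈ Submodule.span (Lam p) (Set.range (cls p m (d := d))) := by
    rw [span_range_cls]
    trivial
  induction hw using Submodule.span_induction with
  | mem w hw =>
    obtain ⟨w, rfl⟩ := hw
    rw [← sub_eq_zero, ← LinearMap.sub_apply]
    refine eq_zero_of_wordCoord p m A hs fun w' => ?_
    have h1 : wordCoord p m A s w' ∘ₗ (f - g) ∘ₗ
        (TensorProduct.AlgebraTensorModule.mk (Lam p) A (PDHat p d A) (Om p m d)).flip
          (cls p m w) = 0 := by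
      refine hat_eq_zero p A fun k => ?_
      change wordCoord p m A s w' (f (gen p m A k w) - g (gen p m A k w)) = 0
      rw [h, sub_self, map_zero]
    exact LinearMap.congr_fun h1 y
  | zero => simp
  | add v w _ _ hv hw => rw [TensorProduct.tmul_add, map_add, map_add, hv, hw]
  | smul c w _ hw =>
    rw [TensorProduct.tmul_smul, LinearMap.map_smul_of_tower, LinearMap.map_smul_of_tower, hw]

end density

/-! ## The conditions on the integration map -/

section conditions

variable (p : ℕ) [hp : Fact p.Prime] (m : ℕ) {d n : ℕ} (A : Type*) [CommRing A] [Algebra (Lam p) A]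

lemma tmul_cls_mem (y : PDHat p d A) (w : List (Letter d)) :
    y ⊗ₜ[Lam p] cls p m w ∈ LOmDeg p m d A w.length :=
  Submodule.subset_span ⟨y, w, rfl, rfl⟩

lemma tmul_formMul_cls_mem (y : PDHat p d A) (k : MIdx d) (w : List (Letter d)) :
    y ⊗ₜ[Lam p] formMul p m k (cls p m w) ∈ LOmDeg p m d A (w.length + 1) := by
  by_cases hk : k = 0
  · simp [hk]
  · rw [← cls_cons p m ⟨k, hk⟩]
    exact tmul_cls_mem p m A y (⟨k, hk⟩ :: w)

lemma bimul_mem {r : ℕ} {z : LOm p m (n + 1) A} (hz : z ∈ LOmDeg p m (n + 1) A r) (a : MIdx n) :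
    bimul p m A a z ∈ LOmDeg p m (n + 1) A (r + 1) := by
  induction hz using Submodule.span_induction with
  | mem z hz =>
    obtain ⟨y, w, rfl, rfl⟩ := hz
    rw [bimul_tmul]
    exact sum_mem fun j _ => tmul_formMul_cls_mem p m A _ _ _
  | zero => rw [map_zero]; exact zero_mem _
  | add x y _ _ hx hy => rw [map_add]; exact add_mem hx hy
  | smul c x _ hx => rw [map_smul]; exact Submodule.smul_mem _ _ hx

lemma bimulComp_mem {r : ℕ} {g : PDHat p (n + 1) A →ₗ[A] LOm p m (n + 1) A}
    (hg : ∀ y, g y ∈ LOmDeg p m (n + 1) A r) (b : MIdx (n + 1)) (y : PDHat p (n + 1) A) :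
    bimulComp p m A b g y ∈ LOmDeg p m (n + 1) A (r + 1) := by
  obtain ⟨a, t, rfl⟩ := exists_snocIdx b
  rw [bimulComp_snocIdx]
  split_ifs
  · exact bimul_mem p m A (hg y) a
  · exact zero_mem _

lemma corr_mem (b : MIdx (n + 1)) (w : List (Letter (n + 1))) (y : PDHat p (n + 1) A) :
    corr p m A b (cls p m w) y ∈ LOmDeg p m (n + 1) A (w.length + 1) := by
  rw [corr]
  split_ifs
  · exact zero_mem _
  · rw [LinearMap.neg_apply, LinearMap.neg_apply, corrSum_apply]
    exact neg_mem (sum_mem fun l _ =>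
      Submodule.smul_of_tower_mem _ _ (tmul_formMul_cls_mem p m A _ _ _))

lemma topInt_mem (w : List (Letter (n + 1))) (y : PDHat p (n + 1) A) :
    topInt p m A (cls p m w) y ∈ LOmDeg p m (n + 1) A w.length := by
  induction w generalizing y with
  | nil =>
    rw [topInt_one]
    exact tmul_cls_mem p m A _ []
  | cons k w ih =>
    rw [cls_cons, topInt_formMul]
    exact add_mem (corr_mem p m A _ w y) (bimulComp_mem p m A ih _ y)

lemma firstInt_mem (b : MIdx (n + 1)) (w : List (Letter (n + 1))) (y : PDHat p (n + 1) A) :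
    firstInt p m A b (cls p m w) y ∈ LOmDeg p m (n + 1) A w.length := by
  rw [firstInt]
  split_ifs
  · rw [powInt]
    split_ifs
    · exact topInt_mem p m A w y
    · exact tmul_cls_mem p m A _ w
    · exact zero_mem _
  · exact zero_mem _

lemma curriedInt_cons_mem (k : Letter (n + 1)) (w : List (Letter (n + 1)))
    (y : PDHat p (n + 1) A) :
    curriedInt p m A (cls p m (k :: w)) y ∈ LOmDeg p m (n + 1) A w.length := by
  induction w generalizing k y with
  | nil =>
    rw [cls_cons, curriedInt_formMul, curriedInt_one, map_zero, sub_zero]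
    exact firstInt_mem p m A _ [] y
  | cons k' w ih =>
    rw [cls_cons, curriedInt_formMul]
    exact sub_mem (firstInt_mem p m A _ _ y) (bimulComp_mem p m A (ih k') _ y)

lemma integration_mem {r : ℕ} {z : LOm p m (n + 1) A} (hz : z ∈ LOmDeg p m (n + 1) A (r + 1)) :
    integration p m A z ∈ LOmDeg p m (n + 1) A r := by
  induction hz using Submodule.span_induction with
  | mem z hz =>
    obtain ⟨y, w, hw, rfl⟩ := hz
    obtain _ | ⟨k, w⟩ := w
    · simp at hw
    obtain rfl : w.length = r := by simpa using hw
    exact curriedInt_cons_mem p m A k w y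
  | zero => rw [map_zero]; exact zero_mem _
  | add x y _ _ hx hy => rw [map_add]; exact add_mem hx hy
  | smul c x _ hx => rw [map_smul]; exact Submodule.smul_mem _ _ hx

lemma integration_eq_zero {z : LOm p m (n + 1) A} (hz : z ∈ LOmDeg p m (n + 1) A 0) :
    integration p m A z = 0 := by
  induction hz using Submodule.span_induction with
  | mem z hz =>
    obtain ⟨y, w, hw, rfl⟩ := hz
    obtain rfl := List.length_eq_zero_iff.1 hw
    rw [integration_tmul, curriedInt_one, LinearMap.zero_apply]
  | zero => rw [map_zero]
  | add x y _ _ hx hy => rw [map_add, hx, hy, add_zero]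
  | smul c x _ hx => rw [map_smul, hx, smul_zero]

lemma curriedInt_hat {a : MIdx n} (ha : a ≠ 0) (w : Om p m (n + 1)) (y : PDHat p (n + 1) A) :
    curriedInt p m A (formMul p m (snocIdx a 0) w) y =
      -bimul p m A a (curriedInt p m A w y) := by
  rw [curriedInt_formMul, firstInt_snocIdx, if_neg ha, bimulComp_snocIdx, if_pos ⟨rfl, ha⟩,
    LinearMap.zero_apply, zero_sub]
  rfl

/-- Moving the coefficient past one more factor on the left is `bimul`. The ranges j ≤ t and j ≤ p^m
differ only in terms whose coefficient or form is zero. -/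
lemma moved_append (kh : MIdx n) (u : List (Letter n)) (a : Letter n) (t : ℕ)
    (v : List (Letter (n + 1))) :
    moved p m A kh (u ++ [a]) t v = bimul p m A a.1 (moved p m A kh u t v) := by
  induction u generalizing t v with
  | nil =>
    have h1 := Finset.range_subset_range.2 (show t + 1 ≤ t + 1 + p ^ m by omega)
    have h2 := Finset.range_subset_range.2 (show p ^ m + 1 ≤ t + 1 + p ^ m by omega)
    rw [List.nil_append, moved, moved, gen_eq, bimul_mono, Finset.sum_subset h1,
      Finset.sum_subset h2]
    · refine Finset.sum_congr rfl fun j _ => ?_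
      rw [moved, gen_eq, cls_cons]
      rfl
    · intro j _ hj
      rw [Finset.mem_range] at hj
      rw [formMul_eq_zero p m (by rw [weight_snocIdx]; omega), LinearMap.zero_apply,
        TensorProduct.tmul_zero, smul_zero]
    · intro j _ hj
      rw [Finset.mem_range] at hj
      rw [angle₁_eq_zero p m (by omega), zero_smul]
  | cons c u ih =>
    rw [List.cons_append, moved, moved, map_sum]
    refine Finset.sum_congr rfl fun j _ => ?_
    rw [ih, LinearMap.map_smul_of_tower]

lemma curriedInt_append_eq_zero (u : List (Letter n)) (w : List (Letter (n + 1)))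
    (y : PDHat p (n + 1) A) (h : curriedInt p m A (cls p m w) y = 0) :
    curriedInt p m A (cls p m (u.map (fun a => snocLetter a 0) ++ w)) y = 0 := by
  induction u with
  | nil => exact h
  | cons a u ih =>
    rw [List.map_cons, List.cons_append, cls_cons]
    refine (curriedInt_hat p m A a.2 _ y).trans ?_
    rw [ih, map_zero, neg_zero]

lemma curriedInt_append (kh : MIdx n) (t : ℕ) (c : Lam p) (u : List (Letter n))
    (w v : List (Letter (n + 1))) (y : PDHat p (n + 1) A)
    (h : curriedInt p m A (cls p m w) y = c • gen p m A (snocIdx kh t) v) :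
    curriedInt p m A (cls p m (u.map (fun a => snocLetter a 0) ++ w)) y =
      ((-1) ^ u.length * c) • moved p m A kh u.reverse t v := by
  induction u with
  | nil =>
    rw [List.length_nil, pow_zero, one_mul, List.reverse_nil]
    exact h
  | cons a u ih =>
    rw [List.map_cons, List.cons_append, cls_cons]
    refine (curriedInt_hat p m A a.2 _ y).trans ?_
    rw [ih, LinearMap.map_smul_of_tower, ← moved_append, List.reverse_cons, List.length_cons,
      pow_succ, mul_neg_one, neg_mul, neg_smul]

lemma curriedInt_pow {l : ℕ} (v : List (Letter (n + 1)))
    (hl : (0 < l ∧ l < p ^ m) ∨ (l = p ^ m ∧ v = [])) (y : PDHat p (n + 1) A) :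
    curriedInt p m A (formMul p m (snocIdx 0 l) (cls p m v)) y =
      raise p m A l y ⊗ₜ[Lam p] cls p m v := by
  rw [curriedInt_formMul, firstInt_snocIdx, if_pos rfl, bimulComp_snocIdx,
    if_neg (fun h => h.2 rfl), LinearMap.zero_apply, sub_zero]
  rcases hl with ⟨h1, h2⟩ | ⟨rfl, rfl⟩
  · rw [powInt_of_lt p m A h1.ne' h2]
    rfl
  · rw [powInt_top, topInt_one]
    rfl

lemma isIntegration_integration : IsIntegration p m A (integration p m (n := n) A) where
  map_deg _ _ hz := integration_mem p m A hz
  map_deg_zero _ hz := integration_eq_zero p m A hz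
  eq_zero kh k u b v _ _ _ h := by
    rw [gen_eq, integration_tmul]
    by_cases hk : p ^ m ∣ k
    swap
    · exact curriedInt_mono_of_not_dvd p m A kh hk _
    refine curriedInt_append_eq_zero p m A u _ _ ?_
    obtain ⟨b, hb⟩ := b
    obtain ⟨a, t, rfl⟩ := exists_snocIdx b
    have h1 : (snocIdx a t) (Fin.last n) = t := by simp [snocIdx]
    have h2 : Fin.init (α := fun _ => ℕ) (snocIdx a t) = a := by simp [snocIdx]
    simp only [h1, h2] at h
    rw [cls_cons]
    simp only
    rcases h with ⟨rfl, rfl⟩ | ⟨ht, ha⟩ | h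
    · have ha : a ≠ 0 := by
        rintro rfl
        exact hb (snocIdx_eq_zero.2 ⟨rfl, rfl⟩)
      rw [curriedInt_hat p m A ha, curriedInt_one, LinearMap.zero_apply, map_zero, neg_zero]
    · rw [curriedInt_formMul, firstInt_snocIdx, if_neg ha, bimulComp_snocIdx,
        if_neg (fun h => ht h.1), LinearMap.zero_apply, LinearMap.zero_apply, sub_zero,
        LinearMap.zero_apply]
    · exact absurd hk h
  eq_moved kh k u b v _ _ _ h0 hk hl := by
    rw [gen_eq, integration_tmul]
    refine curriedInt_append p m A kh _ _ u _ v _ ?_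
    obtain ⟨b, hb⟩ := b
    obtain ⟨a, t, rfl⟩ := exists_snocIdx b
    have h1 : (snocIdx a t) (Fin.last n) = t := by simp [snocIdx]
    have h2 : Fin.init (α := fun _ => ℕ) (snocIdx a t) = a := by simp [snocIdx]
    simp only [h1, h2] at h0 hl ⊢
    subst h0
    rw [cls_cons]
    refine (curriedInt_pow p m A v hl _).trans ?_
    rw [raise_mono, if_pos hk, ← TensorProduct.smul_tmul', gen_eq]

end conditions

/-! ## Uniqueness and the homotopy formula -/

section uniqueness

variable (p : ℕ) [hp : Fact p.Prime] (m : ℕ) {d n : ℕ} (A : Type*) [CommRing A] [Algebra (Lam p) A]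

lemma cls_eq_zero {w : List (Letter d)} {k : Letter d} (hk : k ∈ w) (h : p ^ m < weight k.1) :
    cls p m w = 0 := by
  induction w with
  | nil => simp at hk
  | cons b w ih =>
    rw [cls_cons]
    rcases List.mem_cons.1 hk with rfl | hk
    · rw [formMul_eq_zero p m h, LinearMap.zero_apply]
    · rw [ih hk, map_zero]

lemma exists_prefix (u : List (Letter d)) :
    ∃ E : Om p m d →ₗ[Lam p] Om p m d, ∀ w, cls p m (u ++ w) = E (cls p m w) := by
  induction u with
  | nil => exact ⟨LinearMap.id, fun w => rfl⟩
  | cons a u ih =>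
    obtain ⟨E, hE⟩ := ih
    exact ⟨formMul p m a.1 ∘ₗ E, fun w => by
      rw [List.cons_append, cls_cons, hE, LinearMap.comp_apply]⟩

variable {A p m} {h h' : LOm p m (n + 1) A →ₗ[A] LOm p m (n + 1) A}

/-- For nonempty v the conditions leave two cases open. If b has last entry 0, it is absorbed into u
and v gets shorter. If b = (0, p^m), the relation that contains b ⊗' b' expresses its word, up to a
unit, by words whose first letter is not (0, p^m). -/
lemma IsIntegration.gen_cons_eq (hh : IsIntegration p m A h) (hh' : IsIntegration p m A h')
    (kh : MIdx n) {k : ℕ} (hk : p ^ m ∣ k) (u : List (Letter n)) (b : Letter (n + 1))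
    (v : List (Letter (n + 1))) (hu : ∀ a ∈ u, weight a.1 ≤ p ^ m) (hb : weight b.1 ≤ p ^ m)
    (hv : ∀ c ∈ v, weight c.1 ≤ p ^ m) :
    h (gen p m A (snocIdx kh k) (u.map (fun a => snocLetter a 0) ++ b :: v)) =
      h' (gen p m A (snocIdx kh k) (u.map (fun a => snocLetter a 0) ++ b :: v)) := by
  induction hs : v.length using Nat.strong_induction_on generalizing u b v with
  | _ s ih =>
  have tail : ∀ (b' : Letter (n + 1)) (v' : List (Letter (n + 1))), v'.length < s →
      weight b'.1 ≤ p ^ m → (∀ c ∈ v', weight c.1 ≤ p ^ m) → ∀ a : Letter n, weight a.1 ≤ p ^ m →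
      h (gen p m A (snocIdx kh k) (u.map (fun a => snocLetter a 0) ++ snocLetter a 0 :: b' :: v')) =
      h' (gen p m A (snocIdx kh k)
        (u.map (fun a => snocLetter a 0) ++ snocLetter a 0 :: b' :: v')) := by
    intro b' v' hlen hb' hv' a ha
    have := ih _ hlen (u ++ [a]) b' v' (by
      intro c hc
      rcases List.mem_append.1 hc with hc | hc
      · exact hu c hc
      · rw [List.mem_singleton.1 hc]; exact ha) hb' hv' rfl
    simpa only [List.map_append, List.map_cons, List.map_nil, List.append_assoc,
      List.cons_append, List.nil_append] using this
  have low : ∀ (b : Letter (n + 1)) (v : List (Letter (n + 1))), weight b.1 ≤ p ^ m →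
      (∀ c ∈ v, weight c.1 ≤ p ^ m) → (b.1 (Fin.last n) = 0 → v = []) →
      (b.1 = snocIdx 0 (p ^ m) → v = []) →
      h (gen p m A (snocIdx kh k) (u.map (fun a => snocLetter a 0) ++ b :: v)) =
      h' (gen p m A (snocIdx kh k) (u.map (fun a => snocLetter a 0) ++ b :: v)) := by
    rintro ⟨b, hb0⟩ v hb hv h1 h2
    obtain ⟨a, t, rfl⟩ := exists_snocIdx b
    have e1 : (snocIdx a t) (Fin.last n) = t := by simp [snocIdx]
    have e2 : Fin.init (α := fun _ => ℕ) (snocIdx a t) = a := by simp [snocIdx]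
    simp only [e1] at h1
    have hwt : weight a + t ≤ p ^ m := by rwa [weight_snocIdx] at hb
    by_cases ha : a = 0
    · subst ha
      have ht : 0 < t := Nat.pos_of_ne_zero fun h => hb0 (snocIdx_eq_zero.2 ⟨rfl, h⟩)
      have e3 : (0 < (snocIdx (0 : MIdx n) t) (Fin.last n) ∧
          (snocIdx (0 : MIdx n) t) (Fin.last n) < p ^ m) ∨
          ((snocIdx (0 : MIdx n) t) (Fin.last n) = p ^ m ∧ v = []) := by
        rw [e1]
        rcases Nat.lt_or_ge t (p ^ m) with h3 | h3
        · exact Or.inl ⟨ht, h3⟩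
        · have h4 : t = p ^ m := by omega
          exact Or.inr ⟨h4, h2 (congrArg (snocIdx 0) h4)⟩
      exact (hh.eq_moved kh k u _ v hu hb hv e2 hk e3).trans
        (hh'.eq_moved kh k u _ v hu hb hv e2 hk e3).symm
    · have e3 : (v = [] ∧ (snocIdx a t) (Fin.last n) = 0) ∨
          ((snocIdx a t) (Fin.last n) ≠ 0 ∧ Fin.init (α := fun _ => ℕ) (snocIdx a t) ≠ 0) ∨
          ¬ p ^ m ∣ k := by
        rw [e1, e2]
        by_cases ht : t = 0
        · exact Or.inl ⟨h1 ht, ht⟩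
        · exact Or.inr (Or.inl ⟨ht, ha⟩)
      exact (hh.eq_zero kh k u _ v hu hb hv e3).trans (hh'.eq_zero kh k u _ v hu hb hv e3).symm
  obtain _ | ⟨b', v⟩ := v
  · exact low b [] hb hv (fun _ => rfl) fun _ => rfl
  rw [List.forall_mem_cons] at hv
  rw [List.length_cons] at hs
  have step : ∀ b b' : Letter (n + 1), weight b.1 ≤ p ^ m → weight b'.1 ≤ p ^ m →
      b.1 ≠ snocIdx 0 (p ^ m) →
      h (gen p m A (snocIdx kh k) (u.map (fun a => snocLetter a 0) ++ b :: b' :: v)) =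
      h' (gen p m A (snocIdx kh k) (u.map (fun a => snocLetter a 0) ++ b :: b' :: v)) := by
    intro b b' hb hb' hne
    by_cases h0 : b.1 (Fin.last n) = 0
    · obtain ⟨b, hb0⟩ := b
      obtain ⟨a, t, rfl⟩ := exists_snocIdx b
      have e1 : (snocIdx a t) (Fin.last n) = t := by simp [snocIdx]
      simp only [e1] at h0
      subst h0
      have ha : a ≠ 0 := fun h => hb0 (snocIdx_eq_zero.2 ⟨h, rfl⟩)
      rw [weight_snocIdx] at hb
      exact tail b' v (by omega) hb' hv.2 ⟨a, ha⟩ hb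
    · refine low b (b' :: v) hb ?_ (fun h => absurd h h0) (fun h => absurd h hne)
      rw [List.forall_mem_cons]
      exact ⟨hb', hv.2⟩
  by_cases hbN : b.1 = snocIdx 0 (p ^ m)
  swap
  · exact step b b' hb hv.1 hbN
  obtain ⟨E, hE⟩ := exists_prefix p m (u.map (fun a => snocLetter a 0))
  -- The difference of the two maps after the fixed prefix, viewed as a function of the remaining
  -- form, so that it can be applied to the relation.
  let D : Om p m (n + 1) →ₗ[Lam p] LOm p m (n + 1) A :=
    (h - h').restrictScalars (Lam p) ∘ₗ
      TensorProduct.mk (Lam p) _ _ (mono p A (snocIdx kh k)) ∘ₗ E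
  have hD : ∀ w, D (cls p m w) =
      h (gen p m A (snocIdx kh k) (u.map (fun a => snocLetter a 0) ++ w)) -
      h' (gen p m A (snocIdx kh k) (u.map (fun a => snocLetter a 0) ++ w)) := by
    intro w
    rw [gen_eq, hE]
    rfl
  obtain ⟨b', hb'0⟩ := b'
  obtain ⟨a, l, rfl⟩ := exists_snocIdx b'
  have hb'w := hv.1
  rw [weight_snocIdx] at hb'w
  have hK : p ^ m < weight (snocIdx a (p ^ m + l)) := by
    have : weight (snocIdx a l) ≠ 0 := fun h => hb'0 (weight_eq_zero.1 h)
    rw [weight_snocIdx] at this ⊢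
    omega
  -- All terms of the relation other than the one that starts with (0, p^m) are annihilated by D, by
  -- `step` or because a letter is zero or too large.
  have rel := congrArg D (sum_formMul_formMul p m hK (cls p m v))
  rw [map_sum, map_zero, Finset.sum_eq_single_of_mem (snocIdx 0 (p ^ m), snocIdx a l)
    (by rw [mem_antidiagonal, snocIdx_add, zero_add]), map_smul, angle_snocIdx,
    angle_zero_right, one_mul] at rel
  · have h1 := (isUnit_angle₁_of_dvd p m (dvd_refl (p ^ m)) l).smul_eq_zero.1 rel
    have h2 : formMul p m (snocIdx 0 (p ^ m)) (formMul p m (snocIdx a l) (cls p m v)) =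
        cls p m (b :: ⟨snocIdx a l, hb'0⟩ :: v) := by
      rw [cls_cons, cls_cons, hbN]
    rw [h2, hD] at h1
    exact sub_eq_zero.1 h1
  · rintro ⟨x, y⟩ hxy hne
    rw [mem_antidiagonal] at hxy
    rw [map_smul]
    simp only at hxy ⊢
    by_cases hx : x = 0
    · simp [hx]
    by_cases hy : y = 0
    · simp [hy]
    rcases Nat.lt_or_ge (p ^ m) (weight x) with hwx | hwx
    · simp [formMul_eq_zero p m hwx]
    rcases Nat.lt_or_ge (p ^ m) (weight y) with hwy | hwy
    · simp [formMul_eq_zero p m hwy]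
    have h2 : formMul p m x (formMul p m y (cls p m v)) = cls p m (⟨x, hx⟩ :: ⟨y, hy⟩ :: v) := by
      rw [cls_cons, cls_cons]
    rw [h2, hD, step ⟨x, hx⟩ ⟨y, hy⟩ hwx hwy, sub_self, smul_zero]
    intro h3
    simp only at h3
    refine hne (Prod.ext h3 ?_)
    simp only
    refine add_left_cancel (a := x) ?_
    rw [hxy, h3, snocIdx_add, zero_add]

lemma IsIntegration.eq (hh : IsIntegration p m A h) (hh' : IsIntegration p m A h') : h = h' := by
  refine LOm_hom_ext p m A fun K' w => ?_
  obtain _ | ⟨b, v⟩ := w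
  · have h0 : gen p m A K' [] ∈ LOmDeg p m (n + 1) A 0 := tmul_cls_mem p m A _ []
    rw [hh.map_deg_zero _ h0, hh'.map_deg_zero _ h0]
  by_cases hw : ∀ c ∈ b :: v, weight c.1 ≤ p ^ m
  swap
  · push Not at hw
    obtain ⟨c, hc, hcw⟩ := hw
    rw [gen_eq, cls_eq_zero p m hc hcw, TensorProduct.tmul_zero, map_zero, map_zero]
  rw [List.forall_mem_cons] at hw
  obtain ⟨kh, k, rfl⟩ := exists_snocIdx K'
  by_cases hk : p ^ m ∣ k
  · exact hh.gen_cons_eq hh' kh hk [] b v (by simp) hw.1 hw.2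
  · exact (hh.eq_zero kh k [] b v (by simp) hw.1 hw.2 (Or.inr (Or.inr hk))).trans
      (hh'.eq_zero kh k [] b v (by simp) hw.1 hw.2 (Or.inr (Or.inr hk))).symm

variable (n p m A) in
lemma integration_homotopy :
    integration p m A ∘ₗ dLOm p m (n + 1) A + dLOm p m (n + 1) A ∘ₗ integration p m A =
      LinearMap.id - piLOm p m A n :=
  LOm_hom_ext p m A fun k w => homotopy_mono p m A k (cls p m w)

end uniqueness

end QJet

end

theorem mainTheorem12 (p : ℕ) [Fact p.Prime] (m n : ℕ) (A : Type*) [CommRing A]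
    [Algebra (QJet.Lam p) A] [IsAdicComplete (QJet.adicIdeal p A) A] :
    (∀ k l : ℕ, p ^ m ∣ k → 0 < l → l ≤ p ^ m → IsUnit (QJet.angle₁ p m (k + l) k)) ∧
    ∃ h : QJet.LOm p m (n + 1) A →ₗ[A] QJet.LOm p m (n + 1) A,
      QJet.IsIntegration p m A h ∧
      (∀ h' : QJet.LOm p m (n + 1) A →ₗ[A] QJet.LOm p m (n + 1) A,
        QJet.IsIntegration p m A h' → h' = h) ∧
      h ∘ₗ QJet.dLOm p m (n + 1) A + QJet.dLOm p m (n + 1) A ∘ₗ h =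
        LinearMap.id - QJet.piLOm p m A n :=
  ⟨fun _ l hk _ _ => QJet.isUnit_angle₁_of_dvd p m hk l, QJet.integration p m A,
    QJet.isIntegration_integration p m A,
    fun _ hh' => hh'.eq (QJet.isIntegration_integration p m A),
    QJet.integration_homotopy p m n A⟩
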